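/- Let $d\ge 1$, $\alpha>0$, $0<r<\infty$ and $s_*>0$. For $f$ on $\mathbb R^d$ write $\widehat f(\xi)=\int e^{-ix\cdot\xi}f(x)\,dx$, $e^{it(-\Delta)^{\alpha/2}}f(x)=(2\pi)^{-d}\int e^{i(x\cdot\xi+t|\xi|^\alpha)}\widehat f(\xi)\,d\xi$ and $\|f\|_{H^\sigma}=\|(1+|\cdot|^2)^{\sigma/2}\widehat f\,\|_{L^2(\mathbb R^d)}$. For $0<\gamma\le d$, a nonnegative Borel measure $\mu$ on $\mathbb R^d$ is called $\gamma$-dimensional if there is a finite constant $C_\mu$ with $\mu(B(x,\rho))\le C_\mu\rho^\gamma$ for all $x\in\mathbb R^d$, $\rho>0$; $\langle\mu\rangle_\gamma$ denotes the infimum of such $C_\mu$. A real sequence $\{t_n\}$ belongs to $\ell^{r,\infty}(\mathbb N)$ if $\sup_{\delta>0}\delta^r\,\#\{n:|t_n|\ge\delta\}<\infty$. Put $$\tilde s_*=\frac{r\alpha}{r\min\{\alpha,1\}+2s_*}\,s_* .$$ (i) Let $0<\gamma\le d$ and suppose there is a constant $C$ such that, for every $\gamma$-dimensional measure $\mu$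 and every Schwartz function $f$, $$\Big\|\sup_{0<t<1}\big|e^{it(-\Delta)^{\alpha/2}}f\big|\Big\|_{L^2(B(0,1),d\mu)}\le C\langle\mu\rangle_\gamma^{1/2}\|f\|_{H^{\frac{d-\gamma}2+s_*}} .$$ Then for every $\{t_n\}\in\ell^{r,\infty}(\mathbb N)$ there is a constant $C'>0$ such that, for every $s\ge\min\{s_*,\tilde s_*\}$, every $\gamma$-dimensional $\mu$ and every $f\in H^{\frac{d-\gamma}2+s}(\mathbb R^d)$, $$\Big\|\sup_{n\in\mathbb N}\big|e^{it_n(-\Delta)^{\alpha/2}}f\big|\Big\|_{L^2(B(0,1),d\mu)}\le C'\langle\mu\rangle_\gamma^{1/2}\|f\|_{H^{\frac{d-\gamma}2+s}} .$$ Here each $e^{it_n(-\Delta)^{\alpha/2}}f$ is understood as the limit in $L^2(B(0,1),d\mu)$, as $N\to\infty$, of $(2\pi)^{-d}\int_{|\xi|<N}e^{i(x\cdot\xi+t_n|\xi|^\alpha)}\widehat f(\xi)\,d\xi$, and the existence of these limits is part of the conclusion. (ii) Suppose there is a constant $C$ such that $\big\|\sup_{0<t\le1}|e^{it(-\Delta)^{\alpha/2}}f|\big\|_{L^2(B(0,1))}\le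 C\|f\|_{H^{s_*}}$ for every Schwartz function $f$, with Lebesgue measure on $B(0,1)$. Then for every $\{t_n\}\in\ell^{r,\infty}(\mathbb N)$ there is a constant $C'>0$ such that $\big\|\sup_{n}|e^{it_n(-\Delta)^{\alpha/2}}f|\big\|_{L^2(B(0,1))}\le C'\|f\|_{H^{s}}$ for every $s\ge\min\{s_*,\tilde s_*\}$ and every $f\in H^s(\mathbb R^d)$, with $e^{it_n(-\Delta)^{\alpha/2}}f$ understood as in (i). -/

import Mathlib

open MeasureTheory Filter Topology
open scoped ENNReal NNReal SchwartzMap FourierTransform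

noncomputable section

namespace SeqSchrodinger

/-- `f̂(ξ) = ∫ exp(-i x·ξ) f(x) dx` for `f ∈ L²(ℝᵈ)`, extended from Schwartz functions by Plancherel.
Mathlib's `𝓕` has the phase `-2π i x·η`, hence the dilation `ξ = 2π η`. -/
def fourierHat {d : ℕ} (f : Lp ℂ 2 (volume : Measure (EuclideanSpace ℝ (Fin d)))) :
    EuclideanSpace ℝ (Fin d) → ℂ :=
  fun ξ => (𝓕 f : Lp ℂ 2 (volume : Measure (EuclideanSpace ℝ (Fin d)))) ((2 * Real.pi)⁻¹ • ξ)

/-- On Schwartz functions `fourierHat` is the classical integral. -/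
theorem fourierHat_schwartz {d : ℕ} (f : 𝓢(EuclideanSpace ℝ (Fin d), ℂ)) :
    fourierHat (f.toLp 2 volume) =ᵐ[volume]
      fun ξ => ∫ x, Complex.exp (-(Complex.I * ((inner ℝ x ξ : ℝ) : ℂ))) * f x := by
  have h := SchwartzMap.coeFn_toLp (𝓕 f) 2 (volume : Measure (EuclideanSpace ℝ (Fin d)))
  rw [← SchwartzMap.toLp_fourier_eq] at h
  have hq : Measure.QuasiMeasurePreserving
      (fun ξ : EuclideanSpace ℝ (Fin d) => (2 * Real.pi)⁻¹ • ξ) volume volume := by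
    refine ⟨by fun_prop, ?_⟩
    rw [Measure.map_addHaar_smul _ (by positivity)]
    exact Measure.smul_absolutelyContinuous
  filter_upwards [hq.ae h] with ξ hξ
  unfold fourierHat
  rw [hξ, SchwartzMap.fourier_coe, Real.fourier_eq']
  congr 1
  ext x
  rw [inner_smul_right, smul_eq_mul]
  congr 2
  push_cast
  field_simp

/-- `‖f‖_{H^σ} = ‖(1+|·|²)^{σ/2} f̂‖_{L²} ∈ [0,∞]`. For `σ ≥ 0` the space `H^σ(ℝᵈ)` is the set of
`f ∈ L²(ℝᵈ)` with `sobolevNorm σ f < ∞`. -/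
def sobolevNorm {d : ℕ} (σ : ℝ) (f : Lp ℂ 2 (volume : Measure (EuclideanSpace ℝ (Fin d)))) : ℝ≥0∞ :=
  eLpNorm (fun ξ => (((1 + ‖ξ‖ ^ 2) ^ (σ / 2) : ℝ) : ℂ) * fourierHat f ξ) 2 volume

/-- `(2π)^{-d} ∫_A exp(i(x·ξ + t|ξ|^α)) f̂(ξ) dξ`, the part of `e^{it(-Δ)^{α/2}} f (x)` coming from
frequencies in `A`. -/
def propagatorOn {d : ℕ} (α : ℝ) (A : Set (EuclideanSpace ℝ (Fin d)))
    (f : Lp ℂ 2 (volume : Measure (EuclideanSpace ℝ (Fin d)))) (t : ℝ) (x : EuclideanSpace ℝ (Fin d)) : ℂ :=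
  (((2 * Real.pi) ^ d)⁻¹ : ℝ) *
    ∫ ξ in A, Complex.exp (Complex.I * ((inner ℝ x ξ + t * ‖ξ‖ ^ α : ℝ) : ℂ)) * fourierHat f ξ

/-- `e^{it(-Δ)^{α/2}} f (x)`, given by the Fourier integral over all frequencies. It is used where
this integral converges absolutely, in particular for Schwartz `f`. -/
def propagator {d : ℕ} (α : ℝ) (f : Lp ℂ 2 (volume : Measure (EuclideanSpace ℝ (Fin d)))) (t : ℝ)
    (x : EuclideanSpace ℝ (Fin d)) : ℂ :=
  propagatorOn α Set.univ f t x

/-- `u` is (a version of) `e^{it(-Δ)^{α/2}} f` as an element of `L²(B(0,1), dμ)`: the limit in that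
space of the absolutely convergent integrals over the frequencies `|ξ| < N`, as `N → ∞`.
Such a `u` is unique up to `μ`-null subsets of `B(0,1)`. -/
def IsPropagatorTrace {d : ℕ} (α : ℝ) (μ : Measure (EuclideanSpace ℝ (Fin d)))
    (f : Lp ℂ 2 (volume : Measure (EuclideanSpace ℝ (Fin d)))) (t : ℝ)
    (u : EuclideanSpace ℝ (Fin d) → ℂ) : Prop :=
  MemLp u 2 (μ.restrict (Metric.ball 0 1)) ∧
  Tendsto (fun N : ℕ => eLpNorm (fun x => propagatorOn α (Metric.ball 0 (N : ℝ)) f t x - u x) 2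
    (μ.restrict (Metric.ball 0 1))) atTop (𝓝 0)

/-- `μ(B(x,ρ)) ≤ C ρ^γ` for all balls. -/
def GrowthBound {d : ℕ} (γ : ℝ) (μ : Measure (EuclideanSpace ℝ (Fin d))) (C : ℝ≥0) : Prop :=
  ∀ (x : EuclideanSpace ℝ (Fin d)) (ρ : ℝ), 0 < ρ →
    μ (Metric.ball x ρ) ≤ C * ENNReal.ofReal (ρ ^ γ)

/-- `μ` is `γ`-dimensional. -/
def IsDimensional {d : ℕ} (γ : ℝ) (μ : Measure (EuclideanSpace ℝ (Fin d))) : Prop :=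
  ∃ C : ℝ≥0, GrowthBound γ μ C

/-- `⟨μ⟩_γ`, the infimum of the admissible constants. -/
def growthConst {d : ℕ} (γ : ℝ) (μ : Measure (EuclideanSpace ℝ (Fin d))) : ℝ≥0 :=
  sInf {C : ℝ≥0 | GrowthBound γ μ C}

/-- The real sequence `t` belongs to `ℓ^{r,∞}(ℕ)`. -/
def MemWeakEll (r : ℝ) (t : ℕ → ℝ) : Prop :=
  (⨆ δ : ℝ, ⨆ _ : 0 < δ,
    ENNReal.ofReal (δ ^ r) * (({n : ℕ | δ ≤ |t n|}.encard : ℕ∞) : ℝ≥0∞)) < ∞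

/-- `‖ sup_{τ ∈ T} |e^{iτ(-Δ)^{α/2}} f| ‖_{L²(B(0,1),dμ)} ≤ K ‖f‖_{H^σ}` for all Schwartz `f`. -/
def MaximalEstimate {d : ℕ} (α : ℝ) (T : Set ℝ) (σ : ℝ)
    (μ : Measure (EuclideanSpace ℝ (Fin d))) (K : ℝ≥0) : Prop :=
  ∀ f : 𝓢(EuclideanSpace ℝ (Fin d), ℂ),
    eLpNorm (fun x => ⨆ τ ∈ T, ‖propagator α (f.toLp 2 volume) τ x‖ₑ) 2 (μ.restrict (Metric.ball 0 1))
      ≤ K * sobolevNorm σ (f.toLp 2 volume)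

/-- For every `f ∈ H^σ` (`σ ≥ 0`), all `e^{it_n(-Δ)^{α/2}} f` exist as elements of
`L²(B(0,1), dμ)`, and `‖ sup_n |e^{it_n(-Δ)^{α/2}} f| ‖_{L²(B(0,1),dμ)} ≤ K ‖f‖_{H^σ}`. -/
def SeqMaximalEstimate {d : ℕ} (α : ℝ) (t : ℕ → ℝ) (σ : ℝ)
    (μ : Measure (EuclideanSpace ℝ (Fin d))) (K : ℝ≥0) : Prop :=
  ∀ f : Lp ℂ 2 (volume : Measure (EuclideanSpace ℝ (Fin d))), sobolevNorm σ f < ∞ →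
    ∃ u : ℕ → EuclideanSpace ℝ (Fin d) → ℂ,
      (∀ n, IsPropagatorTrace α μ f (t n) (u n)) ∧
      eLpNorm (fun x => ⨆ n, ‖u n x‖ₑ) 2 (μ.restrict (Metric.ball 0 1)) ≤ K * sobolevNorm σ f

/-- The exponent `s̃_* = rα s_* / (r min{α,1} + 2 s_*)`. -/
def sTilde (α r sStar : ℝ) : ℝ :=
  r * α / (r * min α 1 + 2 * sStar) * sStar

end SeqSchrodinger

end

/-!
Up to a constant, the evolution of `f` is the oscillatory integral `osc α g` of its Fourier
transform `g`, which by density may be taken to have bounded support. Decompose `g` into the dyadic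
shells `|ξ| ∼ 2 ^ k` and the indices into the blocks where `|t n| ∼ 2 ^ (-j)`; the weak `ℓ^r`
condition says that block `j` has at most about `2 ^ (r * j)` elements. There are three bounds for
the supremum of `osc α g (t n) - osc α g 0` over one shell and one block.

* Counting the times costs a factor `2 ^ (r * j / 2)` over the estimate for one fixed time.
* If `2 ^ (-j) ≥ 2 ^ (-α * k)`, waves of frequency `R = 2 ^ k` have finite speed, so on a short time
  interval the maximal estimate may be applied on balls of a small radius `ρ`, rescaled to the unit
  ball. Windowed Fourier transforms make this precise, and the rescaling is the reason for working
  with classes of measures that are stable under it.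
* If `2 ^ (-j) ≤ 2 ^ (-α * k)`, then `|exp(ix) - 1| ≤ |x|` is enough.

The exponent `s̃_*` is the one at which the first two bounds balance. Relative to it the blocks
decay exponentially in `|s̃_* k - r j / 2|`, and Schur's test sums them. For `s ≥ s_*` the maximal
estimate applies directly.

Instead of stationary phase, multipliers that depend on time, frequency and position are expanded
into absolutely convergent series of products. The functions with such an expansion form a Banach
algebra, so power series can be applied to them.
-/

noncomputable section

namespace SeqSchrodinger

variable {d : ℕ}

/-! ### Oscillatory integrals and weighted energies -/

/-- The ambient space `ℝᵈ`. -/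
abbrev Space (d : ℕ) := EuclideanSpace ℝ (Fin d)

/-- The plane wave `exp(i(x·ξ + t|ξ|^α))`. -/
def phase (α t : ℝ) (x ξ : Space d) : ℂ :=
  Complex.exp (Complex.I * ((inner ℝ x ξ + t * ‖ξ‖ ^ α : ℝ) : ℂ))

/-- The oscillatory integral `∫ exp(i(x·ξ + t|ξ|^α)) g(ξ) dξ`; up to the factor `(2π)^{-d}` it is
the evolution of the function with Fourier transform `g`. -/
def osc (α : ℝ) (g : Space d → ℂ) (t : ℝ) (x : Space d) : ℂ :=
  ∫ ξ, phase α t x ξ * g ξ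

/-- The squared Sobolev norm `∫ (1+|ξ|²)^σ |g(ξ)|² dξ` of the function with Fourier
transform `g`. -/
def energy (σ : ℝ) (g : Space d → ℂ) : ℝ≥0∞ :=
  ∫⁻ ξ, ENNReal.ofReal ((1 + ‖ξ‖ ^ 2) ^ σ) * ‖g ξ‖ₑ ^ 2

/-- Measurable square integrable functions of bounded support, which serve as the Fourier transforms
of band limited initial data. -/
structure BandLimited (g : Space d → ℂ) : Prop where
  measurable : Measurable g
  sq_lt_top : ∫⁻ ξ, ‖g ξ‖ₑ ^ 2 < ∞
  bounded : ∃ R : ℝ, ∀ ξ, R < ‖ξ‖ → g ξ = 0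

theorem iSup_sq_le {ι : Sort*} {f : ι → ℝ≥0∞} {c : ℝ≥0∞} (h : ∀ i, f i ^ 2 ≤ c) :
    (⨆ i, f i) ^ 2 ≤ c := by
  rcases isEmpty_or_nonempty ι with hι | hι
  · simp
  · rw [ENNReal.iSup_pow]
    exact iSup_le h

theorem biSup_sq_le {ι : Type*} {s : Set ι} {f : ι → ℝ≥0∞} {c : ℝ≥0∞}
    (h : ∀ i ∈ s, f i ^ 2 ≤ c) : (⨆ i ∈ s, f i) ^ 2 ≤ c :=
  iSup_sq_le fun i => iSup_sq_le fun hi => h i hi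

theorem add_sq_le_two (a b : ℝ≥0∞) : (a + b) ^ 2 ≤ 2 * a ^ 2 + 2 * b ^ 2 := by
  have h := ENNReal.rpow_add_le_mul_rpow_add_rpow a b one_le_two
  norm_num at h
  rwa [← mul_add]

theorem eLpNorm_two_sq {X F : Type*} [MeasurableSpace X] [TopologicalSpace F] [ContinuousENorm F]
    (f : X → F) (μ : Measure X) : eLpNorm f 2 μ ^ 2 = ∫⁻ x, ‖f x‖ₑ ^ 2 ∂μ := by
  simpa using eLpNorm_nnreal_pow_eq_lintegral (f := f) (p := 2) (μ := μ) two_ne_zero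

theorem eLpNorm_two_le_iff {X F : Type*} [MeasurableSpace X] [TopologicalSpace F]
    [ContinuousENorm F] (f : X → F) (μ : Measure X) (c : ℝ≥0∞) :
    eLpNorm f 2 μ ≤ c ↔ ∫⁻ x, ‖f x‖ₑ ^ 2 ∂μ ≤ c ^ 2 := by
  rw [← eLpNorm_two_sq, ENNReal.pow_le_pow_left_iff two_ne_zero]

theorem norm_phase (α t : ℝ) (x ξ : Space d) : ‖phase α t x ξ‖ = 1 := by
  rw [phase, mul_comm, Complex.norm_exp_ofReal_mul_I]

theorem enorm_phase (α t : ℝ) (x ξ : Space d) : ‖phase α t x ξ‖ₑ = 1 := by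
  rw [← ofReal_norm, norm_phase, ENNReal.ofReal_one]

theorem continuous_phase {α : ℝ} (hα : 0 < α) :
    Continuous fun p : (ℝ × Space d) × Space d => phase α p.1.1 p.1.2 p.2 := by
  have : Continuous fun p : (ℝ × Space d) × Space d => ‖p.2‖ ^ α :=
    (continuous_snd.norm).rpow_const fun _ => Or.inr hα.le
  unfold phase
  fun_prop

theorem measurable_phase {α : ℝ} (hα : 0 < α) (t : ℝ) (x : Space d) :
    Measurable (phase α t x) :=
  ((continuous_phase hα).comp (by fun_prop : Continuous fun ξ : Space d => ((t, x), ξ))).measurable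

theorem integrable_phase_mul {α : ℝ} (hα : 0 < α) {g : Space d → ℂ} (hg : Integrable g)
    (t : ℝ) (x : Space d) : Integrable fun ξ => phase α t x ξ * g ξ :=
  hg.bdd_mul (measurable_phase hα t x).aestronglyMeasurable
    (Eventually.of_forall fun ξ => (norm_phase α t x ξ).le)

theorem continuous_osc {α : ℝ} (hα : 0 < α) {g : Space d → ℂ} (hg : Integrable g) :
    Continuous fun p : ℝ × Space d => osc α g p.1 p.2 := by
  refine continuous_of_dominated (bound := fun ξ => ‖g ξ‖)
    (fun p => (integrable_phase_mul hα hg p.1 p.2).aestronglyMeasurable)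
    (fun p => Eventually.of_forall fun ξ => ?_) hg.norm (Eventually.of_forall fun ξ => ?_)
  · rw [norm_mul, norm_phase, one_mul]
  · exact ((continuous_phase hα).comp
      (by fun_prop : Continuous fun p : ℝ × Space d => (p, ξ))).mul continuous_const

theorem continuous_osc_right {α : ℝ} (hα : 0 < α) {g : Space d → ℂ} (hg : Integrable g) (t : ℝ) :
    Continuous (osc α g t) :=
  (continuous_osc hα hg).comp₂ continuous_const continuous_id

theorem enorm_osc_le (α : ℝ) (g : Space d → ℂ) (t : ℝ) (x : Space d) :
    ‖osc α g t x‖ₑ ≤ ∫⁻ ξ, ‖g ξ‖ₑ :=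
  (enorm_integral_le_lintegral_enorm _).trans_eq (by simp only [enorm_mul, enorm_phase, one_mul])

theorem osc_sub {α : ℝ} (hα : 0 < α) {g h : Space d → ℂ} (hg : Integrable g) (hh : Integrable h)
    (t : ℝ) (x : Space d) : osc α (g - h) t x = osc α g t x - osc α h t x := by
  simp only [osc, Pi.sub_apply, mul_sub]
  exact integral_sub (integrable_phase_mul hα hg t x) (integrable_phase_mul hα hh t x)

theorem osc_congr_ae {α : ℝ} {g h : Space d → ℂ} (hgh : g =ᵐ[volume] h) (t : ℝ) (x : Space d) :
    osc α g t x = osc α h t x :=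
  integral_congr_ae (hgh.mono fun ξ hξ => congrArg (phase α t x ξ * ·) hξ)

theorem lowerSemicontinuous_iSup_osc {α : ℝ} (hα : 0 < α) {g : Space d → ℂ} (hg : Integrable g)
    (T : Set ℝ) : LowerSemicontinuous fun x => ⨆ τ ∈ T, ‖osc α g τ x‖ₑ :=
  lowerSemicontinuous_biSup fun τ _ => (continuous_osc_right hα hg τ).enorm.lowerSemicontinuous

theorem measurable_iSup_osc {α : ℝ} (hα : 0 < α) {g : Space d → ℂ} (hg : Integrable g)
    (T : Set ℝ) : Measurable fun x => ⨆ τ ∈ T, ‖osc α g τ x‖ₑ :=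
  (lowerSemicontinuous_iSup_osc hα hg T).measurable

theorem BandLimited.memLp {g : Space d → ℂ} (hg : BandLimited g) : MemLp g 2 volume := by
  refine ⟨hg.measurable.aestronglyMeasurable, ?_⟩
  have h : eLpNorm g 2 volume ^ 2 < ∞ := by
    rw [eLpNorm_two_sq]
    exact hg.sq_lt_top
  simpa using h

theorem BandLimited.integrable {g : Space d → ℂ} (hg : BandLimited g) : Integrable g := by
  obtain ⟨R, hR⟩ := hg.bounded
  have : IsFiniteMeasure (volume.restrict (Metric.closedBall (0 : Space d) R)) :=
    ⟨by simpa using measure_closedBall_lt_top⟩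
  have hball : IntegrableOn g (Metric.closedBall 0 R) := (hg.memLp.restrict _).integrable one_le_two
  refine (integrableOn_iff_integrable_of_support_subset fun ξ hξ => ?_).1 hball
  by_contra h
  exact hξ (hR ξ (by simpa using h))

theorem continuous_weight (σ : ℝ) : Continuous fun ξ : Space d => (1 + ‖ξ‖ ^ 2) ^ σ :=
  (by fun_prop : Continuous fun ξ : Space d => 1 + ‖ξ‖ ^ 2).rpow_const
    fun ξ => Or.inl (by positivity)

theorem measurable_ofReal_weight (σ : ℝ) :
    Measurable fun ξ : Space d => ENNReal.ofReal ((1 + ‖ξ‖ ^ 2) ^ σ) :=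
  (continuous_weight σ).measurable.ennreal_ofReal

theorem energy_zero (g : Space d → ℂ) : energy 0 g = ∫⁻ ξ, ‖g ξ‖ₑ ^ 2 := by
  simp only [energy, Real.rpow_zero, ENNReal.ofReal_one, one_mul]

theorem energy_mono {σ τ : ℝ} (h : σ ≤ τ) (g : Space d → ℂ) : energy σ g ≤ energy τ g := by
  unfold energy
  gcongr with ξ
  nlinarith [sq_nonneg ‖ξ‖]

theorem energy_congr_ae {σ : ℝ} {g h : Space d → ℂ} (hgh : g =ᵐ[volume] h) :
    energy σ g = energy σ h :=
  lintegral_congr_ae (hgh.mono fun ξ hξ => by simp only [hξ])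

/-- The measure with density `(1+|ξ|²)^σ`, for which `energy σ` is the squared `L²` norm. -/
def weightMeasure (d : ℕ) (σ : ℝ) : Measure (Space d) :=
  volume.withDensity fun ξ => ENNReal.ofReal ((1 + ‖ξ‖ ^ 2) ^ σ)

theorem eLpNorm_weightMeasure_sq (σ : ℝ) (g : Space d → ℂ) :
    eLpNorm g 2 (weightMeasure d σ) ^ 2 = energy σ g := by
  rw [eLpNorm_two_sq, weightMeasure, lintegral_withDensity_eq_lintegral_mul_non_measurable _
    (measurable_ofReal_weight σ) (Eventually.of_forall fun _ => ENNReal.ofReal_lt_top)]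
  rfl

instance (σ : ℝ) : IsLocallyFiniteMeasure (weightMeasure d σ) :=
  IsLocallyFiniteMeasure.withDensity_ofReal (continuous_weight σ)

theorem BandLimited.energy_lt_top {g : Space d → ℂ} (hg : BandLimited g) (σ : ℝ) :
    energy σ g < ∞ := by
  obtain ⟨R, hR⟩ := hg.bounded
  have hle : energy σ g ≤ ENNReal.ofReal ((1 + R ^ 2) ^ |σ|) * ∫⁻ ξ, ‖g ξ‖ₑ ^ 2 := by
    rw [← lintegral_const_mul' _ _ ENNReal.ofReal_ne_top]
    refine lintegral_mono fun ξ => ?_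
    rcases lt_or_ge R ‖ξ‖ with h | h
    · simp [hR ξ h]
    · gcongr
      calc (1 + ‖ξ‖ ^ 2) ^ σ ≤ (1 + ‖ξ‖ ^ 2) ^ |σ| :=
            Real.rpow_le_rpow_of_exponent_le (by nlinarith [sq_nonneg ‖ξ‖]) (le_abs_self σ)
        _ ≤ (1 + R ^ 2) ^ |σ| := by gcongr
  exact hle.trans_lt (ENNReal.mul_lt_top ENNReal.ofReal_lt_top hg.sq_lt_top)

theorem lintegral_weight_neg_lt_top {M : ℝ} (hM : (d : ℝ) < 2 * M) :
    ∫⁻ ξ : Space d, ENNReal.ofReal ((1 + ‖ξ‖ ^ 2) ^ (-M)) < ∞ := by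
  have h : Integrable fun ξ : Space d => (1 + ‖ξ‖ ^ 2) ^ (-(2 * M) / 2) :=
    integrable_rpow_neg_one_add_norm_sq (by simpa using hM)
  rw [show -(2 * M) / 2 = -M by ring] at h
  exact h.lintegral_lt_top

theorem sq_lintegral_enorm_le {g : Space d → ℂ} (hg : AEStronglyMeasurable g volume) (M : ℝ) :
    (∫⁻ ξ, ‖g ξ‖ₑ) ^ 2 ≤
      (∫⁻ ξ : Space d, ENNReal.ofReal ((1 + ‖ξ‖ ^ 2) ^ (-M))) * energy M g := by
  have hw (s : ℝ) := (measurable_ofReal_weight (d := d) s).aemeasurable (μ := volume)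
  have hcancel (ξ : Space d) : ENNReal.ofReal ((1 + ‖ξ‖ ^ 2) ^ (-M / 2)) *
      ENNReal.ofReal ((1 + ‖ξ‖ ^ 2) ^ (M / 2)) = 1 := by
    rw [← ENNReal.ofReal_mul (by positivity), ← Real.rpow_add (by positivity)]
    simp [neg_div]
  have hsq (s : ℝ) (ξ : Space d) : ENNReal.ofReal ((1 + ‖ξ‖ ^ 2) ^ (s / 2)) ^ (2 : ℝ) =
      ENNReal.ofReal ((1 + ‖ξ‖ ^ 2) ^ s) := by
    rw [ENNReal.ofReal_rpow_of_nonneg (by positivity) zero_le_two, ← Real.rpow_mul (by positivity),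
      div_mul_cancel₀ _ two_ne_zero]
  have hölder := ENNReal.lintegral_mul_le_Lp_mul_Lq (volume : Measure (Space d))
    Real.HolderConjugate.two_two (hw (-M / 2)) ((hw (M / 2)).mul hg.enorm)
  simp only [Pi.mul_apply, ← mul_assoc, hcancel, one_mul,
    ENNReal.mul_rpow_of_nonneg _ _ zero_le_two, hsq] at hölder
  refine (pow_le_pow_left' hölder 2).trans_eq ?_
  rw [mul_pow, ← ENNReal.rpow_natCast, ← ENNReal.rpow_natCast, ← ENNReal.rpow_mul,
    ← ENNReal.rpow_mul]
  simp [energy]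

theorem integrable_of_test {h : Space d → ℂ} (hc : HasCompactSupport h)
    (hs : ContDiff ℝ (⊤ : ℕ∞) h) : Integrable h :=
  hs.continuous.integrable_of_hasCompactSupport hc

theorem BandLimited.memLp_weightMeasure {g : Space d → ℂ} (hg : BandLimited g) (σ : ℝ) :
    MemLp g 2 (weightMeasure d σ) := by
  refine ⟨hg.measurable.aestronglyMeasurable, ?_⟩
  have h : eLpNorm g 2 (weightMeasure d σ) ^ 2 < ∞ := by
    rw [eLpNorm_weightMeasure_sq]
    exact hg.energy_lt_top σ
  simpa using h

theorem tendsto_osc_of_tendsto_lintegral {α : ℝ} (hα : 0 < α) {g : Space d → ℂ}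
    (hg : Integrable g) {h : ℕ → Space d → ℂ} (hh : ∀ n, Integrable (h n))
    (hlim : Tendsto (fun n => ∫⁻ ξ, ‖g ξ - h n ξ‖ₑ) atTop (𝓝 0)) (t : ℝ) (x : Space d) :
    Tendsto (fun n => osc α (h n) t x) atTop (𝓝 (osc α g t x)) := by
  rw [tendsto_iff_edist_tendsto_0]
  refine tendsto_of_tendsto_of_tendsto_of_le_of_le tendsto_const_nhds hlim (fun _ => zero_le)
    fun n => ?_
  rw [edist_comm, edist_eq_enorm_sub, ← osc_sub hα hg (hh n)]
  exact enorm_osc_le _ _ _ _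

theorem limsup_energy_le {σ : ℝ} {g : Space d → ℂ} {h : ℕ → Space d → ℂ} (hg : Measurable g)
    (hh : ∀ n, Measurable (h n)) (hlim : Tendsto (fun n => energy σ (g - h n)) atTop (𝓝 0)) :
    limsup (fun n => energy σ (h n)) atTop ≤ energy σ g := by
  have hroot : Tendsto (fun n => eLpNorm (g - h n) 2 (weightMeasure d σ)) atTop (𝓝 0) := by
    simpa [← eLpNorm_weightMeasure_sq, ← ENNReal.rpow_natCast_mul] using hlim.ennrpow_const (1 / 2)
  have htri (n : ℕ) : energy σ (h n) ≤ (eLpNorm g 2 (weightMeasure d σ) +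
      eLpNorm (g - h n) 2 (weightMeasure d σ)) ^ 2 := by
    rw [← eLpNorm_weightMeasure_sq]
    gcongr
    rw [eLpNorm_sub_comm, add_comm]
    simpa using eLpNorm_add_le (μ := weightMeasure d σ) (p := 2)
      ((hh n).sub hg).aestronglyMeasurable hg.aestronglyMeasurable one_le_two
  calc limsup (fun n => energy σ (h n)) atTop ≤ limsup (fun n => (eLpNorm g 2 (weightMeasure d σ) +
        eLpNorm (g - h n) 2 (weightMeasure d σ)) ^ 2) atTop :=
        limsup_le_limsup (Eventually.of_forall htri)
    _ = (eLpNorm g 2 (weightMeasure d σ) + 0) ^ 2 :=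
        (ENNReal.Tendsto.pow (tendsto_const_nhds.add hroot)).limsup_eq
    _ = energy σ g := by rw [add_zero, eLpNorm_weightMeasure_sq]

theorem BandLimited.exists_seq_test {g : Space d → ℂ} (hg : BandLimited g) (σ : ℝ) :
    ∃ h : ℕ → Space d → ℂ, (∀ n, HasCompactSupport (h n) ∧ ContDiff ℝ (⊤ : ℕ∞) (h n)) ∧
      Tendsto (fun n => ∫⁻ ξ, ‖g ξ - h n ξ‖ₑ) atTop (𝓝 0) ∧
      Tendsto (fun n => energy σ (g - h n)) atTop (𝓝 0) := by
  set M : ℝ := max σ (d + 1)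
  have hM : (d : ℝ) < 2 * M := by
    linarith [le_max_right σ ((d : ℝ) + 1), (Nat.cast_nonneg d : (0 : ℝ) ≤ d)]
  choose h hc hs hle using fun n : ℕ => (hg.memLp_weightMeasure M).exist_eLpNorm_sub_le
    ENNReal.ofNat_ne_top one_le_two (Nat.one_div_pos_of_nat (α := ℝ) (n := n))
  have hε : Tendsto (fun n : ℕ => ENNReal.ofReal (1 / ((n : ℝ) + 1))) atTop (𝓝 0) := by
    simpa using ENNReal.tendsto_ofReal (tendsto_one_div_add_atTop_nhds_zero_nat (𝕜 := ℝ))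
  have hlim : Tendsto (fun n => energy M (g - h n)) atTop (𝓝 0) := by
    have hsq := ENNReal.Tendsto.pow (n := 2) (tendsto_of_tendsto_of_tendsto_of_le_of_le
      tendsto_const_nhds hε (fun _ => zero_le) hle)
    simpa [eLpNorm_weightMeasure_sq] using hsq
  refine ⟨h, fun n => ⟨hc n, hs n⟩, ?_, tendsto_of_tendsto_of_tendsto_of_le_of_le
    tendsto_const_nhds hlim (fun _ => zero_le) fun n => energy_mono (le_max_left _ _) _⟩
  have hsq : Tendsto (fun n => (∫⁻ ξ, ‖(g - h n) ξ‖ₑ) ^ 2) atTop (𝓝 0) := by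
    refine tendsto_of_tendsto_of_tendsto_of_le_of_le tendsto_const_nhds
      (by simpa using ENNReal.Tendsto.const_mul hlim (Or.inr (lintegral_weight_neg_lt_top hM).ne))
      (fun _ => zero_le) fun n => sq_lintegral_enorm_le (hg.measurable.aestronglyMeasurable.sub
        (hs n).continuous.aestronglyMeasurable) M
  simpa [← ENNReal.rpow_natCast_mul] using hsq.ennrpow_const (1 / 2)

theorem BandLimited.lintegral_iSup_osc_sq_le_of_test {α : ℝ} (hα : 0 < α) {T : Set ℝ} {σ : ℝ}
    {ν : Measure (Space d)} {c : ℝ≥0∞} (hc : c ≠ ∞)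
    (htest : ∀ h : Space d → ℂ, HasCompactSupport h → ContDiff ℝ (⊤ : ℕ∞) h →
      ∫⁻ x, (⨆ τ ∈ T, ‖osc α h τ x‖ₑ) ^ 2 ∂ν ≤ c * energy σ h)
    {g : Space d → ℂ} (hg : BandLimited g) :
    ∫⁻ x, (⨆ τ ∈ T, ‖osc α g τ x‖ₑ) ^ 2 ∂ν ≤ c * energy σ g := by
  obtain ⟨h, hh, hL1, hE⟩ := hg.exists_seq_test σ
  have hint (n : ℕ) := integrable_of_test (hh n).1 (hh n).2
  have hpt (x : Space d) : (⨆ τ ∈ T, ‖osc α g τ x‖ₑ) ^ 2 ≤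
      liminf (fun n => (⨆ τ ∈ T, ‖osc α (h n) τ x‖ₑ) ^ 2) atTop := by
    refine biSup_sq_le fun τ hτ => ?_
    rw [← (ENNReal.Tendsto.pow
      (tendsto_osc_of_tendsto_lintegral hα hg.integrable hint hL1 τ x).enorm).liminf_eq]
    refine liminf_le_liminf (Eventually.of_forall fun n => ?_)
    gcongr
    exact le_iSup₂ (f := fun τ _ => ‖osc α (h n) τ x‖ₑ) τ hτ
  calc ∫⁻ x, (⨆ τ ∈ T, ‖osc α g τ x‖ₑ) ^ 2 ∂ν
      ≤ ∫⁻ x, liminf (fun n => (⨆ τ ∈ T, ‖osc α (h n) τ x‖ₑ) ^ 2) atTop ∂ν := lintegral_mono hpt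
    _ ≤ liminf (fun n => ∫⁻ x, (⨆ τ ∈ T, ‖osc α (h n) τ x‖ₑ) ^ 2 ∂ν) atTop :=
        lintegral_liminf_le fun n => (measurable_iSup_osc hα (hint n) T).pow_const 2
    _ ≤ limsup (fun n => c * energy σ (h n)) atTop :=
        (liminf_le_liminf (Eventually.of_forall fun n => htest _ (hh n).1 (hh n).2)).trans
          liminf_le_limsup
    _ = c * limsup (fun n => energy σ (h n)) atTop := ENNReal.limsup_const_mul_of_ne_top hc
    _ ≤ c * energy σ g := by
        gcongr
        exact limsup_energy_le hg.measurable (fun n => (hh n).2.continuous.measurable) hE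

theorem lintegral_comp_smul {E : Type*} [NormedAddCommGroup E] [NormedSpace ℝ E]
    [MeasurableSpace E] [BorelSpace E] [FiniteDimensional ℝ E] (μ : Measure E)
    [μ.IsAddHaarMeasure] (F : E → ℝ≥0∞) {r : ℝ} (hr : r ≠ 0) :
    ∫⁻ x, F (r • x) ∂μ = ENNReal.ofReal |(r ^ Module.finrank ℝ E)⁻¹| * ∫⁻ x, F x ∂μ := by
  have h := lintegral_map_equiv (μ := μ) F (MeasurableEquiv.smul (Units.mk0 r hr))
  rw [show ⇑(MeasurableEquiv.smul (Units.mk0 r hr) : E ≃ᵐ E) = (r • ·) from rfl] at h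
  rw [← h, Measure.map_addHaar_smul _ hr, lintegral_smul_measure, smul_eq_mul]

theorem osc_zero_eq_fourier (α : ℝ) (g : Space d → ℂ) (x : Space d) :
    osc α g 0 x = 𝓕 g (-((2 * Real.pi)⁻¹ • x)) := by
  rw [osc, Real.fourier_eq']
  congr 1
  ext ξ
  rw [phase, smul_eq_mul, inner_neg_right, inner_smul_right, real_inner_comm]
  congr 2
  push_cast
  field_simp
  ring

theorem lintegral_osc_zero_of_test (α : ℝ) {h : Space d → ℂ} (hc : HasCompactSupport h)
    (hs : ContDiff ℝ (⊤ : ℕ∞) h) :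
    ∫⁻ x, ‖osc α h 0 x‖ₑ ^ 2 = ENNReal.ofReal ((2 * Real.pi) ^ d) * ∫⁻ ξ, ‖h ξ‖ₑ ^ 2 := by
  let f := hc.toSchwartzMap hs
  have hL2 : eLpNorm (𝓕 f : 𝓢(Space d, ℂ)) 2 volume = eLpNorm f 2 volume := by
    have hnorm := SchwartzMap.norm_fourier_toL2_eq f
    rw [SchwartzMap.norm_toLp, SchwartzMap.norm_toLp] at hnorm
    exact (ENNReal.toReal_eq_toReal_iff' (SchwartzMap.memLp _ 2 _).2.ne
      (SchwartzMap.memLp _ 2 _).2.ne).1 hnorm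
  have hplancherel : ∫⁻ η, ‖𝓕 h η‖ₑ ^ 2 = ∫⁻ ξ, ‖h ξ‖ₑ ^ 2 := by
    rw [← eLpNorm_two_sq, ← eLpNorm_two_sq, show h = f from rfl, ← hL2, SchwartzMap.fourier_coe]
  simp only [osc_zero_eq_fourier]
  rw [lintegral_comp_smul volume (fun x => ‖𝓕 h (-x)‖ₑ ^ 2) (by positivity : (2 * Real.pi)⁻¹ ≠ 0),
    lintegral_neg_eq_self (fun x => ‖𝓕 h x‖ₑ ^ 2), hplancherel, finrank_euclideanSpace_fin,
    inv_pow, inv_inv, abs_of_pos (by positivity)]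

theorem BandLimited.lintegral_osc_zero_le {α : ℝ} (hα : 0 < α) {g : Space d → ℂ}
    (hg : BandLimited g) :
    ∫⁻ x, ‖osc α g 0 x‖ₑ ^ 2 ≤ ENNReal.ofReal ((2 * Real.pi) ^ d) * ∫⁻ ξ, ‖g ξ‖ₑ ^ 2 := by
  have h := hg.lintegral_iSup_osc_sq_le_of_test hα (T := {0}) (σ := 0) (ν := volume)
    (c := ENNReal.ofReal ((2 * Real.pi) ^ d)) ENNReal.ofReal_ne_top fun h hc hs => by
      simpa [energy_zero] using (lintegral_osc_zero_of_test α hc hs).le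
  simpa [energy_zero] using h

theorem quasiMeasurePreserving_smul {E : Type*} [NormedAddCommGroup E] [NormedSpace ℝ E]
    [MeasurableSpace E] [BorelSpace E] [FiniteDimensional ℝ E] (μ : Measure E)
    [μ.IsAddHaarMeasure] {r : ℝ} (hr : r ≠ 0) :
    Measure.QuasiMeasurePreserving (fun x : E => r • x) μ μ := by
  refine ⟨by fun_prop, ?_⟩
  rw [Measure.map_addHaar_smul _ hr]
  exact Measure.smul_absolutelyContinuous

theorem exists_fourierHat_ae_eq {h : Space d → ℂ} (hc : HasCompactSupport h)
    (hs : ContDiff ℝ (⊤ : ℕ∞) h) :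
    ∃ f : 𝓢(Space d, ℂ), fourierHat (f.toLp 2 volume) =ᵐ[volume] h := by
  have hpi : 2 * Real.pi ≠ 0 := by positivity
  let G := (hc.comp_smul hpi).toSchwartzMap (hs.comp (contDiff_const_smul (2 * Real.pi)))
  refine ⟨𝓕⁻ G, ?_⟩
  filter_upwards [(quasiMeasurePreserving_smul volume (inv_ne_zero hpi)).ae
    (SchwartzMap.coeFn_toLp G 2 volume)] with ξ hξ
  rw [fourierHat, SchwartzMap.toLp_fourier_eq, FourierTransform.fourier_fourierInv_eq, hξ]
  change h ((2 * Real.pi) • ((2 * Real.pi)⁻¹ • ξ)) = h ξ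
  rw [smul_inv_smul₀ hpi]

theorem propagatorOn_eq (α : ℝ) {A : Set (Space d)} (hA : MeasurableSet A)
    (f : Lp ℂ 2 (volume : Measure (Space d))) (t : ℝ) (x : Space d) :
    propagatorOn α A f t x =
      (((2 * Real.pi) ^ d)⁻¹ : ℝ) * osc α (A.indicator (fourierHat f)) t x := by
  rw [propagatorOn, osc, ← integral_indicator hA]
  congr 2
  ext ξ
  by_cases h : ξ ∈ A <;> simp [h, phase]

theorem sobolevNorm_sq (σ : ℝ) (f : Lp ℂ 2 (volume : Measure (Space d))) :
    sobolevNorm σ f ^ 2 = energy σ (fourierHat f) := by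
  rw [sobolevNorm, eLpNorm_two_sq, energy]
  congr 1
  ext ξ
  rw [enorm_mul, mul_pow, ← ofReal_norm (_ : ℂ), Complex.norm_real,
    ← ENNReal.ofReal_pow (norm_nonneg _), Real.norm_eq_abs, sq_abs, ← Real.rpow_natCast,
    ← Real.rpow_mul (by positivity)]
  norm_num

theorem enorm_osc_eq_propagator {α : ℝ} {f : Lp ℂ 2 (volume : Measure (Space d))}
    {h : Space d → ℂ} (hf : fourierHat f =ᵐ[volume] h) (t : ℝ) (x : Space d) :
    ‖osc α h t x‖ₑ = ENNReal.ofReal ((2 * Real.pi) ^ d) * ‖propagator α f t x‖ₑ := by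
  have hpos : 0 < (2 * Real.pi) ^ d := by positivity
  rw [propagator, propagatorOn_eq α MeasurableSet.univ, Set.indicator_univ, osc_congr_ae hf,
    enorm_mul, ← mul_assoc, ← ofReal_norm (((((2 * Real.pi) ^ d)⁻¹ : ℝ)) : ℂ),
    Complex.norm_real, ← ENNReal.ofReal_mul hpos.le, Real.norm_of_nonneg (by positivity),
    mul_inv_cancel₀ hpos.ne', ENNReal.ofReal_one, one_mul]

theorem MaximalEstimate.lintegral_le_of_test {α : ℝ} {T : Set ℝ} {σ : ℝ} {μ : Measure (Space d)}
    {K : ℝ≥0} (H : MaximalEstimate α T σ μ K) {h : Space d → ℂ} (hc : HasCompactSupport h)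
    (hs : ContDiff ℝ (⊤ : ℕ∞) h) :
    ∫⁻ x in Metric.ball 0 1, (⨆ τ ∈ T, ‖osc α h τ x‖ₑ) ^ 2 ∂μ ≤
      (ENNReal.ofReal ((2 * Real.pi) ^ d) * K) ^ 2 * energy σ h := by
  obtain ⟨f, hf⟩ := exists_fourierHat_ae_eq hc hs
  have hH := pow_le_pow_left' (H f) 2
  simp only [eLpNorm_two_sq, enorm_eq_self, mul_pow, sobolevNorm_sq, energy_congr_ae hf] at hH
  simp only [enorm_osc_eq_propagator hf, ← ENNReal.mul_iSup, mul_pow]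
  rw [lintegral_const_mul' _ _ (by finiteness), mul_assoc]
  gcongr

theorem MaximalEstimate.bandLimited {α : ℝ} (hα : 0 < α) {T : Set ℝ} {σ : ℝ}
    {μ : Measure (Space d)} {K : ℝ≥0} (H : MaximalEstimate α T σ μ K) {g : Space d → ℂ}
    (hg : BandLimited g) :
    ∫⁻ x in Metric.ball 0 1, (⨆ τ ∈ T, ‖osc α g τ x‖ₑ) ^ 2 ∂μ ≤
      (ENNReal.ofReal ((2 * Real.pi) ^ d) * K) ^ 2 * energy σ g :=
  hg.lintegral_iSup_osc_sq_le_of_test hα (by finiteness) fun _ => H.lintegral_le_of_test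

theorem tsum_mul_sq_le {ι : Type*} (b x : ι → ℝ≥0∞) :
    (∑' i, b i * x i) ^ 2 ≤ (∑' i, b i) * ∑' i, b i * x i ^ 2 := by
  let _ : MeasurableSpace ι := ⊤
  have hölder := ENNReal.lintegral_mul_le_Lp_mul_Lq (Measure.count : Measure ι)
    Real.HolderConjugate.two_two (f := fun i => b i ^ (1 / 2 : ℝ))
    (g := fun i => b i ^ (1 / 2 : ℝ) * x i) measurable_from_top.aemeasurable
    measurable_from_top.aemeasurable
  have hmul (i : ι) : b i ^ (1 / 2 : ℝ) * b i ^ (1 / 2 : ℝ) = b i := by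
    rw [← ENNReal.rpow_add_of_nonneg _ _ (by norm_num) (by norm_num)]
    norm_num
  have hsq (i : ι) : (b i ^ (1 / 2 : ℝ)) ^ (2 : ℝ) = b i := by
    rw [← ENNReal.rpow_mul]
    norm_num
  simp only [Pi.mul_apply, ← mul_assoc, hmul, ENNReal.mul_rpow_of_nonneg _ _ zero_le_two, hsq,
    lintegral_count, ENNReal.rpow_two] at hölder
  refine (pow_le_pow_left' hölder 2).trans_eq ?_
  rw [mul_pow, ← ENNReal.rpow_natCast, ← ENNReal.rpow_natCast, ← ENNReal.rpow_mul,
    ← ENNReal.rpow_mul]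
  simp

/-! ### Separated expansions -/

/-- An expansion `Q(t,x,z) = ∑_j c_j(t) a_j(x) b_j(z)` on `T × X × Z` with `|c_j| ≤ m_j`,
`|a_j|, |b_j| ≤ 1` and `∑_j m_j ≤ M`. Separating the variables turns a multiplier depending on the
time, the frequency and the position into a superposition of products. -/
structure SepExpansion {τ χ ζ : Type*} [MeasurableSpace χ] [MeasurableSpace ζ] (T : Set τ)
    (X : Set χ) (Z : Set ζ) (Q : τ → χ → ζ → ℂ) (M : ℝ≥0) (ι : Type) where
  m : ι → ℝ≥0
  c : ι → τ → ℂ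
  a : ι → χ → ℂ
  b : ι → ζ → ℂ
  measurable_a : ∀ j, Measurable (a j)
  measurable_b : ∀ j, Measurable (b j)
  norm_c_le : ∀ j, ∀ t ∈ T, ‖c j t‖ ≤ m j
  norm_a_le : ∀ j, ∀ x ∈ X, ‖a j x‖ ≤ 1
  norm_b_le : ∀ j, ∀ z ∈ Z, ‖b j z‖ ≤ 1
  tsum_le : ∑' j, (m j : ℝ≥0∞) ≤ M
  hasSum : ∀ t ∈ T, ∀ x ∈ X, ∀ z ∈ Z, HasSum (fun j => c j t * a j x * b j z) (Q t x z)

/-- `Q` has a countable separated expansion of total size at most `M`. These functions form a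
Banach algebra, so that power series can be applied to them. -/
def SepBound {τ χ ζ : Type*} [MeasurableSpace χ] [MeasurableSpace ζ] (T : Set τ) (X : Set χ)
    (Z : Set ζ) (Q : τ → χ → ζ → ℂ) (M : ℝ≥0) : Prop :=
  ∃ (ι : Type) (_ : Countable ι), Nonempty (SepExpansion T X Z Q M ι)

section SepBound

variable {τ χ ζ : Type*} [MeasurableSpace χ] [MeasurableSpace ζ] {T : Set τ} {X : Set χ}
  {Z : Set ζ} {Q Q' : τ → χ → ζ → ℂ} {M M' : ℝ≥0}

namespace SepExpansion

variable {ι : Type}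

theorem norm_term_le (e : SepExpansion T X Z Q M ι) {t : τ} (ht : t ∈ T) {x : χ} (hx : x ∈ X)
    {z : ζ} (hz : z ∈ Z) (j : ι) : ‖e.c j t * e.a j x * e.b j z‖ ≤ e.m j := by
  rw [norm_mul, norm_mul]
  calc ‖e.c j t‖ * ‖e.a j x‖ * ‖e.b j z‖ ≤ e.m j * 1 * 1 := by
        gcongr
        exacts [e.norm_c_le j t ht, e.norm_a_le j x hx, e.norm_b_le j z hz]
    _ = e.m j := by ring

theorem summable_m (e : SepExpansion T X Z Q M ι) : Summable fun j => (e.m j : ℝ) :=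
  NNReal.summable_coe.2
    (ENNReal.tsum_coe_ne_top_iff_summable.1 (e.tsum_le.trans_lt ENNReal.coe_lt_top).ne)

theorem summable_norm (e : SepExpansion T X Z Q M ι) {t : τ} (ht : t ∈ T) {x : χ} (hx : x ∈ X)
    {z : ζ} (hz : z ∈ Z) : Summable fun j => ‖e.c j t * e.a j x * e.b j z‖ :=
  e.summable_m.of_nonneg_of_le (fun _ => norm_nonneg _) (e.norm_term_le ht hx hz)

end SepExpansion

namespace SepBound

theorem mono (h : SepBound T X Z Q M) (hM : M ≤ M') : SepBound T X Z Q M' := by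
  obtain ⟨ι, hι, ⟨e⟩⟩ := h
  exact ⟨ι, hι, ⟨{ e with tsum_le := e.tsum_le.trans (by exact_mod_cast hM) }⟩⟩

theorem congr (h : SepBound T X Z Q M)
    (hQ : ∀ t ∈ T, ∀ x ∈ X, ∀ z ∈ Z, Q t x z = Q' t x z) : SepBound T X Z Q' M := by
  obtain ⟨ι, hι, ⟨e⟩⟩ := h
  exact ⟨ι, hι, ⟨{ e with
    hasSum := fun t ht x hx z hz => hQ t ht x hx z hz ▸ e.hasSum t ht x hx z hz }⟩⟩

theorem comap {τ' : Type*} {T' : Set τ'} (h : SepBound T X Z Q M) (f : τ' → τ)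
    (hf : ∀ t ∈ T', f t ∈ T) : SepBound T' X Z (fun t => Q (f t)) M := by
  obtain ⟨ι, hι, ⟨e⟩⟩ := h
  exact ⟨ι, hι, ⟨{ e with
    c := fun j t => e.c j (f t)
    norm_c_le := fun j t ht => e.norm_c_le j _ (hf t ht)
    hasSum := fun t ht => e.hasSum _ (hf t ht) }⟩⟩

theorem single {c : τ → ℂ} {a : χ → ℂ} {b : ζ → ℂ} (ha : Measurable a) (hb : Measurable b)
    {C A B : ℝ≥0} (hA : 0 < A) (hB : 0 < B) (hc : ∀ t ∈ T, ‖c t‖ ≤ C) (haX : ∀ x ∈ X, ‖a x‖ ≤ A)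
    (hbZ : ∀ z ∈ Z, ‖b z‖ ≤ B) : SepBound T X Z (fun t x z => c t * a x * b z) (C * A * B) := by
  have hnorm (D : ℝ≥0) : ‖((D : ℝ) : ℂ)‖ = D := by
    rw [Complex.norm_real, Real.norm_of_nonneg D.coe_nonneg]
  have hdiv {w : ℂ} {D : ℝ≥0} (hw : ‖w‖ ≤ D) : ‖w / (D : ℝ)‖ ≤ 1 := by
    rw [norm_div, hnorm]
    exact div_le_one_of_le₀ hw D.coe_nonneg
  refine ⟨Unit, inferInstance, ⟨{
    m := fun _ => C * A * B
    c := fun _ t => c t * (A : ℝ) * (B : ℝ)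
    a := fun _ x => a x / (A : ℝ)
    b := fun _ z => b z / (B : ℝ)
    measurable_a := fun _ => ha.div_const _
    measurable_b := fun _ => hb.div_const _
    norm_c_le := fun _ t ht => ?_
    norm_a_le := fun _ x hx => hdiv (haX x hx)
    norm_b_le := fun _ z hz => hdiv (hbZ z hz)
    tsum_le := by simp
    hasSum := fun t _ x _ z _ => ?_ }⟩⟩
  · rw [norm_mul, norm_mul, hnorm, hnorm, NNReal.coe_mul, NNReal.coe_mul]
    gcongr
    exact hc t ht
  · have hA' : ((A : ℝ) : ℂ) ≠ 0 := by exact_mod_cast hA.ne'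
    have hB' : ((B : ℝ) : ℂ) ≠ 0 := by exact_mod_cast hB.ne'
    rw [show c t * a x * b z = c t * (A : ℝ) * (B : ℝ) * (a x / (A : ℝ)) * (b z / (B : ℝ)) by
      field_simp]
    exact hasSum_unique _

theorem ofReal_mul {a : χ → ℝ} {b : ζ → ℝ} (ha : Measurable a) (hb : Measurable b) {A B : ℝ}
    (hA : 0 < A) (hB : 0 < B) (haX : ∀ x ∈ X, |a x| ≤ A) (hbZ : ∀ z ∈ Z, |b z| ≤ B) :
    SepBound T X Z (fun _ x z => ((a x * b z : ℝ) : ℂ)) (A * B).toNNReal := by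
  have h := single (T := T) (X := X) (Z := Z) (c := fun _ => 1) (C := 1)
    (Complex.measurable_ofReal.comp ha) (Complex.measurable_ofReal.comp hb)
    (Real.toNNReal_pos.2 hA) (Real.toNNReal_pos.2 hB) (by simp)
    (fun x hx => by simpa [hA.le] using haX x hx) (fun z hz => by simpa [hB.le] using hbZ z hz)
  simpa [Real.toNNReal_mul hA.le] using h

theorem const (w : ℂ) : SepBound T X Z (fun _ _ _ => w) ‖w‖₊ := by
  simpa using single (T := T) (X := X) (Z := Z) (c := fun _ => w) (a := fun _ => 1)
    (b := fun _ => 1) measurable_const measurable_const (C := ‖w‖₊) one_pos one_pos (by simp)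
    (by simp) (by simp)

theorem norm_le (h : SepBound T X Z Q M) {t : τ} (ht : t ∈ T) {x : χ} (hx : x ∈ X) {z : ζ}
    (hz : z ∈ Z) : ‖Q t x z‖ ≤ M := by
  obtain ⟨ι, _, ⟨e⟩⟩ := h
  rw [← (e.hasSum t ht x hx z hz).tsum_eq]
  refine (tsum_of_norm_bounded e.summable_m.hasSum (e.norm_term_le ht hx hz)).trans ?_
  rw [← NNReal.coe_tsum]
  have hm := e.tsum_le
  rw [← ENNReal.coe_tsum (NNReal.summable_coe.1 e.summable_m)] at hm
  exact_mod_cast hm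

theorem mul (h : SepBound T X Z Q M) (h' : SepBound T X Z Q' M') :
    SepBound T X Z (fun t x z => Q t x z * Q' t x z) (M * M') := by
  obtain ⟨ι, hι, ⟨e⟩⟩ := h
  obtain ⟨κ, hκ, ⟨e'⟩⟩ := h'
  refine ⟨ι × κ, inferInstance, ⟨{
    m := fun p => e.m p.1 * e'.m p.2
    c := fun p t => e.c p.1 t * e'.c p.2 t
    a := fun p x => e.a p.1 x * e'.a p.2 x
    b := fun p z => e.b p.1 z * e'.b p.2 z
    measurable_a := fun p => (e.measurable_a _).mul (e'.measurable_a _)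
    measurable_b := fun p => (e.measurable_b _).mul (e'.measurable_b _)
    norm_c_le := fun p t ht => (norm_mul_le _ _).trans
      (mul_le_mul (e.norm_c_le _ t ht) (e'.norm_c_le _ t ht) (norm_nonneg _) (e.m p.1).coe_nonneg)
    norm_a_le := fun p x hx => (norm_mul_le _ _).trans
      (mul_le_one₀ (e.norm_a_le _ x hx) (norm_nonneg _) (e'.norm_a_le _ x hx))
    norm_b_le := fun p z hz => (norm_mul_le _ _).trans
      (mul_le_one₀ (e.norm_b_le _ z hz) (norm_nonneg _) (e'.norm_b_le _ z hz))
    tsum_le := ?_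
    hasSum := fun t ht x hx z hz => ?_ }⟩⟩
  · rw [ENNReal.tsum_prod']
    simp only [ENNReal.coe_mul, ENNReal.tsum_mul_left, ENNReal.tsum_mul_right]
    exact mul_le_mul' e.tsum_le e'.tsum_le
  · have hsumm : Summable fun p : ι × κ =>
        (e.c p.1 t * e.a p.1 x * e.b p.1 z) * (e'.c p.2 t * e'.a p.2 x * e'.b p.2 z) :=
      summable_mul_of_summable_norm (f := fun j => e.c j t * e.a j x * e.b j z)
        (g := fun j => e'.c j t * e'.a j x * e'.b j z)
        (e.summable_norm ht hx hz) (e'.summable_norm ht hx hz)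
    have hprod := (e.hasSum t ht x hx z hz).mul (e'.hasSum t ht x hx z hz) hsumm
    exact hprod.congr_fun fun p => by ring

theorem hasSum {κ : Type} [Countable κ] {q : κ → τ → χ → ζ → ℂ} {N : κ → ℝ≥0}
    (h : ∀ k, SepBound T X Z (q k) (N k)) (hN : ∑' k, (N k : ℝ≥0∞) ≤ M)
    (hQ : ∀ t ∈ T, ∀ x ∈ X, ∀ z ∈ Z, HasSum (fun k => q k t x z) (Q t x z)) :
    SepBound T X Z Q M := by
  choose ι hι e using h
  replace e := fun k => (e k).some
  have hM : ∑' p : Σ k, ι k, ((e p.1).m p.2 : ℝ≥0∞) ≤ M := by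
    rw [ENNReal.tsum_sigma']
    exact (ENNReal.tsum_le_tsum fun k => (e k).tsum_le).trans hN
  refine ⟨Σ k, ι k, inferInstance, ⟨{
    m := fun p => (e p.1).m p.2
    c := fun p => (e p.1).c p.2
    a := fun p => (e p.1).a p.2
    b := fun p => (e p.1).b p.2
    measurable_a := fun p => (e p.1).measurable_a p.2
    measurable_b := fun p => (e p.1).measurable_b p.2
    norm_c_le := fun p => (e p.1).norm_c_le p.2
    norm_a_le := fun p => (e p.1).norm_a_le p.2
    norm_b_le := fun p => (e p.1).norm_b_le p.2
    tsum_le := hM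
    hasSum := fun t ht x hx z hz => ?_ }⟩⟩
  refine HasSum.sigma_of_hasSum (hQ t ht x hx z hz) (fun k => (e k).hasSum t ht x hx z hz) ?_
  exact Summable.of_norm_bounded
    (NNReal.summable_coe.2 (ENNReal.tsum_coe_ne_top_iff_summable.1 (hM.trans_lt (by simp)).ne))
    fun p => (e p.1).norm_term_le ht hx hz p.2

theorem add (h : SepBound T X Z Q M) (h' : SepBound T X Z Q' M') :
    SepBound T X Z (fun t x z => Q t x z + Q' t x z) (M + M') := by
  refine hasSum (κ := Bool) (q := fun k => bif k then Q else Q')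
    (N := fun k => bif k then M else M') (Bool.rec h' h) (by simp) fun t _ x _ z _ => ?_
  simpa using hasSum_fintype fun k : Bool => (bif k then Q else Q') t x z

theorem sum {κ : Type*} (s : Finset κ) {q : κ → τ → χ → ζ → ℂ} {N : κ → ℝ≥0}
    (h : ∀ i, SepBound T X Z (q i) (N i)) :
    SepBound T X Z (fun t x z => ∑ i ∈ s, q i t x z) (∑ i ∈ s, N i) := by
  classical
  induction s using Finset.induction_on with
  | empty => simpa using const (0 : ℂ)
  | insert i s hi ih =>
    simp only [Finset.sum_insert hi]
    exact (h i).add ih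

theorem pow (h : SepBound T X Z Q M) (n : ℕ) :
    SepBound T X Z (fun t x z => Q t x z ^ n) (M ^ n) := by
  induction n with
  | zero => simpa using const (1 : ℂ)
  | succ n ih => simpa only [pow_succ] using ih.mul h

theorem powerSeries (h : SepBound T X Z Q M) {p : ℕ → ℂ} {f : ℂ → ℂ}
    (hp : ∑' n, ((‖p n‖₊ * M ^ n : ℝ≥0) : ℝ≥0∞) ≤ M')
    (hf : ∀ w : ℂ, ‖w‖ ≤ M → HasSum (fun n => p n * w ^ n) (f w)) :
    SepBound T X Z (fun t x z => f (Q t x z)) M' :=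
  hasSum (fun n => (const (p n)).mul (h.pow n)) hp
    fun _ ht _ hx _ hz => hf _ (h.norm_le ht hx hz)

theorem exp_sub_one (h : SepBound T X Z Q M) :
    SepBound T X Z (fun t x z => Complex.exp (Q t x z) - 1) (Real.toNNReal (Real.exp M - 1)) := by
  let p (n : ℕ) : ℂ := if n = 0 then 0 else (n.factorial : ℂ)⁻¹
  have hp (w : ℂ) : HasSum (fun n => p n * w ^ n) (Complex.exp w - 1) := by
    have hexp : HasSum (fun n : ℕ => (n.factorial : ℂ)⁻¹ * w ^ n) (Complex.exp w) := by
      rw [Complex.exp_eq_exp_ℂ]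
      simpa using NormedSpace.exp_series_hasSum_exp' (𝕂 := ℂ) w
    exact (hexp.sub (hasSum_ite_eq (0 : ℕ) (1 : ℂ))).congr_fun fun n => by
      by_cases hn : n = 0 <;> simp [p, hn]
  refine h.powerSeries (p := p) (f := fun w => Complex.exp w - 1) (ENNReal.tsum_coe_eq ?_).le
    fun w _ => hp w
  rw [← NNReal.hasSum_coe, Real.coe_toNNReal _ (sub_nonneg.2 (Real.one_le_exp M.coe_nonneg)),
    ← Complex.hasSum_ofReal]
  push_cast
  exact (hp (M : ℝ)).congr_fun fun n => by by_cases hn : n = 0 <;> simp [p, hn]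

theorem exp (h : SepBound T X Z Q M) :
    SepBound T X Z (fun t x z => Complex.exp (Q t x z)) (Real.toNNReal (Real.exp M)) := by
  have hadd := h.exp_sub_one.add (const (1 : ℂ))
  simp only [sub_add_cancel] at hadd
  refine hadd.mono (le_of_eq ?_)
  ext
  simp [Real.coe_toNNReal _ (sub_nonneg.2 (Real.one_le_exp M.coe_nonneg)),
    Real.coe_toNNReal _ (Real.exp_pos _).le]

theorem log_one_add (h : SepBound T X Z Q M) (hM : M ≤ 1 / 2) :
    SepBound T X Z (fun t x z => Complex.log (1 + Q t x z)) (2 * M) := by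
  let p (n : ℕ) : ℂ := (-1) ^ (n + 1) / n
  have hp (n : ℕ) : ‖p n‖₊ ≤ 1 := by
    rw [← NNReal.coe_le_coe, coe_nnnorm, norm_div, norm_pow, norm_neg, norm_one, one_pow,
      Complex.norm_natCast, one_div]
    exact Nat.cast_inv_le_one n
  refine h.powerSeries (p := p) (f := fun w => Complex.log (1 + w)) ?_ fun w hw => ?_
  · have hle (n : ℕ) : ((‖p (n + 1)‖₊ * M ^ (n + 1) : ℝ≥0) : ℝ≥0∞) ≤ M * 2⁻¹ ^ n := by
      rw [show (M : ℝ≥0∞) * 2⁻¹ ^ n = ((1 * (M * 2⁻¹ ^ n) : ℝ≥0) : ℝ≥0∞) by push_cast; ring,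
        ENNReal.coe_le_coe, pow_succ' M]
      gcongr
      exacts [hp _, by simpa using hM]
    rw [tsum_eq_zero_add' ENNReal.summable]
    calc ((‖p 0‖₊ * M ^ 0 : ℝ≥0) : ℝ≥0∞) + ∑' n, ((‖p (n + 1)‖₊ * M ^ (n + 1) : ℝ≥0) : ℝ≥0∞)
        ≤ 0 + ∑' n : ℕ, (M : ℝ≥0∞) * 2⁻¹ ^ n := add_le_add (by simp [p]) (ENNReal.tsum_le_tsum hle)
      _ = (2 * M : ℝ≥0) := by
        rw [ENNReal.tsum_mul_left, ENNReal.tsum_geometric, ENNReal.one_sub_inv_two, inv_inv,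
          zero_add, ENNReal.coe_mul, ENNReal.coe_ofNat, mul_comm]
  · have hw1 : ‖w‖ < 1 := hw.trans_lt (by exact_mod_cast hM.trans_lt (by norm_num))
    exact (Complex.hasSum_taylorSeries_log hw1).congr_fun fun n => by ring

end SepBound

end SepBound

theorem GrowthBound.isLocallyFiniteMeasure {γ : ℝ} {μ : Measure (Space d)} {A : ℝ≥0}
    (h : GrowthBound γ μ A) : IsLocallyFiniteMeasure μ :=
  ⟨fun x => ⟨Metric.ball x 1, Metric.ball_mem_nhds x one_pos,
    (h x 1 one_pos).trans_lt (ENNReal.mul_lt_top ENNReal.coe_lt_top ENNReal.ofReal_lt_top)⟩⟩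

theorem lintegral_lintegral_ball {E : Type*} [NormedAddCommGroup E] [MeasurableSpace E]
    [BorelSpace E] [SecondCountableTopology E] (ν μ : Measure E) [ν.IsAddHaarMeasure] [SFinite ν]
    [SFinite μ] {F : E → ℝ≥0∞} (hF : Measurable F) (r : ℝ) :
    ∫⁻ k, ∫⁻ x in Metric.ball k r, F x ∂μ ∂ν = ν (Metric.ball 0 r) * ∫⁻ x, F x ∂μ := by
  have hmeas : Measurable (Function.uncurry fun k x => (Metric.ball k r).indicator F x) :=
    (hF.comp measurable_snd).indicator
      (measurableSet_lt (f := fun p : E × E => dist p.2 p.1) (by fun_prop) measurable_const)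
  have hcomm (k x : E) :
      (Metric.ball k r).indicator F x = (Metric.ball x r).indicator (fun _ => F x) k := by
    classical rw [Set.indicator_apply, Set.indicator_apply, Metric.mem_ball_comm]
  simp only [← lintegral_indicator measurableSet_ball]
  rw [lintegral_lintegral_swap hmeas.aemeasurable]
  simp only [hcomm, lintegral_indicator_const measurableSet_ball, Measure.addHaar_ball_center]
  rw [lintegral_mul_const _ hF, mul_comm]

theorem enorm_integral_le_tsum {Y : Type*} [MeasurableSpace Y] {ν : Measure Y} {ι : Type*}
    [Countable ι] {f : ι → Y → ℂ} {F : Y → ℂ} {G : Y → ℝ} {m : ι → ℝ} (hG : Integrable G ν)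
    (hm : Summable m) (hf : ∀ j, AEStronglyMeasurable (f j) ν) (hle : ∀ j y, ‖f j y‖ ≤ m j * G y)
    (hF : ∀ y, HasSum (fun j => f j y) (F y)) :
    ‖∫ y, F y ∂ν‖ₑ ≤ ∑' j, ‖∫ y, f j y ∂ν‖ₑ := by
  have hint (j : ι) : Integrable (f j) ν :=
    (hG.const_mul (m j)).mono' (hf j) (Eventually.of_forall (hle j))
  have hsum : Summable fun j => ∫ y, ‖f j y‖ ∂ν := by
    refine (hm.mul_right (∫ y, G y ∂ν)).of_nonneg_of_le
      (fun j => integral_nonneg fun _ => norm_nonneg _) fun j => ?_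
    rw [← integral_const_mul]
    exact integral_mono (hint j).norm (hG.const_mul _) (hle j)
  have hterm := hasSum_integral_of_summable_integral_norm hint hsum
  simp only [fun y => (hF y).tsum_eq] at hterm
  have hnorm : Summable fun j => ‖∫ y, f j y ∂ν‖ :=
    hsum.of_nonneg_of_le (fun _ => norm_nonneg _) fun j => norm_integral_le_integral_norm _
  rw [← hterm.tsum_eq, ← ofReal_norm]
  refine (ENNReal.ofReal_le_ofReal (norm_tsum_le_tsum_norm hnorm)).trans_eq ?_
  rw [ENNReal.ofReal_tsum_of_nonneg (fun _ => norm_nonneg _) hnorm]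
  simp only [ofReal_norm]

theorem lintegral_enorm_mul_sq_le {g a : Space d → ℂ} {c : ℝ≥0}
    (hle : ∀ ξ, g ξ ≠ 0 → ‖a ξ‖ ≤ c) :
    ∫⁻ ξ, ‖a ξ * g ξ‖ₑ ^ 2 ≤ (c : ℝ≥0∞) ^ 2 * ∫⁻ ξ, ‖g ξ‖ₑ ^ 2 := by
  rw [← lintegral_const_mul' _ _ (by finiteness)]
  refine lintegral_mono fun ξ => ?_
  rw [enorm_mul, mul_pow]
  by_cases hξ : g ξ = 0
  · simp [hξ]
  · gcongr
    rw [enorm_eq_nnnorm]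
    exact_mod_cast hle ξ hξ

theorem BandLimited.mul {g a : Space d → ℂ} (hg : BandLimited g) (ha : Measurable a) {c : ℝ≥0}
    (hle : ∀ ξ, g ξ ≠ 0 → ‖a ξ‖ ≤ c) : BandLimited fun ξ => a ξ * g ξ := by
  refine ⟨ha.mul hg.measurable, (lintegral_enorm_mul_sq_le hle).trans_lt
    (ENNReal.mul_lt_top (by finiteness) hg.sq_lt_top), ?_⟩
  obtain ⟨R, hR⟩ := hg.bounded
  exact ⟨R, fun ξ hξ => by simp [hR ξ hξ]⟩

theorem sepBound_exp_inner {R : ℝ} (hR : 0 < R) :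
    SepBound (Metric.ball (0 : Space d) (1 / R)) (Metric.closedBall (0 : Space d) R)
      (Set.univ : Set Unit) (fun y ξ _ => Complex.exp (Complex.I * ((inner ℝ y ξ : ℝ) : ℂ)))
      (Real.toNNReal (Real.exp d)) := by
  have hcoord (i : Fin d) : SepBound (Metric.ball (0 : Space d) (1 / R))
      (Metric.closedBall (0 : Space d) R) (Set.univ : Set Unit)
      (fun y ξ _ => (Complex.I * (y i : ℝ)) * (ξ i : ℝ) * (1 : ℂ)) 1 := by
    have h := SepBound.single (T := Metric.ball (0 : Space d) (1 / R))
      (X := Metric.closedBall (0 : Space d) R) (Z := (Set.univ : Set Unit))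
      (c := fun y : Space d => Complex.I * (y i : ℝ)) (a := fun ξ : Space d => ((ξ i : ℝ) : ℂ))
      (b := fun _ => 1) (by fun_prop) measurable_const (C := Real.toNNReal (1 / R))
      (A := Real.toNNReal R) (B := 1) (Real.toNNReal_pos.2 hR) one_pos
      (fun y hy => by
        rw [norm_mul, Complex.norm_I, one_mul, Complex.norm_real,
          Real.coe_toNNReal _ (by positivity)]
        exact (PiLp.norm_apply_le y i).trans (mem_ball_zero_iff.1 hy).le)
      (fun ξ hξ => by
        rw [Complex.norm_real, Real.coe_toNNReal _ hR.le]
        exact (PiLp.norm_apply_le ξ i).trans (mem_closedBall_zero_iff.1 hξ)) (by simp)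
    refine h.mono (le_of_eq ?_)
    rw [mul_one, ← Real.toNNReal_mul (by positivity), one_div_mul_cancel hR.ne', Real.toNNReal_one]
  refine ((SepBound.sum Finset.univ hcoord).exp.congr fun y _ ξ _ _ _ => ?_).mono (by simp)
  rw [PiLp.inner_apply, Complex.ofReal_sum, Finset.mul_sum]
  congr 1
  refine Finset.sum_congr rfl fun i _ => ?_
  simp only [RCLike.inner_apply, conj_trivial, Complex.ofReal_mul]
  ring

theorem phase_zero_mul_phase (α t : ℝ) (x y ξ : Space d) :
    phase α 0 x ξ * phase α t y ξ = phase α t (x + y) ξ := by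
  rw [phase, phase, phase, ← Complex.exp_add, inner_add_left]
  congr 1
  push_cast
  ring

theorem osc_phase_mul (α : ℝ) (g : Space d → ℂ) (t : ℝ) (x y : Space d) :
    osc α (fun ξ => phase α t y ξ * g ξ) 0 x = osc α g t (x + y) := by
  simp only [osc, ← mul_assoc, phase_zero_mul_phase]

theorem SepExpansion.enorm_osc_le_tsum {τ ζ : Type*} [MeasurableSpace ζ] {T : Set τ}
    {X : Set (Space d)} {Z : Set ζ} {Q : τ → Space d → ζ → ℂ} {M : ℝ≥0} {ι : Type} [Countable ι]
    (e : SepExpansion T X Z Q M ι) {α : ℝ} (hα : 0 < α) {g : Space d → ℂ} (hg : BandLimited g)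
    (hsupp : ∀ ξ, g ξ ≠ 0 → ξ ∈ X) {t : τ} (ht : t ∈ T) {z : ζ} (hz : z ∈ Z) (s : ℝ)
    (x : Space d) :
    ‖osc α (fun ξ => Q t ξ z * g ξ) s x‖ₑ ≤
      ∑' j, e.m j * ‖osc α (fun ξ => e.a j ξ * g ξ) s x‖ₑ := by
  have hband (j : ι) : BandLimited fun ξ => e.a j ξ * g ξ :=
    hg.mul (c := 1) (e.measurable_a j) fun ξ hξ => e.norm_a_le j ξ (hsupp ξ hξ)
  refine (enorm_integral_le_tsum (G := fun ξ => ‖g ξ‖)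
    (f := fun j ξ => e.c j t * e.b j z * (phase α s x ξ * (e.a j ξ * g ξ))) hg.integrable.norm
    e.summable_m (fun j => ((integrable_phase_mul hα
      (hband j).integrable s x).const_mul _).aestronglyMeasurable)
    (fun j ξ => ?_) fun ξ => ?_).trans (ENNReal.tsum_le_tsum fun j => ?_)
  · by_cases hξ : g ξ = 0
    · simp [hξ]
    · calc ‖e.c j t * e.b j z * (phase α s x ξ * (e.a j ξ * g ξ))‖
          = ‖e.c j t * e.a j ξ * e.b j z‖ * ‖g ξ‖ := by
            simp only [norm_mul, norm_phase]
            ring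
        _ ≤ e.m j * ‖g ξ‖ := by
            gcongr
            exact e.norm_term_le ht (hsupp ξ hξ) hz j
  · by_cases hξ : g ξ = 0
    · simp [hξ]
    · rw [show phase α s x ξ * (Q t ξ z * g ξ) = phase α s x ξ * g ξ * Q t ξ z by ring]
      exact ((e.hasSum t ht ξ (hsupp ξ hξ) z hz).mul_left _).congr_fun fun j => by ring
  · rw [integral_const_mul, enorm_mul, ← osc]
    gcongr
    rw [enorm_eq_nnnorm, ENNReal.coe_le_coe, ← NNReal.coe_le_coe, coe_nnnorm, norm_mul,
      ← mul_one (e.m j : ℝ)]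
    exact mul_le_mul (e.norm_c_le j t ht) (e.norm_b_le j z hz) (norm_nonneg _) (e.m j).coe_nonneg

theorem measure_ball_mul_lintegral_sq_le {E : Type*} [NormedAddCommGroup E] [MeasurableSpace E]
    [BorelSpace E] [SecondCountableTopology E] (ν μ : Measure E) [ν.IsAddHaarMeasure] [SFinite ν]
    [SFinite μ] {ι : Type*} [Countable ι] {m : ι → ℝ≥0} {M : ℝ≥0} (hm : ∑' j, (m j : ℝ≥0∞) ≤ M)
    {S : E → ℝ≥0∞} (hS : Measurable S) {P : ι → E → E → ℝ≥0∞} (hP : ∀ j k, Measurable (P j k))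
    {b : ι → E → ℝ≥0∞} (hb : ∀ j, Measurable (b j)) {ρ : ℝ}
    (hPb : ∀ j k, ∫⁻ x in Metric.ball k ρ, P j k x ^ 2 ∂μ ≤ b j k) {B : ℝ≥0∞}
    (hbB : ∀ j, ∫⁻ k, b j k ∂ν ≤ B)
    (hSP : ∀ k, ∀ x ∈ Metric.ball k ρ, S x ≤ ∑' j, m j * P j k x) :
    ν (Metric.ball 0 ρ) * ∫⁻ x, S x ^ 2 ∂μ ≤ (M : ℝ≥0∞) ^ 2 * B := by
  have hball (k : E) : ∫⁻ x in Metric.ball k ρ, S x ^ 2 ∂μ ≤ M * ∑' j, m j * b j k := by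
    calc ∫⁻ x in Metric.ball k ρ, S x ^ 2 ∂μ
        ≤ ∫⁻ x in Metric.ball k ρ, M * ∑' j, m j * P j k x ^ 2 ∂μ :=
          setLIntegral_mono' measurableSet_ball fun x hx => (pow_le_pow_left' (hSP k x hx) 2).trans
            ((tsum_mul_sq_le _ _).trans (mul_le_mul_left hm _))
      _ = M * ∑' j, m j * ∫⁻ x in Metric.ball k ρ, P j k x ^ 2 ∂μ := by
          rw [lintegral_const_mul' _ _ ENNReal.coe_ne_top,
            lintegral_tsum fun j => (((hP j k).pow_const 2).const_mul _).aemeasurable]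
          simp only [lintegral_const_mul' _ _ ENNReal.coe_ne_top]
      _ ≤ M * ∑' j, m j * b j k := by
          gcongr with j
          exact hPb j k
  rw [← lintegral_lintegral_ball ν μ (hS.pow_const 2)]
  calc ∫⁻ k, ∫⁻ x in Metric.ball k ρ, S x ^ 2 ∂μ ∂ν
      ≤ ∫⁻ k, M * ∑' j, m j * b j k ∂ν := lintegral_mono hball
    _ = M * ∑' j, m j * ∫⁻ k, b j k ∂ν := by
        rw [lintegral_const_mul' _ _ ENNReal.coe_ne_top,
          lintegral_tsum fun j => ((hb j).const_mul _).aemeasurable]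
        simp only [lintegral_const_mul' _ _ ENNReal.coe_ne_top]
    _ ≤ M * (M * B) := by
        gcongr
        refine (ENNReal.tsum_le_tsum fun j => mul_le_mul_right (hbB j) _).trans ?_
        rw [ENNReal.tsum_mul_right]
        gcongr
    _ = (M : ℝ≥0∞) ^ 2 * B := by ring

theorem GrowthBound.volume_ball_mul_lintegral_sq_le {γ : ℝ} {μ : Measure (Space d)} {A : ℝ≥0}
    (hμ : GrowthBound γ μ A) {ι : Type*} [Countable ι] {m : ι → ℝ≥0} {M : ℝ≥0}
    (hm : ∑' j, (m j : ℝ≥0∞) ≤ M) {S : Space d → ℝ≥0∞} (hS : Measurable S)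
    {P : ι → Space d → ℝ≥0∞} (hP : ∀ j, Measurable (P j)) {B : ℝ≥0∞}
    (hPB : ∀ j, ∫⁻ k, P j k ^ 2 ≤ B) {ρ : ℝ} (hρ : 0 < ρ)
    (hSP : ∀ k, ∀ x ∈ Metric.ball k ρ, S x ≤ ∑' j, m j * P j k) :
    volume (Metric.ball (0 : Space d) ρ) * ∫⁻ x, S x ^ 2 ∂μ ≤
      A * ENNReal.ofReal (ρ ^ γ) * ((M : ℝ≥0∞) ^ 2 * B) := by
  have := hμ.isLocallyFiniteMeasure
  rw [mul_left_comm]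
  refine measure_ball_mul_lintegral_sq_le volume μ hm hS (P := fun j k _ => P j k)
    (b := fun j k => A * ENNReal.ofReal (ρ ^ γ) * P j k ^ 2) (fun _ _ => measurable_const)
    (fun j => ((hP j).pow_const 2).const_mul _) (fun j k => ?_) (fun j => ?_) hSP
  · rw [setLIntegral_const, mul_comm]
    gcongr
    exact hμ k ρ hρ
  · rw [lintegral_const_mul' _ _ (by finiteness)]
    gcongr
    exact hPB j

/-- The constant `|B(0,1)|⁻¹ (2π)^d e^{2d}` in the estimates for multipliers with separated
variables: averaging over balls, Plancherel, and the square of the size of `e^{iy·ξ}`. -/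
def multiplierConst (d : ℕ) : ℝ≥0 :=
  ((volume (Metric.ball (0 : Space d) 1))⁻¹ * ENNReal.ofReal ((2 * Real.pi) ^ d) *
    ENNReal.ofReal (Real.exp d) ^ 2).toNNReal

theorem coe_multiplierConst (d : ℕ) : (multiplierConst d : ℝ≥0∞) =
    (volume (Metric.ball (0 : Space d) 1))⁻¹ * ENNReal.ofReal ((2 * Real.pi) ^ d) *
      ENNReal.ofReal (Real.exp d) ^ 2 :=
  ENNReal.coe_toNNReal (ENNReal.mul_ne_top (ENNReal.mul_ne_top (ENNReal.inv_ne_top.2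
    (Metric.measure_ball_pos _ _ one_pos).ne') (by finiteness)) (by finiteness))

theorem le_of_volume_ball_inv_mul_le {R : ℝ} (hR : 0 < R) (γ : ℝ) {u v : ℝ≥0∞}
    (h : volume (Metric.ball (0 : Space d) (1 / R)) * u ≤ ENNReal.ofReal ((1 / R) ^ γ) * v) :
    u ≤ (volume (Metric.ball (0 : Space d) 1))⁻¹ * ENNReal.ofReal (R ^ ((d : ℝ) - γ)) * v := by
  have hV : volume (Metric.ball (0 : Space d) 1) ≠ 0 := (Metric.measure_ball_pos _ _ one_pos).ne'
  have hRd : ENNReal.ofReal ((1 / R) ^ d) ≠ 0 := (ENNReal.ofReal_pos.2 (by positivity)).ne'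
  have hpow : ENNReal.ofReal (R ^ ((d : ℝ) - γ)) =
      (ENNReal.ofReal ((1 / R) ^ d))⁻¹ * ENNReal.ofReal ((1 / R) ^ γ) := by
    rw [← ENNReal.ofReal_inv_of_pos (by positivity), ← ENNReal.ofReal_mul (by positivity),
      Real.rpow_sub hR, Real.rpow_natCast, one_div, inv_pow, inv_inv, Real.inv_rpow hR.le]
    rfl
  rw [Measure.addHaar_ball_of_pos _ _ (by positivity), finrank_euclideanSpace_fin] at h
  rw [← one_mul u, ← ENNReal.inv_mul_cancel (mul_ne_zero hRd hV) (by finiteness), mul_assoc]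
  refine (mul_le_mul_right h _).trans_eq ?_
  rw [hpow, ENNReal.mul_inv (Or.inl hRd) (Or.inr hV)]
  ring

theorem GrowthBound.lintegral_iSup_multiplier_le {α γ : ℝ} (hα : 0 < α) {μ : Measure (Space d)}
    {A : ℝ≥0} (hμ : GrowthBound γ μ A) {I : Set ℝ} {R : ℝ} (hR : 0 < R) {q : ℝ → Space d → ℂ}
    (hqm : ∀ t ∈ I, Measurable (q t)) {N : ℝ≥0}
    (hq : SepBound I (Metric.closedBall (0 : Space d) R) (Set.univ : Set Unit)
      (fun t ξ _ => q t ξ) N)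
    {g : Space d → ℂ} (hg : BandLimited g) (hsupp : ∀ ξ, R < ‖ξ‖ → g ξ = 0) :
    ∫⁻ x, (⨆ t ∈ I, ‖osc α (fun ξ => q t ξ * g ξ) 0 x‖ₑ) ^ 2 ∂μ ≤
      multiplierConst d * A * ENNReal.ofReal (R ^ ((d : ℝ) - γ)) * (N : ℝ≥0∞) ^ 2 *
        ∫⁻ ξ, ‖g ξ‖ₑ ^ 2 := by
  have hmem (ξ : Space d) (hξ : g ξ ≠ 0) : ξ ∈ Metric.closedBall (0 : Space d) R :=
    mem_closedBall_zero_iff.2 (not_lt.1 fun h => hξ (hsupp ξ h))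
  have hS : Measurable fun x => ⨆ t ∈ I, ‖osc α (fun ξ => q t ξ * g ξ) 0 x‖ₑ := by
    refine (lowerSemicontinuous_biSup fun t ht => ?_).measurable
    have hband := hg.mul (hqm t ht) fun ξ hξ => hq.norm_le ht (hmem ξ hξ) (Set.mem_univ ())
    exact (continuous_osc_right hα hband.integrable 0).enorm.lowerSemicontinuous
  -- On balls of radius `1/R` the translation `x ↦ x - k` is one more separated multiplier.
  obtain ⟨ι, _, ⟨e⟩⟩ := ((sepBound_exp_inner hR).comap
    (T' := I ×ˢ Metric.ball (0 : Space d) (1 / R)) Prod.snd fun p hp => hp.2).mul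
      (hq.comap Prod.fst fun p hp => hp.1)
  have ha (j : ι) (ξ : Space d) (hξ : g ξ ≠ 0) : ‖e.a j ξ‖ ≤ (1 : ℝ≥0) :=
    e.norm_a_le j ξ (hmem ξ hξ)
  have hband (j : ι) : BandLimited fun ξ => e.a j ξ * g ξ := hg.mul (e.measurable_a j) (ha j)
  have hshift (k x : Space d) (t : ℝ) : osc α (fun ξ => q t ξ * g ξ) 0 x =
      osc α (fun ξ => Complex.exp (Complex.I * ((inner ℝ (x - k) ξ : ℝ) : ℂ)) * q t ξ * g ξ)
        0 k := by
    simpa [phase, mul_assoc] using (osc_phase_mul α (fun ξ => q t ξ * g ξ) 0 k (x - k)).symm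
  have hball := hμ.volume_ball_mul_lintegral_sq_le e.tsum_le hS
    (fun j => (continuous_osc_right hα (hband j).integrable 0).enorm.measurable)
    (fun j => ((hband j).lintegral_osc_zero_le hα).trans
      (mul_le_mul_right (lintegral_enorm_mul_sq_le (ha j)) _)) (one_div_pos.2 hR)
    fun k x hx => iSup₂_le fun t ht => by
      rw [hshift k x t]
      exact e.enorm_osc_le_tsum hα hg hmem (t := (t, x - k))
        ⟨ht, by rwa [mem_ball_zero_iff, ← dist_eq_norm]⟩ (Set.mem_univ ()) 0 k
  rw [mul_comm (A : ℝ≥0∞), mul_assoc] at hball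
  refine (le_of_volume_ball_inv_mul_le hR γ hball).trans_eq ?_
  rw [coe_multiplierConst, ENNReal.coe_mul, ENNReal.coe_one, one_pow, one_mul, ENNReal.ofReal,
    ENNReal.ofReal, ENNReal.ofReal]
  ring

theorem GrowthBound.lintegral_osc_le {α γ : ℝ} (hα : 0 < α) {μ : Measure (Space d)} {A : ℝ≥0}
    (hμ : GrowthBound γ μ A) {R : ℝ} (hR : 0 < R) {g : Space d → ℂ} (hg : BandLimited g)
    (hsupp : ∀ ξ, R < ‖ξ‖ → g ξ = 0) (t : ℝ) :
    ∫⁻ x, ‖osc α g t x‖ₑ ^ 2 ∂μ ≤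
      multiplierConst d * A * ENNReal.ofReal (R ^ ((d : ℝ) - γ)) * ∫⁻ ξ, ‖g ξ‖ₑ ^ 2 := by
  have hq : SepBound ({0} : Set ℝ) (Metric.closedBall (0 : Space d) R) (Set.univ : Set Unit)
      (fun _ ξ _ => phase α t 0 ξ) 1 := by
    simpa using SepBound.single (T := ({0} : Set ℝ)) (X := Metric.closedBall (0 : Space d) R)
      (Z := (Set.univ : Set Unit)) (c := fun _ => 1) (b := fun _ => 1) (measurable_phase hα t 0)
      measurable_const (C := 1) one_pos one_pos (by simp)
      (fun ξ _ => (norm_phase α t 0 ξ).le) (by simp)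
  simpa [osc_phase_mul] using
    hμ.lintegral_iSup_multiplier_le hα hR (fun _ _ => measurable_phase hα t 0) hq hg hsupp

theorem sepBound_mul_norm_rpow {α : ℝ} (hα : 0 ≤ α) {ζ : Type*} [MeasurableSpace ζ] {T : Set ℝ}
    {X : Set (Space d)} {Z : Set ζ} {δ B : ℝ} (hδ : 0 ≤ δ) (hB : 0 < B) (hT : ∀ t ∈ T, |t| ≤ δ)
    (hX : ∀ ξ ∈ X, ‖ξ‖ ≤ B) :
    SepBound T X Z (fun t ξ _ => Complex.I * t * ((‖ξ‖ ^ α : ℝ) : ℂ)) (δ * B ^ α).toNNReal := by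
  have hBα : 0 < B ^ α := Real.rpow_pos_of_pos hB α
  have h := SepBound.single (T := T) (X := X) (Z := Z) (c := fun t : ℝ => Complex.I * t)
    (a := fun ξ : Space d => ((‖ξ‖ ^ α : ℝ) : ℂ)) (b := fun _ => 1)
    (Complex.measurable_ofReal.comp (measurable_norm.pow_const α)) measurable_const
    (C := δ.toNNReal) (A := (B ^ α).toNNReal) (B := 1) (Real.toNNReal_pos.2 hBα) one_pos
    (fun t ht => by simpa [hδ] using hT t ht)
    (fun ξ hξ => by
      rw [Complex.norm_real, Real.coe_toNNReal _ hBα.le, Real.norm_of_nonneg (by positivity)]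
      exact Real.rpow_le_rpow (norm_nonneg _) (hX ξ hξ) hα) (by simp)
  simpa only [mul_one, Real.toNNReal_mul hδ] using h

theorem sepBound_phase_sub_one {α : ℝ} (hα : 0 < α) {R δ : ℝ} (hR : 0 < R) (hδ : 0 < δ)
    (hδR : δ * R ^ α ≤ 1) :
    SepBound (Set.Icc (-δ) δ) (Metric.closedBall (0 : Space d) R) (Set.univ : Set Unit)
      (fun t ξ _ => phase α t 0 ξ - 1) (2 * (δ * R ^ α)).toNNReal := by
  have hpos : 0 ≤ δ * R ^ α := by positivity
  have hexp : Real.exp (δ * R ^ α) - 1 ≤ 2 * (δ * R ^ α) := by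
    have h := Real.abs_exp_sub_one_le (x := δ * R ^ α) (by rwa [abs_of_nonneg hpos])
    rw [abs_of_nonneg hpos] at h
    exact (le_abs_self _).trans h
  have hlin := sepBound_mul_norm_rpow (Z := (Set.univ : Set Unit)) hα.le hδ.le hR
    (fun t ht => abs_le.2 ht) fun ξ : Space d => mem_closedBall_zero_iff.1
  refine (hlin.exp_sub_one.congr fun t _ ξ _ _ _ => ?_).mono ?_
  · rw [phase, inner_zero_left]
    congr 2
    push_cast
    ring
  · rw [Real.coe_toNNReal _ hpos]
    exact Real.toNNReal_le_toNNReal hexp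

theorem GrowthBound.lintegral_iSup_osc_sub_le {α γ : ℝ} (hα : 0 < α) {μ : Measure (Space d)}
    {A : ℝ≥0} (hμ : GrowthBound γ μ A) {R δ : ℝ} (hR : 0 < R) (hδ : 0 < δ)
    (hδR : δ * R ^ α ≤ 1) {g : Space d → ℂ} (hg : BandLimited g)
    (hsupp : ∀ ξ, R < ‖ξ‖ → g ξ = 0) :
    ∫⁻ x, (⨆ t ∈ Set.Icc (-δ) δ, ‖osc α g t x - osc α g 0 x‖ₑ) ^ 2 ∂μ ≤
      4 * multiplierConst d * A * ENNReal.ofReal (R ^ ((d : ℝ) - γ) * (δ * R ^ α) ^ 2) *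
        ∫⁻ ξ, ‖g ξ‖ₑ ^ 2 := by
  have hosc (t : ℝ) (x : Space d) :
      osc α (fun ξ => (phase α t 0 ξ - 1) * g ξ) 0 x = osc α g t x - osc α g 0 x := by
    have hsub : (fun ξ => (phase α t 0 ξ - 1) * g ξ) = (fun ξ => phase α t 0 ξ * g ξ) - g :=
      funext fun ξ => sub_one_mul _ _
    have hshift : osc α g t x = osc α (fun ξ => phase α t 0 ξ * g ξ) 0 x := by
      simpa using (osc_phase_mul α g t x 0).symm
    rw [hsub, osc_sub hα (integrable_phase_mul hα hg.integrable t 0) hg.integrable, hshift]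
  have h := hμ.lintegral_iSup_multiplier_le hα hR
    (fun t _ => (measurable_phase hα t 0).sub_const 1) (sepBound_phase_sub_one hα hR hδ hδR)
    hg hsupp
  simp only [hosc] at h
  refine h.trans_eq ?_
  have hsq : ((Real.toNNReal (2 * (δ * R ^ α)) : ℝ≥0) : ℝ≥0∞) ^ 2 =
      4 * ENNReal.ofReal ((δ * R ^ α) ^ 2) := by
    rw [← ENNReal.ofReal, ← ENNReal.ofReal_pow (by positivity), mul_pow,
      ENNReal.ofReal_mul (by positivity)]
    norm_num
  rw [hsq, ENNReal.ofReal_mul (by positivity)]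
  ring

/-! ### Rescaling and families of measures -/

/-- The datum whose evolution is that of `g` seen at the scale `ρ` around `x₀`, with time measured
in units of `ρ ^ α`. -/
def rescale (α ρ : ℝ) (x₀ : Space d) (g : Space d → ℂ) : Space d → ℂ := fun ξ =>
  ((ρ ^ d)⁻¹ : ℝ) * (phase α 0 x₀ (ρ⁻¹ • ξ) * g (ρ⁻¹ • ξ))

/-- The measure `μ` seen at the scale `ρ` around `x₀`, normalized so that `γ`-dimensional growth
bounds are preserved. -/
def rescaleMeasure (γ ρ : ℝ) (x₀ : Space d) (μ : Measure (Space d)) : Measure (Space d) :=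
  ENNReal.ofReal (ρ ^ (-γ)) • μ.map (fun x => ρ⁻¹ • (x - x₀))

/-- A class of measures stable under rescaling, with a uniform maximal estimate. The class of all
measures of a given growth and the class consisting of Lebesgue measure alone give the two parts of
the theorem. -/
structure MaximalFamily (α γ σ : ℝ) (A K : ℝ≥0) (𝓜 : Set (Measure (Space d))) : Prop where
  growth : ∀ μ ∈ 𝓜, GrowthBound γ μ A
  rescaleMeasure_mem : ∀ μ ∈ 𝓜, ∀ (x₀ : Space d) (ρ : ℝ), 0 < ρ → rescaleMeasure γ ρ x₀ μ ∈ 𝓜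
  maximal : ∀ μ ∈ 𝓜, MaximalEstimate α (Set.Ioo 0 1) σ μ K

theorem phase_inv_smul {α ρ : ℝ} (hρ : 0 < ρ) (τ : ℝ) (y ξ : Space d) :
    phase α (ρ ^ α * τ) (ρ • y) (ρ⁻¹ • ξ) = phase α τ y ξ := by
  have hρα : ρ ^ α ≠ 0 := (Real.rpow_pos_of_pos hρ α).ne'
  rw [phase, phase, real_inner_smul_left, real_inner_smul_right, mul_inv_cancel_left₀ hρ.ne',
    norm_smul, Real.norm_of_nonneg (by positivity), Real.mul_rpow (by positivity) (norm_nonneg _),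
    Real.inv_rpow hρ.le]
  congr 3
  field_simp

theorem osc_rescale {α ρ : ℝ} (hρ : 0 < ρ) (x₀ y : Space d) (g : Space d → ℂ) (τ : ℝ) :
    osc α (rescale α ρ x₀ g) τ y = osc α g (ρ ^ α * τ) (x₀ + ρ • y) := by
  have hint (ξ : Space d) : phase α τ y ξ * rescale α ρ x₀ g ξ = ((ρ ^ d)⁻¹ : ℝ) •
      (phase α (ρ ^ α * τ) (x₀ + ρ • y) (ρ⁻¹ • ξ) * g (ρ⁻¹ • ξ)) := by
    rw [← phase_zero_mul_phase, phase_inv_smul hρ, rescale, Complex.real_smul]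
    ring
  simp only [osc, hint]
  rw [integral_smul, Measure.integral_comp_smul volume
    (fun ξ => phase α (ρ ^ α * τ) (x₀ + ρ • y) ξ * g ξ), finrank_euclideanSpace_fin,
    inv_pow, inv_inv, abs_of_pos (by positivity), inv_smul_smul₀ (by positivity)]

theorem enorm_rescale {α ρ : ℝ} (hρ : 0 < ρ) (x₀ : Space d) (g : Space d → ℂ) (ξ : Space d) :
    ‖rescale α ρ x₀ g ξ‖ₑ = ENNReal.ofReal (ρ ^ d)⁻¹ * ‖g (ρ⁻¹ • ξ)‖ₑ := by
  rw [rescale, enorm_mul, enorm_mul, enorm_phase, one_mul, ← ofReal_norm ((_ : ℝ) : ℂ),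
    Complex.norm_real, Real.norm_of_nonneg (by positivity)]

theorem lintegral_rescale {α ρ : ℝ} (hρ : 0 < ρ) (x₀ : Space d) (g : Space d → ℂ)
    (w : Space d → ℝ≥0∞) :
    ∫⁻ ξ, w ξ * ‖rescale α ρ x₀ g ξ‖ₑ ^ 2 =
      ENNReal.ofReal (ρ ^ d)⁻¹ * ∫⁻ ξ, w (ρ • ξ) * ‖g ξ‖ₑ ^ 2 := by
  have hscale := lintegral_comp_smul volume (fun ξ : Space d => w (ρ • ξ) * ‖g ξ‖ₑ ^ 2)
    (inv_pos.2 hρ).ne'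
  simp only [smul_inv_smul₀ hρ.ne', finrank_euclideanSpace_fin, inv_pow, inv_inv,
    abs_of_pos (pow_pos hρ d)] at hscale
  have hcancel : ENNReal.ofReal (ρ ^ d)⁻¹ * ENNReal.ofReal (ρ ^ d) = 1 := by
    rw [← ENNReal.ofReal_mul (by positivity), inv_mul_cancel₀ (by positivity), ENNReal.ofReal_one]
  simp only [enorm_rescale hρ, mul_pow, mul_left_comm (w _)]
  rw [lintegral_const_mul' _ _ (by finiteness), hscale, sq, mul_assoc,
    ← mul_assoc _ _ (lintegral _ _), hcancel, one_mul]

theorem BandLimited.rescale {α : ℝ} (hα : 0 < α) {g : Space d → ℂ} (hg : BandLimited g) {ρ : ℝ}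
    (hρ : 0 < ρ) (x₀ : Space d) : BandLimited (rescale α ρ x₀ g) := by
  have hsmul : Measurable fun ξ : Space d => ρ⁻¹ • ξ := measurable_const_smul _
  refine ⟨measurable_const.mul
    (((measurable_phase hα 0 x₀).comp hsmul).mul (hg.measurable.comp hsmul)), ?_, ?_⟩
  · have h := lintegral_rescale (α := α) hρ x₀ g 1
    simp only [Pi.one_apply, one_mul] at h
    rw [h]
    exact ENNReal.mul_lt_top (by finiteness) hg.sq_lt_top
  · obtain ⟨R, hR⟩ := hg.bounded
    refine ⟨ρ * R, fun ξ hξ => ?_⟩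
    rw [SeqSchrodinger.rescale, hR, mul_zero, mul_zero]
    rwa [norm_smul, Real.norm_of_nonneg (by positivity), inv_mul_eq_div, lt_div_iff₀' hρ]

theorem preimage_ball_inv_smul_sub (x₀ y : Space d) {ρ : ℝ} (hρ : 0 < ρ) (r : ℝ) :
    (fun x : Space d => ρ⁻¹ • (x - x₀)) ⁻¹' Metric.ball y r =
      Metric.ball (x₀ + ρ • y) (ρ * r) := by
  ext x
  have hsub : ρ⁻¹ • (x - x₀) - y = ρ⁻¹ • (x - (x₀ + ρ • y)) := by
    rw [← sub_sub, smul_sub ρ⁻¹ (x - x₀), inv_smul_smul₀ hρ.ne']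
  rw [Set.mem_preimage, mem_ball_iff_norm, mem_ball_iff_norm, hsub, norm_smul,
    Real.norm_of_nonneg (by positivity), inv_mul_lt_iff₀ hρ]

theorem lintegral_ball_rescaleMeasure (γ : ℝ) {ρ : ℝ} (hρ : 0 < ρ) (x₀ : Space d)
    (μ : Measure (Space d)) {F : Space d → ℝ≥0∞} (hF : Measurable F) :
    ∫⁻ x in Metric.ball 0 1, F x ∂rescaleMeasure γ ρ x₀ μ =
      ENNReal.ofReal (ρ ^ (-γ)) * ∫⁻ x in Metric.ball x₀ ρ, F (ρ⁻¹ • (x - x₀)) ∂μ := by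
  rw [rescaleMeasure, Measure.restrict_smul, lintegral_smul_measure,
    setLIntegral_map measurableSet_ball hF (by fun_prop), preimage_ball_inv_smul_sub x₀ 0 hρ,
    smul_zero, add_zero, mul_one, smul_eq_mul]

theorem iSup_osc_le_iSup_osc_rescale {α : ℝ} {ρ : ℝ} (hρ : 0 < ρ) (g : Space d → ℂ)
    (x₀ x : Space d) :
    ⨆ t ∈ Set.Ioo 0 (ρ ^ α), ‖osc α g t x‖ₑ ≤
      ⨆ τ ∈ Set.Ioo (0 : ℝ) 1, ‖osc α (rescale α ρ x₀ g) τ (ρ⁻¹ • (x - x₀))‖ₑ := by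
  have hρα : 0 < ρ ^ α := Real.rpow_pos_of_pos hρ α
  refine iSup₂_le fun t ht => ?_
  have hosc : osc α (rescale α ρ x₀ g) (t / ρ ^ α) (ρ⁻¹ • (x - x₀)) = osc α g t x := by
    rw [osc_rescale hρ, smul_inv_smul₀ hρ.ne', mul_div_cancel₀ _ hρα.ne', add_sub_cancel]
  rw [← hosc]
  exact le_iSup₂ (f := fun τ (_ : τ ∈ Set.Ioo (0 : ℝ) 1) =>
    ‖osc α (rescale α ρ x₀ g) τ (ρ⁻¹ • (x - x₀))‖ₑ) _
    ⟨div_pos ht.1 hρα, (div_lt_one hρα).2 ht.2⟩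

theorem MaximalFamily.lintegral_ball_le {α γ σ : ℝ} {A K : ℝ≥0} {𝓜 : Set (Measure (Space d))}
    (h𝓜 : MaximalFamily α γ σ A K 𝓜) (hα : 0 < α) {μ : Measure (Space d)} (hμ : μ ∈ 𝓜)
    (x₀ : Space d) {ρ : ℝ} (hρ : 0 < ρ) {g : Space d → ℂ} (hg : BandLimited g) :
    ∫⁻ x in Metric.ball x₀ ρ, (⨆ t ∈ Set.Ioo 0 (ρ ^ α), ‖osc α g t x‖ₑ) ^ 2 ∂μ ≤
      (ENNReal.ofReal ((2 * Real.pi) ^ d) * K) ^ 2 * (ENNReal.ofReal (ρ ^ (γ - d)) *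
        ∫⁻ ξ, ENNReal.ofReal ((1 + ‖ρ • ξ‖ ^ 2) ^ σ) * ‖g ξ‖ₑ ^ 2) := by
  have hbl : BandLimited (rescale α ρ x₀ g) := hg.rescale hα hρ x₀
  have hmax := (h𝓜.maximal _ (h𝓜.rescaleMeasure_mem μ hμ x₀ ρ hρ)).bandLimited hα hbl
  rw [lintegral_ball_rescaleMeasure γ hρ x₀ μ
    ((measurable_iSup_osc hα hbl.integrable (Set.Ioo 0 1)).pow_const 2), energy,
    lintegral_rescale hρ] at hmax
  have hργ : ENNReal.ofReal (ρ ^ γ) * ENNReal.ofReal (ρ ^ (-γ)) = 1 := by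
    rw [← ENNReal.ofReal_mul (by positivity), ← Real.rpow_add hρ, add_neg_cancel, Real.rpow_zero,
      ENNReal.ofReal_one]
  calc ∫⁻ x in Metric.ball x₀ ρ, (⨆ t ∈ Set.Ioo 0 (ρ ^ α), ‖osc α g t x‖ₑ) ^ 2 ∂μ
      ≤ ∫⁻ x in Metric.ball x₀ ρ, (⨆ τ ∈ Set.Ioo (0 : ℝ) 1,
          ‖osc α (rescale α ρ x₀ g) τ (ρ⁻¹ • (x - x₀))‖ₑ) ^ 2 ∂μ :=
        lintegral_mono fun x => pow_le_pow_left' (iSup_osc_le_iSup_osc_rescale hρ g x₀ x) 2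
    _ = ENNReal.ofReal (ρ ^ γ) * (ENNReal.ofReal (ρ ^ (-γ)) * ∫⁻ x in Metric.ball x₀ ρ,
          (⨆ τ ∈ Set.Ioo (0 : ℝ) 1,
            ‖osc α (rescale α ρ x₀ g) τ (ρ⁻¹ • (x - x₀))‖ₑ) ^ 2 ∂μ) := by
        rw [← mul_assoc, hργ, one_mul]
    _ ≤ _ := mul_le_mul_right hmax _
    _ = _ := by
        rw [Real.rpow_sub hρ, Real.rpow_natCast, div_eq_mul_inv, ENNReal.ofReal_mul (by positivity)]
        ring

theorem lintegral_weight_smul_le {σ : ℝ} (hσ : 0 ≤ σ) {ρ R : ℝ} (hρ : 0 < ρ) (hρR : 1 ≤ ρ * R)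
    {g : Space d → ℂ} (hsupp : ∀ ξ, 2 * R < ‖ξ‖ → g ξ = 0) :
    ∫⁻ ξ, ENNReal.ofReal ((1 + ‖ρ • ξ‖ ^ 2) ^ σ) * ‖g ξ‖ₑ ^ 2 ≤
      ENNReal.ofReal (5 ^ σ * (ρ * R) ^ (2 * σ)) * ∫⁻ ξ, ‖g ξ‖ₑ ^ 2 := by
  rw [← lintegral_const_mul' _ _ (by finiteness)]
  refine lintegral_mono fun ξ => ?_
  rcases lt_or_ge (2 * R) ‖ξ‖ with hξ | hξ
  · simp [hsupp ξ hξ]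
  refine mul_le_mul_left (ENNReal.ofReal_le_ofReal ?_) _
  have hbase : 1 + ‖ρ • ξ‖ ^ 2 ≤ 5 * (ρ * R) ^ 2 := by
    rw [norm_smul, Real.norm_of_nonneg hρ.le]
    have hle : ρ * ‖ξ‖ ≤ 2 * (ρ * R) := by nlinarith
    have hnonneg : 0 ≤ ρ * ‖ξ‖ := by positivity
    nlinarith
  calc (1 + ‖ρ • ξ‖ ^ 2) ^ σ ≤ (5 * (ρ * R) ^ 2) ^ σ :=
        Real.rpow_le_rpow (by positivity) hbase hσ
    _ = 5 ^ σ * (ρ * R) ^ (2 * σ) := by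
        rw [Real.mul_rpow (by norm_num) (by positivity), ← Real.rpow_natCast_mul (by positivity)]
        norm_num

theorem MaximalFamily.lintegral_ball_le_of_support {α γ s : ℝ} {A K : ℝ≥0}
    {𝓜 : Set (Measure (Space d))} (h𝓜 : MaximalFamily α γ (((d : ℝ) - γ) / 2 + s) A K 𝓜)
    (hα : 0 < α) (hγ : γ ≤ d) (hs : 0 < s) {μ : Measure (Space d)} (hμ : μ ∈ 𝓜) (x₀ : Space d)
    {ρ R : ℝ} (hρ : 0 < ρ) (hR : 0 < R) (hρR : 1 ≤ ρ * R) {g : Space d → ℂ} (hg : BandLimited g)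
    (hsupp : ∀ ξ, 2 * R < ‖ξ‖ → g ξ = 0) :
    ∫⁻ x in Metric.ball x₀ ρ, (⨆ t ∈ Set.Ioo 0 (ρ ^ α), ‖osc α g t x‖ₑ) ^ 2 ∂μ ≤
      (ENNReal.ofReal ((2 * Real.pi) ^ d) * K) ^ 2 *
        ENNReal.ofReal (5 ^ (((d : ℝ) - γ) / 2 + s)) *
        (ENNReal.ofReal (R ^ ((d : ℝ) - γ) * (ρ * R) ^ (2 * s)) * ∫⁻ ξ, ‖g ξ‖ₑ ^ 2) := by
  set σ := ((d : ℝ) - γ) / 2 + s with hσ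
  have hpow : ρ ^ (γ - d) * (ρ * R) ^ (2 * σ) = R ^ ((d : ℝ) - γ) * (ρ * R) ^ (2 * s) := by
    rw [show 2 * σ = ((d : ℝ) - γ) + 2 * s by rw [hσ]; ring, Real.rpow_add (by positivity),
      Real.mul_rpow hρ.le hR.le, ← mul_assoc, ← mul_assoc, ← Real.rpow_add hρ,
      sub_add_sub_cancel, sub_self, Real.rpow_zero, one_mul]
  refine (h𝓜.lintegral_ball_le hα hμ x₀ hρ hg).trans ?_
  rw [mul_assoc]
  refine mul_le_mul_right ((mul_le_mul_right
    (lintegral_weight_smul_le (by linarith) hρ hρR hsupp) _).trans_eq ?_) _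
  rw [← mul_assoc, ← mul_assoc, ← ENNReal.ofReal_mul (by positivity),
    ← ENNReal.ofReal_mul (by positivity), mul_left_comm, hpow]

/-- The frequencies of size comparable to `R`. They form a neighbourhood of the support
`{R / 2 ≤ ‖ξ‖ ≤ R}` of a datum in a dyadic shell. -/
def annulus (d : ℕ) (R : ℝ) : Set (Space d) := {ξ | R / 4 ≤ ‖ξ‖ ∧ ‖ξ‖ ≤ 2 * R}

/-- The size, in units of the inverse spatial scale, of the frequency shifts used to localize in
space. -/
def cutoff (d : ℕ) : ℝ := 1 / (32 * ((d : ℝ) + 1))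

theorem cutoff_pos (d : ℕ) : 0 < cutoff d := by
  unfold cutoff
  positivity

theorem cutoff_le (d : ℕ) : cutoff d ≤ 1 / 32 := by
  unfold cutoff
  gcongr
  linarith [(Nat.cast_nonneg d : (0 : ℝ) ≤ d)]

theorem cutoff_mul (d : ℕ) : cutoff d * (32 * ((d : ℝ) + 1)) = 1 :=
  one_div_mul_cancel (by positivity)

theorem cutoff_div_lt {R ρ : ℝ} (hρ : 0 < ρ) (hρR : 1 ≤ ρ * R) : cutoff d / ρ < R / 4 := by
  rw [div_lt_iff₀ hρ]
  linarith [cutoff_le d]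

theorem norm_pos_of_mem_annulus {R : ℝ} (hR : 0 < R) {ξ : Space d} (hξ : ξ ∈ annulus d R) :
    0 < ‖ξ‖ :=
  (div_pos hR four_pos).trans_le hξ.1

theorem inv_norm_le_of_mem_annulus {R : ℝ} (hR : 0 < R) {ξ : Space d} (hξ : ξ ∈ annulus d R) :
    ‖ξ‖⁻¹ ≤ 4 / R := by
  rw [inv_le_comm₀ (norm_pos_of_mem_annulus hR hξ) (by positivity), inv_div]
  exact hξ.1

theorem sepBound_coord_div_mul_coord {R r : ℝ} (hR : 0 < R) (hr : 0 < r) (T : Set ℝ) (i : Fin d) :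
    SepBound T (annulus d R) (Metric.closedBall (0 : Space d) r)
      (fun _ ξ ζ => ((-2 * ξ i / ‖ξ‖ ^ 2 * ζ i : ℝ) : ℂ)) (8 / R * r).toNNReal := by
  refine SepBound.ofReal_mul (a := fun ξ : Space d => -2 * ξ i / ‖ξ‖ ^ 2)
    (b := fun ζ : Space d => ζ i) (by fun_prop) (by fun_prop) (by positivity) hr
    (fun ξ hξ => ?_) fun ζ hζ => (PiLp.norm_apply_le ζ i).trans (mem_closedBall_zero_iff.1 hζ)
  have hξ0 : ‖ξ‖ ≠ 0 := (norm_pos_of_mem_annulus hR hξ).ne'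
  calc |-2 * ξ i / ‖ξ‖ ^ 2| = 2 * |ξ i| / ‖ξ‖ ^ 2 := by
        rw [abs_div, abs_mul, abs_neg, abs_two, abs_of_nonneg (by positivity : 0 ≤ ‖ξ‖ ^ 2)]
    _ ≤ 2 * ‖ξ‖ / ‖ξ‖ ^ 2 := by
        gcongr
        exact PiLp.norm_apply_le ξ i
    _ = 2 * ‖ξ‖⁻¹ := by field_simp
    _ ≤ 2 * (4 / R) := by
        gcongr
        exact inv_norm_le_of_mem_annulus hR hξ
    _ = 8 / R := by ring

theorem sepBound_inner_div_norm_sq {R r : ℝ} (hR : 0 < R) (hr : 0 < r) (T : Set ℝ) :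
    SepBound T (annulus d R) (Metric.closedBall (0 : Space d) r)
      (fun _ ξ ζ => ((-2 * inner ℝ ξ ζ / ‖ξ‖ ^ 2 : ℝ) : ℂ)) (d * (8 / R * r).toNNReal) := by
  refine ((SepBound.sum Finset.univ
    fun i : Fin d => sepBound_coord_div_mul_coord hR hr T i).congr fun _ _ ξ _ ζ _ => ?_).mono
      (by simp)
  have hinner : inner ℝ ξ ζ = ∑ i, ξ i * ζ i := by
    simp only [PiLp.inner_apply, RCLike.inner_apply', conj_trivial]
  rw [← Complex.ofReal_sum, hinner, Finset.mul_sum, Finset.sum_div]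
  exact congrArg _ (Finset.sum_congr rfl fun i _ => by ring)

theorem sepBound_norm_sq_div_norm_sq {R r : ℝ} (hR : 0 < R) (hr : 0 < r) (T : Set ℝ) :
    SepBound T (annulus d R) (Metric.closedBall (0 : Space d) r)
      (fun _ ξ ζ => (((‖ξ‖ ^ 2)⁻¹ * ‖ζ‖ ^ 2 : ℝ) : ℂ)) ((4 / R) ^ 2 * r ^ 2).toNNReal := by
  refine SepBound.ofReal_mul (a := fun ξ : Space d => (‖ξ‖ ^ 2)⁻¹) (b := fun ζ : Space d => ‖ζ‖ ^ 2)
    (by fun_prop) (by fun_prop) (by positivity) (by positivity) (fun ξ hξ => ?_) fun ζ hζ => ?_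
  · rw [abs_of_nonneg (by positivity), ← inv_pow]
    exact pow_le_pow_left₀ (by positivity) (inv_norm_le_of_mem_annulus hR hξ) 2
  · rw [abs_of_nonneg (by positivity)]
    exact pow_le_pow_left₀ (norm_nonneg _) (mem_closedBall_zero_iff.1 hζ) 2

theorem sepBound_relative_increment {R ρ : ℝ} (hR : 0 < R) (hρ : 0 < ρ) (hρR : 1 ≤ ρ * R)
    (T : Set ℝ) :
    SepBound T (annulus d R) (Metric.closedBall (0 : Space d) (cutoff d / ρ))
      (fun _ ξ ζ => (((‖ξ - ζ‖ / ‖ξ‖) ^ 2 - 1 : ℝ) : ℂ)) (1 / (ρ * R) / 2).toNNReal := by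
  have hr : 0 < cutoff d / ρ := div_pos (cutoff_pos d) hρ
  refine (((sepBound_inner_div_norm_sq hR hr T).add (sepBound_norm_sq_div_norm_sq hR hr T)).congr
    fun _ _ ξ hξ ζ _ => ?_).mono ?_
  · have hξ0 := (norm_pos_of_mem_annulus hR hξ).ne'
    rw [← Complex.ofReal_add, div_pow, norm_sub_sq_real]
    congr 1
    field_simp
    ring
  · rw [← NNReal.coe_le_coe, NNReal.coe_add, NNReal.coe_mul, NNReal.coe_natCast,
      Real.coe_toNNReal _ (by positivity), Real.coe_toNNReal _ (by positivity),
      Real.coe_toNNReal _ (by positivity)]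
    set u := 1 / (ρ * R) with hu
    have hu0 : 0 < u := by positivity
    have hu1 : u ≤ 1 := (div_le_one (by positivity)).2 hρR
    have hsum : (d : ℝ) * (8 / R * (cutoff d / ρ)) + (4 / R) ^ 2 * (cutoff d / ρ) ^ 2 =
        8 * (d * cutoff d) * u + 16 * cutoff d ^ 2 * u ^ 2 := by
      rw [hu]
      field_simp
      norm_num
    have hlin : 8 * (d * cutoff d) ≤ 1 / 4 := by linarith [cutoff_mul d, cutoff_pos d]
    have hsq : 16 * cutoff d ^ 2 ≤ 1 / 4 := by nlinarith [cutoff_pos d, cutoff_le d]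
    rw [hsum]
    nlinarith [mul_le_mul_of_nonneg_right hlin hu0.le,
      mul_le_mul hsq (by nlinarith : u ^ 2 ≤ u) (by positivity) (by norm_num)]

theorem sepBound_norm_div_rpow_sub_one (α : ℝ) {R ρ : ℝ} (hR : 0 < R) (hρ : 0 < ρ)
    (hρR : 1 ≤ ρ * R) (T : Set ℝ) :
    SepBound T (annulus d R) (Metric.closedBall (0 : Space d) (cutoff d / ρ))
      (fun _ ξ ζ => ((‖ξ - ζ‖ ^ α / ‖ξ‖ ^ α - 1 : ℝ) : ℂ))
      (Real.exp (|α / 2| * (1 / (ρ * R))) - 1).toNNReal := by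
  have hu1 : 1 / (ρ * R) ≤ 1 := (div_le_one (by positivity)).2 hρR
  have hlog := (sepBound_relative_increment (d := d) hR hρ hρR T).log_one_add (by
    rw [← NNReal.coe_le_coe, Real.coe_toNNReal _ (by positivity)]
    push_cast
    linarith)
  -- `(‖ξ - ζ‖ / ‖ξ‖) ^ α` is the exponential of `α / 2` times the logarithm of the squared ratio.
  refine (((SepBound.const ((α / 2 : ℝ) : ℂ)).mul hlog).exp_sub_one.congr
    fun _ _ ξ hξ ζ hζ => ?_).mono ?_
  · have hξ0 : 0 < ‖ξ‖ := norm_pos_of_mem_annulus hR hξ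
    have hsub : 0 < ‖ξ - ζ‖ := by
      linarith [hξ.1, norm_sub_norm_le ξ ζ, mem_closedBall_zero_iff.1 hζ,
        cutoff_div_lt (d := d) hρ hρR]
    have hq : 0 < ‖ξ - ζ‖ / ‖ξ‖ := by positivity
    have hone : (1 : ℂ) + (((‖ξ - ζ‖ / ‖ξ‖) ^ 2 - 1 : ℝ) : ℂ) =
        (((‖ξ - ζ‖ / ‖ξ‖) ^ 2 : ℝ) : ℂ) := by
      push_cast
      ring
    rw [hone, ← Complex.ofReal_log (by positivity), ← Complex.ofReal_mul, ← Complex.ofReal_exp,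
      ← Complex.ofReal_one, ← Complex.ofReal_sub, Real.log_pow,
      ← Real.div_rpow (norm_nonneg _) (norm_nonneg _), Real.rpow_def_of_pos hq]
    congr 3
    push_cast
    ring
  · refine Real.toNNReal_le_toNNReal (le_of_eq ?_)
    rw [NNReal.coe_mul, coe_nnnorm, Complex.norm_real, Real.norm_eq_abs, NNReal.coe_mul,
      Real.coe_toNNReal _ (by positivity)]
    congr 3
    push_cast
    ring

theorem exp_sub_one_le_mul_exp (v : ℝ) : Real.exp v - 1 ≤ v * Real.exp v := by
  have h := mul_le_mul_of_nonneg_right (Real.add_one_le_exp (-v)) (Real.exp_pos v).le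
  rw [← Real.exp_add, neg_add_cancel, Real.exp_zero] at h
  linarith

/-- The size of the separated expansion of the change of the phase under a small change of
frequency, see `sepBound_phase_increment`. -/
def incrementConst (α : ℝ) : ℝ≥0 := (Real.exp (2 ^ α * (α / 2 * Real.exp (α / 2)))).toNNReal

theorem mul_rpow_mul_exp_sub_one_le {α : ℝ} (hα : 0 < α) {R ρ δ : ℝ} (hR : 0 < R) (hρ : 0 < ρ)
    (hρR : 1 ≤ ρ * R) (hδR : δ * R ^ (α - 1) ≤ ρ) :
    δ * (2 * R) ^ α * (Real.exp (α / 2 * (1 / (ρ * R))) - 1) ≤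
      2 ^ α * (α / 2 * Real.exp (α / 2)) := by
  have hv : 0 ≤ α / 2 * (1 / (ρ * R)) := by positivity
  have hvα : α / 2 * (1 / (ρ * R)) ≤ α / 2 :=
    mul_le_of_le_one_right (by positivity) ((div_le_one (by positivity)).2 hρR)
  have hδ2 : δ * (2 * R) ^ α ≤ 2 ^ α * (ρ * R) :=
    calc δ * (2 * R) ^ α = 2 ^ α * (δ * R ^ (α - 1) * R) := by
          rw [Real.mul_rpow (by norm_num) hR.le, Real.rpow_sub_one hR.ne']
          field_simp
      _ ≤ 2 ^ α * (ρ * R) := by gcongr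
  calc δ * (2 * R) ^ α * (Real.exp (α / 2 * (1 / (ρ * R))) - 1)
      ≤ (2 ^ α * (ρ * R)) * (α / 2 * (1 / (ρ * R)) * Real.exp (α / 2)) :=
        mul_le_mul hδ2 ((exp_sub_one_le_mul_exp _).trans
          (mul_le_mul_of_nonneg_left (Real.exp_le_exp.2 hvα) hv))
          (sub_nonneg.2 (Real.one_le_exp hv)) (by positivity)
    _ = 2 ^ α * (α / 2 * Real.exp (α / 2)) := by field_simp

theorem sepBound_phase_increment {α : ℝ} (hα : 0 < α) {R ρ δ : ℝ} (hR : 0 < R) (hρ : 0 < ρ)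
    (hδ : 0 < δ) (hρR : 1 ≤ ρ * R) (hδR : δ * R ^ (α - 1) ≤ ρ) :
    SepBound (Set.Ioo 0 δ) (annulus d R) (Metric.closedBall (0 : Space d) (cutoff d / ρ))
      (fun t ξ ζ => Complex.exp (Complex.I * ((t * (‖ξ - ζ‖ ^ α - ‖ξ‖ ^ α) : ℝ) : ℂ)))
      (incrementConst α) := by
  have htime := sepBound_mul_norm_rpow (T := Set.Ioo 0 δ) (X := annulus d R)
    (Z := Metric.closedBall (0 : Space d) (cutoff d / ρ)) hα.le hδ.le
    (mul_pos two_pos hR) (fun t ht => by rw [abs_of_pos ht.1]; exact ht.2.le) fun ξ hξ => hξ.2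
  refine ((htime.mul (sepBound_norm_div_rpow_sub_one α hR hρ hρR _)).exp.congr
    fun t _ ξ hξ ζ _ => ?_).mono (Real.toNNReal_le_toNNReal (Real.exp_le_exp.2 ?_))
  · have hξα : ‖ξ‖ ^ α ≠ 0 := (Real.rpow_pos_of_pos (norm_pos_of_mem_annulus hR hξ) α).ne'
    have hfactor : t * (‖ξ - ζ‖ ^ α - ‖ξ‖ ^ α) =
        t * ‖ξ‖ ^ α * (‖ξ - ζ‖ ^ α / ‖ξ‖ ^ α - 1) := by
      field_simp
    rw [hfactor]
    congr 1
    push_cast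
    ring
  · rw [abs_of_pos (half_pos hα), NNReal.coe_mul, Real.coe_toNNReal _ (by positivity),
      Real.coe_toNNReal _ (sub_nonneg.2 (Real.one_le_exp (by positivity)))]
    exact mul_rpow_mul_exp_sub_one_le hα hR hρ hρR hδR

/-! ### Localization by windowed Fourier transforms -/

/-- The windowed Fourier transform `∫ exp(-ik·ζ) β(ζ) g(ξ-ζ) dζ`. The function of `ξ` with parameter
`k` is the frequency representation of the evolution of `g` localized near `k`. -/
def windowed (α : ℝ) (β g : Space d → ℂ) (k ξ : Space d) : ℂ :=
  osc α (fun ζ => β ζ * g (ξ - ζ)) 0 (-k)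

theorem BandLimited.of_enorm_le {g : Space d → ℂ} (hg : Measurable g) {c : ℝ≥0∞} (hc : c ≠ ∞)
    (hle : ∀ ξ, ‖g ξ‖ₑ ≤ c) {R : ℝ} (hR : ∀ ξ, R < ‖ξ‖ → g ξ = 0) : BandLimited g := by
  refine ⟨hg, ?_, R, hR⟩
  calc ∫⁻ ξ, ‖g ξ‖ₑ ^ 2
      ≤ ∫⁻ ξ, (Metric.closedBall (0 : Space d) R).indicator (fun _ => c ^ 2) ξ := by
        refine lintegral_mono fun ξ => ?_
        by_cases h : ξ ∈ Metric.closedBall (0 : Space d) R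
        · rw [Set.indicator_of_mem h]
          exact pow_le_pow_left' (hle ξ) 2
        · rw [hR ξ (by simpa using h)]
          simp
    _ = c ^ 2 * volume (Metric.closedBall (0 : Space d) R) :=
        lintegral_indicator_const measurableSet_closedBall _
    _ < ∞ := ENNReal.mul_lt_top (by finiteness) measure_closedBall_lt_top

theorem BandLimited.reflect_translate {g : Space d → ℂ} (hg : BandLimited g) (ξ : Space d) :
    BandLimited fun ζ => g (ξ - ζ) := by
  refine ⟨hg.measurable.comp (measurable_const.sub measurable_id), ?_, ?_⟩
  · rw [lintegral_sub_left_eq_self (fun ζ => ‖g ζ‖ₑ ^ 2)]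
    exact hg.sq_lt_top
  · obtain ⟨R, hR⟩ := hg.bounded
    refine ⟨‖ξ‖ + R, fun ζ hζ => hR _ ?_⟩
    linarith [norm_sub_norm_le ζ ξ, norm_sub_rev ζ ξ]

theorem lintegral_lintegral_indicator_mul_sub {E : Type*} [NormedAddCommGroup E] [MeasurableSpace E]
    [BorelSpace E] [SecondCountableTopology E] (ν : Measure E) [ν.IsAddHaarMeasure] [SFinite ν]
    {Z : Set E} (hZ : MeasurableSet Z) {F : E → ℝ≥0∞} (hF : Measurable F) :
    ∫⁻ ξ, ∫⁻ ζ, Z.indicator 1 ζ * F (ξ - ζ) ∂ν ∂ν = ν Z * ∫⁻ ξ, F ξ ∂ν := by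
  have hmeas : Measurable (Function.uncurry fun ξ ζ : E =>
      Z.indicator (1 : E → ℝ≥0∞) ζ * F (ξ - ζ)) :=
    ((measurable_one.indicator hZ).comp measurable_snd).mul
      (hF.comp (by fun_prop : Measurable fun p : E × E => p.1 - p.2))
  have hinner (ζ : E) : ∫⁻ ξ, Z.indicator (1 : E → ℝ≥0∞) ζ * F (ξ - ζ) ∂ν =
      Z.indicator 1 ζ * ∫⁻ ξ, F ξ ∂ν := by
    rw [lintegral_const_mul _ (by fun_prop), lintegral_sub_right_eq_self F]
  rw [lintegral_lintegral_swap hmeas.aemeasurable]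
  simp only [hinner]
  rw [lintegral_mul_const _ (measurable_one.indicator hZ), lintegral_indicator_one hZ]

section Windowed

variable {α : ℝ} {β g : Space d → ℂ} {r : ℝ}

theorem measurable_windowed (hα : 0 < α) (hβ : Measurable β) (hg : Measurable g) :
    Measurable fun p : Space d × Space d => windowed α β g p.1 p.2 := by
  refine (StronglyMeasurable.integral_prod_right' (f := fun q : (Space d × Space d) × Space d =>
    phase α 0 (-q.1.1) q.2 * (β q.2 * g (q.1.2 - q.2))) ?_).measurable
  have hphase : Measurable fun q : (Space d × Space d) × Space d => phase α 0 (-q.1.1) q.2 :=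
    Measurable.comp (g := fun p : (ℝ × Space d) × Space d => phase α p.1.1 p.1.2 p.2)
      (f := fun q : (Space d × Space d) × Space d => (((0 : ℝ), -q.1.1), q.2))
      (continuous_phase hα).measurable (by fun_prop)
  exact (hphase.mul ((hβ.comp measurable_snd).mul (hg.comp (by fun_prop : Measurable
    fun q : (Space d × Space d) × Space d => q.1.2 - q.2)))).stronglyMeasurable

theorem windowed_eq_zero {ξ : Space d} (h : ∀ ζ, β ζ ≠ 0 → g (ξ - ζ) = 0) (k : Space d) :
    windowed α β g k ξ = 0 := by
  have hzero (ζ : Space d) : β ζ * g (ξ - ζ) = 0 :=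
    mul_eq_zero.2 (or_iff_not_imp_left.2 (h ζ))
  simp only [windowed, osc, hzero, mul_zero, integral_zero]

theorem norm_le_of_window_ne_zero
    (hβle : ∀ ζ, ‖β ζ‖ₑ ≤ (Metric.closedBall (0 : Space d) r).indicator 1 ζ) {ζ : Space d}
    (hζ : β ζ ≠ 0) : ‖ζ‖ ≤ r := by
  by_contra h
  refine hζ (enorm_eq_zero.1 (le_zero_iff.1 ((hβle ζ).trans_eq ?_)))
  exact Set.indicator_of_notMem (by simpa using h) _

theorem enorm_window_le_one
    (hβle : ∀ ζ, ‖β ζ‖ₑ ≤ (Metric.closedBall (0 : Space d) r).indicator 1 ζ) (ζ : Space d) :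
    ‖β ζ‖ₑ ≤ 1 :=
  (hβle ζ).trans (Set.indicator_le_self _ _ ζ)

theorem bandLimited_windowed (hα : 0 < α) (hβ : Measurable β)
    (hβle : ∀ ζ, ‖β ζ‖ₑ ≤ (Metric.closedBall (0 : Space d) r).indicator 1 ζ)
    (hg : BandLimited g) (k : Space d) :
    BandLimited (windowed α β g k) := by
  obtain ⟨R, hR⟩ := hg.bounded
  refine .of_enorm_le (c := ∫⁻ ζ, ‖g ζ‖ₑ) (R := r + R)
    (measurable_windowed hα hβ hg.measurable).of_uncurry_left hg.integrable.2.ne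
    (fun ξ => ?_) fun ξ hξ => windowed_eq_zero (fun ζ hζ => hR _ ?_) k
  · refine (enorm_osc_le _ _ _ _).trans ?_
    rw [← lintegral_sub_left_eq_self (fun ζ => ‖g ζ‖ₑ) ξ]
    refine lintegral_mono fun ζ => ?_
    rw [enorm_mul]
    exact mul_le_of_le_one_left' (enorm_window_le_one hβle ζ)
  · linarith [norm_sub_norm_le ξ ζ, norm_le_of_window_ne_zero hβle hζ]

theorem lintegral_windowed_le (hα : 0 < α) (hβ : Measurable β)
    (hβle : ∀ ζ, ‖β ζ‖ₑ ≤ (Metric.closedBall (0 : Space d) r).indicator 1 ζ)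
    (hg : BandLimited g) :
    ∫⁻ k, ∫⁻ ξ, ‖windowed α β g k ξ‖ₑ ^ 2 ≤ ENNReal.ofReal ((2 * Real.pi) ^ d) *
      (volume (Metric.closedBall (0 : Space d) r) * ∫⁻ ξ, ‖g ξ‖ₑ ^ 2) := by
  have hplancherel (ξ : Space d) : ∫⁻ k, ‖windowed α β g k ξ‖ₑ ^ 2 ≤
      ENNReal.ofReal ((2 * Real.pi) ^ d) *
        ∫⁻ ζ, (Metric.closedBall (0 : Space d) r).indicator 1 ζ * ‖g (ξ - ζ)‖ₑ ^ 2 := by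
    have hband : BandLimited fun ζ => β ζ * g (ξ - ζ) :=
      (hg.reflect_translate ξ).mul hβ (c := 1) fun ζ _ => by
        simpa [enorm_eq_nnnorm, ← NNReal.coe_le_coe] using enorm_window_le_one hβle ζ
    have hosc := hband.lintegral_osc_zero_le hα
    rw [← lintegral_neg_eq_self] at hosc
    refine hosc.trans (mul_le_mul_right (lintegral_mono fun ζ => ?_) _)
    rw [enorm_mul, mul_pow]
    gcongr
    exact (pow_le_of_le_one zero_le (enorm_window_le_one hβle ζ) two_ne_zero).trans (hβle ζ)
  rw [lintegral_lintegral_swap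
    ((measurable_windowed hα hβ hg.measurable).enorm.pow_const 2).aemeasurable,
    ← lintegral_lintegral_indicator_mul_sub volume measurableSet_closedBall
      (hg.measurable.enorm.pow_const 2), ← lintegral_const_mul' _ _ (by finiteness)]
  exact lintegral_mono hplancherel

end Windowed

theorem integrable_convolution_phase_mul {α : ℝ} (hα : 0 < α) {f g : Space d → ℂ}
    (hf : Integrable f) (hg : Integrable g) (s t : ℝ) (y x : Space d) :
    Integrable (fun p : Space d × Space d =>
      phase α s y p.2 * f p.2 * (phase α t x (p.1 - p.2) * g (p.1 - p.2)))
      (volume.prod volume) := by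
  simpa using (integrable_phase_mul hα hf s y).convolution_integrand (ContinuousLinearMap.mul ℝ ℂ)
    (integrable_phase_mul hα hg t x)

theorem osc_mul_osc {α : ℝ} (hα : 0 < α) {f g : Space d → ℂ} (hf : Integrable f)
    (hg : Integrable g) (s t : ℝ) (y x : Space d) :
    osc α f s y * osc α g t x = ∫ p : Space d × Space d,
      phase α s y p.2 * f p.2 * (phase α t x (p.1 - p.2) * g (p.1 - p.2))
        ∂(volume.prod volume) := by
  rw [integral_prod _ (integrable_convolution_phase_mul hα hf hg s t y x)]
  exact (integral_convolution (ContinuousLinearMap.mul ℝ ℂ) (integrable_phase_mul hα hf s y)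
    (integrable_phase_mul hα hg t x)).symm

theorem phase_mul_phase_sub (α t : ℝ) (x k ξ ζ : Space d) :
    phase α 0 (x - k) ζ * phase α t x (ξ - ζ) = phase α t x ξ * phase α 0 (-k) ζ *
      Complex.exp (Complex.I * ((t * (‖ξ - ζ‖ ^ α - ‖ξ‖ ^ α) : ℝ) : ℂ)) := by
  simp only [phase, ← Complex.exp_add, inner_sub_left, inner_sub_right, inner_neg_left]
  congr 1
  push_cast
  ring

section WindowTerm

variable {α : ℝ} {T : Set ℝ} {X Z : Set (Space d)} {M : ℝ≥0} {ι : Type}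
  (e : SepExpansion T X Z
    (fun t ξ ζ => Complex.exp (Complex.I * ((t * (‖ξ - ζ‖ ^ α - ‖ξ‖ ^ α) : ℝ) : ℂ))) M ι)
  {g : Space d → ℂ} {t : ℝ}

/-- The contribution of one term of a separated expansion of `exp(it(|ξ-ζ|^α - |ξ|^α))` to the
double integral over `(ξ, ζ)` that represents the evolution of `g` localized near `k`. -/
def SepExpansion.windowTerm (g : Space d → ℂ) (t : ℝ) (k x : Space d) (j : ι)
    (p : Space d × Space d) : ℂ :=
  e.c j t * (phase α t x p.1 * (e.a j p.1 *
    (phase α 0 (-k) p.2 * (Z.indicator (e.b j) p.2 * g (p.1 - p.2)))))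

theorem SepExpansion.measurable_windowTerm (hα : 0 < α) (hZ : MeasurableSet Z) (hg : Measurable g)
    (t : ℝ) (k x : Space d) (j : ι) : Measurable (e.windowTerm g t k x j) :=
  measurable_const.mul (((measurable_phase hα t x).comp measurable_fst).mul
    (((e.measurable_a j).comp measurable_fst).mul
    (((measurable_phase hα 0 (-k)).comp measurable_snd).mul
    ((((e.measurable_b j).indicator hZ).comp measurable_snd).mul
    (hg.comp (measurable_fst.sub measurable_snd))))))

theorem SepExpansion.norm_windowTerm_le (hgX : ∀ ξ ∉ X, ∀ ζ ∈ Z, g (ξ - ζ) = 0) (ht : t ∈ T)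
    (k x : Space d) (j : ι) (p : Space d × Space d) :
    ‖e.windowTerm g t k x j p‖ ≤ e.m j * (Z.indicator (fun _ => 1) p.2 * ‖g (p.1 - p.2)‖) := by
  by_cases hζ : p.2 ∈ Z
  · by_cases hξ : p.1 ∈ X
    · calc ‖e.windowTerm g t k x j p‖
          = ‖e.c j t * e.a j p.1 * e.b j p.2‖ * ‖g (p.1 - p.2)‖ := by
            simp only [windowTerm, norm_mul, norm_phase, Set.indicator_of_mem hζ, one_mul,
              mul_assoc]
        _ ≤ e.m j * ‖g (p.1 - p.2)‖ := by
            gcongr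
            exact e.norm_term_le ht hξ hζ j
        _ = e.m j * (Z.indicator (fun _ => 1) p.2 * ‖g (p.1 - p.2)‖) := by
            rw [Set.indicator_of_mem hζ, one_mul]
    · simp [windowTerm, hgX _ hξ _ hζ]
  · simp [windowTerm, hζ]

theorem SepExpansion.hasSum_windowTerm (hgX : ∀ ξ ∉ X, ∀ ζ ∈ Z, g (ξ - ζ) = 0) (ht : t ∈ T)
    (k x : Space d) (p : Space d × Space d) :
    HasSum (fun j => e.windowTerm g t k x j p) (phase α 0 (x - k) p.2 *
      Z.indicator (fun _ => 1) p.2 * (phase α t x (p.1 - p.2) * g (p.1 - p.2))) := by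
  by_cases hζ : p.2 ∈ Z
  · by_cases hξ : p.1 ∈ X
    · convert! (e.hasSum t ht _ hξ _ hζ).mul_left
        (phase α t x p.1 * phase α 0 (-k) p.2 * g (p.1 - p.2)) using 1
      · funext j
        simp only [windowTerm, Set.indicator_of_mem hζ]
        ring
      · simp only [Set.indicator_of_mem hζ]
        linear_combination g (p.1 - p.2) * phase_mul_phase_sub α t x k p.1 p.2
    · simp [windowTerm, hgX _ hξ _ hζ]
  · simp [windowTerm, hζ]

/- The left-hand side is the modulus of the evolution of `g` times a bump function centred at `k`.
The separated expansion writes it as a superposition of evolutions of windowed data. -/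
theorem SepExpansion.enorm_osc_mul_enorm_osc_le_tsum [Countable ι] (hα : 0 < α)
    (hZ : MeasurableSet Z) (hZfin : volume Z ≠ ∞) (hg : BandLimited g)
    (hgX : ∀ ξ ∉ X, ∀ ζ ∈ Z, g (ξ - ζ) = 0) (ht : t ∈ T) (k x : Space d) :
    ‖osc α (Z.indicator fun _ => 1) 0 (x - k)‖ₑ * ‖osc α g t x‖ₑ ≤
      ∑' j, e.m j * ‖osc α (fun ξ => e.a j ξ * windowed α (Z.indicator (e.b j)) g k ξ) t x‖ₑ := by
  have hindicator {F : Type} [NormedAddCommGroup F] (c : F) : Integrable (Z.indicator fun _ => c) :=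
    (integrableOn_const hZfin).integrable_indicator hZ
  have hG : Integrable (fun p : Space d × Space d =>
      Z.indicator (fun _ => (1 : ℝ)) p.2 * ‖g (p.1 - p.2)‖) (volume.prod volume) := by
    simpa using (hindicator (1 : ℝ)).convolution_integrand
      (ContinuousLinearMap.mul ℝ ℝ) hg.integrable.norm
  have hmeas (j : ι) : AEStronglyMeasurable (e.windowTerm g t k x j) (volume.prod volume) :=
    (e.measurable_windowTerm hα hZ hg.measurable t k x j).aestronglyMeasurable
  have hle := e.norm_windowTerm_le hgX ht k x
  have hint (j : ι) : ∫ p, e.windowTerm g t k x j p ∂(volume.prod volume) =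
      e.c j t * osc α (fun ξ => e.a j ξ * windowed α (Z.indicator (e.b j)) g k ξ) t x := by
    rw [integral_prod _ ((hG.const_mul (e.m j : ℝ)).mono' (hmeas j) (Eventually.of_forall (hle j)))]
    simp only [windowTerm, integral_const_mul]
    rfl
  rw [← enorm_mul, osc_mul_osc hα (hindicator 1) hg.integrable]
  refine (enorm_integral_le_tsum hG e.summable_m hmeas hle
    (e.hasSum_windowTerm hgX ht k x)).trans (ENNReal.tsum_le_tsum fun j => ?_)
  rw [hint, enorm_mul]
  gcongr
  rw [enorm_eq_nnnorm]
  exact_mod_cast e.norm_c_le j t ht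

end WindowTerm

theorem one_half_le_re_phase_zero {α : ℝ} {y ζ : Space d} (h : ‖y‖ * ‖ζ‖ ≤ 1) :
    1 / 2 ≤ (phase α 0 y ζ).re := by
  have hinner : inner ℝ y ζ ^ 2 ≤ 1 :=
    sq_le_one_iff_abs_le_one _ |>.2 ((abs_real_inner_le_norm y ζ).trans h)
  rw [phase, mul_comm, Complex.exp_ofReal_mul_I_re, zero_mul, add_zero]
  linarith [Real.one_sub_sq_div_two_le_cos (x := inner ℝ y ζ)]

theorem le_enorm_osc_indicator_closedBall {α : ℝ} (hα : 0 < α) {ρ r : ℝ} (hr : r * ρ ≤ 1)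
    {y : Space d} (hy : ‖y‖ ≤ ρ) :
    volume (Metric.closedBall (0 : Space d) r) / 2 ≤
      ‖osc α ((Metric.closedBall (0 : Space d) r).indicator fun _ => 1) 0 y‖ₑ := by
  set Z := Metric.closedBall (0 : Space d) r with hZ
  have hindicator {F : Type} [NormedAddCommGroup F] (c : F) : Integrable (Z.indicator fun _ => c) :=
    (integrableOn_const measure_closedBall_lt_top.ne).integrable_indicator measurableSet_closedBall
  have hint := integrable_phase_mul hα (hindicator (1 : ℂ)) 0 y
  have hre : volume.real Z / 2 ≤ (osc α (Z.indicator fun _ => 1) 0 y).re := by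
    calc volume.real Z / 2 = ∫ ζ, Z.indicator (fun _ => (1 / 2 : ℝ)) ζ := by
          rw [integral_indicator measurableSet_closedBall, setIntegral_const, smul_eq_mul]
          ring
      _ ≤ ∫ ζ, (phase α 0 y ζ * Z.indicator (fun _ => 1) ζ).re := by
          refine integral_mono (hindicator _) hint.re fun ζ => ?_
          by_cases hζ : ζ ∈ Z
          · simp only [Set.indicator_of_mem hζ, mul_one]
            refine one_half_le_re_phase_zero ?_
            have hζr : ‖ζ‖ ≤ r := by simpa [hZ] using hζ
            nlinarith [norm_nonneg ζ, norm_nonneg y]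
          · simp [hζ]
      _ = (osc α (Z.indicator fun _ => 1) 0 y).re := integral_re hint
  calc volume Z / 2 = ENNReal.ofReal (volume.real Z / 2) := by
        rw [ENNReal.ofReal_div_of_pos two_pos, ENNReal.ofReal_ofNat,
          ofReal_measureReal measure_closedBall_lt_top.ne]
    _ ≤ ‖osc α (Z.indicator fun _ => 1) 0 y‖ₑ := by
        rw [← ofReal_norm]
        exact ENNReal.ofReal_le_ofReal
          (hre.trans ((le_abs_self _).trans (Complex.abs_re_le_norm _)))

theorem SepExpansion.volume_mul_iSup_enorm_osc_le_tsum {α : ℝ} (hα : 0 < α) {T : Set ℝ}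
    {X : Set (Space d)} {r ρ : ℝ} (hr : r * ρ ≤ 1) {M : ℝ≥0} {ι : Type} [Countable ι]
    (e : SepExpansion T X (Metric.closedBall (0 : Space d) r)
      (fun t ξ ζ => Complex.exp (Complex.I * ((t * (‖ξ - ζ‖ ^ α - ‖ξ‖ ^ α) : ℝ) : ℂ))) M ι)
    {g : Space d → ℂ} (hg : BandLimited g)
    (hgX : ∀ ξ ∉ X, ∀ ζ ∈ Metric.closedBall (0 : Space d) r, g (ξ - ζ) = 0) {k x : Space d}
    (hx : x ∈ Metric.ball k ρ) :
    volume (Metric.closedBall (0 : Space d) r) / 2 * ⨆ t ∈ T, ‖osc α g t x‖ₑ ≤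
      ∑' j, e.m j * ⨆ t ∈ T, ‖osc α (fun ξ => e.a j ξ *
        windowed α ((Metric.closedBall (0 : Space d) r).indicator (e.b j)) g k ξ) t x‖ₑ := by
  refine (ENNReal.mul_iSup _ _).trans_le (iSup_le fun t => ?_)
  refine (ENNReal.mul_iSup _ _).trans_le (iSup_le fun ht => ?_)
  refine (mul_le_mul_left (le_enorm_osc_indicator_closedBall hα hr
    (mem_ball_iff_norm.1 hx).le) _).trans ((e.enorm_osc_mul_enorm_osc_le_tsum hα
      measurableSet_closedBall measure_closedBall_lt_top.ne hg hgX ht k x).trans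
        (ENNReal.tsum_le_tsum fun j => ?_))
  gcongr
  exact le_iSup₂ (f := fun t (_ : t ∈ T) => ‖osc α (fun ξ => e.a j ξ *
    windowed α ((Metric.closedBall (0 : Space d) r).indicator (e.b j)) g k ξ) t x‖ₑ) t ht

/- Averages the localized estimates over the centre of the ball; by Plancherel the windowed data
have total energy comparable to that of `g`. -/
theorem SepExpansion.volume_mul_lintegral_iSup_osc_sq_le {α : ℝ} (hα : 0 < α) {T : Set ℝ}
    {X : Set (Space d)} {r ρ : ℝ} (hr : r * ρ ≤ 1) {M : ℝ≥0} {ι : Type} [Countable ι]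
    (e : SepExpansion T X (Metric.closedBall (0 : Space d) r)
      (fun t ξ ζ => Complex.exp (Complex.I * ((t * (‖ξ - ζ‖ ^ α - ‖ξ‖ ^ α) : ℝ) : ℂ))) M ι)
    {μ : Measure (Space d)} [SFinite μ] {B : ℝ≥0∞}
    (hB : ∀ (k : Space d) (h : Space d → ℂ), BandLimited h → (∀ ξ ∉ X, h ξ = 0) →
      ∫⁻ x in Metric.ball k ρ, (⨆ t ∈ T, ‖osc α h t x‖ₑ) ^ 2 ∂μ ≤ B * ∫⁻ ξ, ‖h ξ‖ₑ ^ 2)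
    {g : Space d → ℂ} (hg : BandLimited g)
    (hgX : ∀ ξ ∉ X, ∀ ζ ∈ Metric.closedBall (0 : Space d) r, g (ξ - ζ) = 0) :
    volume (Metric.ball (0 : Space d) ρ) * ((volume (Metric.closedBall (0 : Space d) r) / 2) ^ 2 *
      ∫⁻ x, (⨆ t ∈ T, ‖osc α g t x‖ₑ) ^ 2 ∂μ) ≤
    (M : ℝ≥0∞) ^ 2 * (B * (ENNReal.ofReal ((2 * Real.pi) ^ d) *
      (volume (Metric.closedBall (0 : Space d) r) * ∫⁻ ξ, ‖g ξ‖ₑ ^ 2))) := by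
  set Z := Metric.closedBall (0 : Space d) r
  have hβ (j : ι) : Measurable (Z.indicator (e.b j)) :=
    (e.measurable_b j).indicator measurableSet_closedBall
  have hβle (j : ι) (ζ : Space d) : ‖Z.indicator (e.b j) ζ‖ₑ ≤ Z.indicator 1 ζ := by
    by_cases hζ : ζ ∈ Z
    · simpa [hζ, enorm_eq_nnnorm, ← NNReal.coe_le_coe] using e.norm_b_le j ζ hζ
    · simp [hζ]
  let G (j : ι) (k : Space d) : Space d → ℂ := windowed α (Z.indicator (e.b j)) g k
  have hGX (j : ι) (k ξ : Space d) (hξ : ξ ∉ X) : G j k ξ = 0 :=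
    windowed_eq_zero (fun ζ hζ => hgX ξ hξ ζ (Set.mem_of_indicator_ne_zero hζ)) k
  have ha (j : ι) (k ξ : Space d) (h : G j k ξ ≠ 0) : ‖e.a j ξ‖ ≤ (1 : ℝ≥0) :=
    e.norm_a_le j ξ (not_not.1 fun hξ => h (hGX j k ξ hξ))
  have hband (j : ι) (k : Space d) : BandLimited fun ξ => e.a j ξ * G j k ξ :=
    (bandLimited_windowed hα (hβ j) (hβle j) hg k).mul (e.measurable_a j) (ha j k)
  have hlocal (j : ι) (k : Space d) : ∫⁻ x in Metric.ball k ρ,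
      (⨆ t ∈ T, ‖osc α (fun ξ => e.a j ξ * G j k ξ) t x‖ₑ) ^ 2 ∂μ ≤
        B * ∫⁻ ξ, ‖G j k ξ‖ₑ ^ 2 :=
    (hB k _ (hband j k) fun ξ hξ => by rw [hGX j k ξ hξ, mul_zero]).trans
      (mul_le_mul_right (by simpa using lintegral_enorm_mul_sq_le (ha j k)) B)
  have hmeas (j : ι) : Measurable fun k => ∫⁻ ξ, ‖G j k ξ‖ₑ ^ 2 :=
    ((measurable_windowed hα (hβ j) hg.measurable).enorm.pow_const 2).lintegral_prod_right'
  rw [← lintegral_const_mul' _ _ (ENNReal.pow_ne_top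
    (ENNReal.div_ne_top measure_closedBall_lt_top.ne two_ne_zero))]
  simp only [← mul_pow]
  refine measure_ball_mul_lintegral_sq_le volume μ e.tsum_le
    ((measurable_iSup_osc hα hg.integrable T).const_mul _)
    (fun j k => measurable_iSup_osc hα (hband j k).integrable T)
    (fun j => (hmeas j).const_mul B) hlocal (fun j => ?_)
    fun k x hx => e.volume_mul_iSup_enorm_osc_le_tsum hα hr hg hgX hx
  rw [lintegral_const_mul _ (hmeas j)]
  exact mul_le_mul_right (lintegral_windowed_le hα (hβ j) (hβle j) hg) B

theorem volume_ball_mul_volume_closedBall {ρ c : ℝ} (hρ : 0 < ρ) (hc : 0 ≤ c) :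
    volume (Metric.ball (0 : Space d) ρ) * volume (Metric.closedBall (0 : Space d) (c / ρ)) =
      ENNReal.ofReal (c ^ d) * volume (Metric.ball (0 : Space d) 1) ^ 2 := by
  rw [Measure.addHaar_ball_of_pos _ _ hρ, Measure.addHaar_closedBall _ _ (by positivity),
    finrank_euclideanSpace_fin, mul_mul_mul_comm, ← ENNReal.ofReal_mul (by positivity), ← mul_pow,
    mul_div_cancel₀ _ hρ.ne', sq]

theorem le_of_mul_half_sq_mul_le {V v u w : ℝ≥0∞} (hV : V ≠ 0) (hV' : V ≠ ∞) (hv : v ≠ 0)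
    (hv' : v ≠ ∞) (h : V * ((v / 2) ^ 2 * u) ≤ v * w) : u ≤ 4 * (V * v)⁻¹ * w := by
  have hfour : (4 : ℝ≥0∞) * 2⁻¹ ^ 2 = 1 := by
    rw [← ENNReal.inv_pow, show (2 : ℝ≥0∞) ^ 2 = 4 by norm_num]
    exact ENNReal.mul_inv_cancel (by norm_num) (by norm_num)
  calc u = (4 * 2⁻¹ ^ 2) * ((V * v)⁻¹ * (V * v)) * (v⁻¹ * v) * u := by
        rw [hfour, ENNReal.inv_mul_cancel (mul_ne_zero hV hv) (by finiteness),
          ENNReal.inv_mul_cancel hv hv']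
        simp only [one_mul]
    _ = 4 * (V * v)⁻¹ * v⁻¹ * (V * ((v / 2) ^ 2 * u)) := by
        rw [div_eq_mul_inv]
        ring
    _ ≤ 4 * (V * v)⁻¹ * v⁻¹ * (v * w) := mul_le_mul_right h _
    _ = 4 * (V * v)⁻¹ * w * (v⁻¹ * v) := by ring
    _ = 4 * (V * v)⁻¹ * w := by rw [ENNReal.inv_mul_cancel hv hv', mul_one]

/-- The constant lost in passing from maximal estimates on balls to a global one, see
`MaximalFamily.short_time`. -/
def shortTimeConst (d : ℕ) (α : ℝ) : ℝ≥0 :=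
  (4 * (ENNReal.ofReal (cutoff d ^ d) * volume (Metric.ball (0 : Space d) 1) ^ 2)⁻¹ *
    ((incrementConst α : ℝ≥0∞) ^ 2 * ENNReal.ofReal ((2 * Real.pi) ^ d))).toNNReal

theorem coe_shortTimeConst (d : ℕ) (α : ℝ) : (shortTimeConst d α : ℝ≥0∞) =
    4 * (ENNReal.ofReal (cutoff d ^ d) * volume (Metric.ball (0 : Space d) 1) ^ 2)⁻¹ *
      ((incrementConst α : ℝ≥0∞) ^ 2 * ENNReal.ofReal ((2 * Real.pi) ^ d)) := by
  have hc := cutoff_pos d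
  have hW : ENNReal.ofReal (cutoff d ^ d) * volume (Metric.ball (0 : Space d) 1) ^ 2 ≠ 0 :=
    mul_ne_zero (ENNReal.ofReal_pos.2 (by positivity)).ne'
      (pow_ne_zero 2 (Metric.measure_ball_pos _ _ one_pos).ne')
  exact ENNReal.coe_toNNReal (ENNReal.mul_ne_top
    (ENNReal.mul_ne_top (by norm_num) (ENNReal.inv_ne_top.2 hW)) (by finiteness))

theorem sub_eq_zero_of_notMem_annulus {R ρ : ℝ} (hρ : 0 < ρ) (hρR : 1 ≤ ρ * R)
    {g : Space d → ℂ} (hlow : ∀ ξ, ‖ξ‖ < R / 2 → g ξ = 0) (hhigh : ∀ ξ, R < ‖ξ‖ → g ξ = 0)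
    {ξ ζ : Space d} (hξ : ξ ∉ annulus d R)
    (hζ : ζ ∈ Metric.closedBall (0 : Space d) (cutoff d / ρ)) : g (ξ - ζ) = 0 := by
  have hζR : ‖ζ‖ < R / 4 := (mem_closedBall_zero_iff.1 hζ).trans_lt (cutoff_div_lt hρ hρR)
  rcases not_and_or.1 hξ with h | h
  · exact hlow _ (by linarith [norm_sub_le ξ ζ])
  · exact hhigh _ (by linarith [norm_sub_norm_le ξ ζ, norm_nonneg ζ])

/- At frequency `R` waves travel at speed about `R ^ (α - 1)`, hence over times `t < δ` they move by
at most about `ρ`, and the maximal estimates on the balls of radius `ρ` can be summed. -/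
theorem MaximalFamily.short_time {α γ s : ℝ} {A K : ℝ≥0} {𝓜 : Set (Measure (Space d))}
    (h𝓜 : MaximalFamily α γ (((d : ℝ) - γ) / 2 + s) A K 𝓜) (hα : 0 < α) (hγ : γ ≤ d) (hs : 0 < s)
    {μ : Measure (Space d)} (hμ : μ ∈ 𝓜) {R ρ δ : ℝ} (hR : 0 < R) (hρ : 0 < ρ) (hδ : 0 < δ)
    (hρR : 1 ≤ ρ * R) (hδρ : δ ≤ ρ ^ α) (hδR : δ * R ^ (α - 1) ≤ ρ) {g : Space d → ℂ}
    (hg : BandLimited g) (hlow : ∀ ξ, ‖ξ‖ < R / 2 → g ξ = 0) (hhigh : ∀ ξ, R < ‖ξ‖ → g ξ = 0) :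
    ∫⁻ x, (⨆ t ∈ Set.Ioo 0 δ, ‖osc α g t x‖ₑ) ^ 2 ∂μ ≤
      shortTimeConst d α * ((ENNReal.ofReal ((2 * Real.pi) ^ d) * K) ^ 2 *
        ENNReal.ofReal (5 ^ (((d : ℝ) - γ) / 2 + s)) *
        (ENNReal.ofReal (R ^ ((d : ℝ) - γ) * (ρ * R) ^ (2 * s)) * ∫⁻ ξ, ‖g ξ‖ₑ ^ 2)) := by
  have := (h𝓜.growth μ hμ).isLocallyFiniteMeasure
  have hc := cutoff_pos d
  obtain ⟨ι, _, ⟨e⟩⟩ := sepBound_phase_increment (d := d) hα hR hρ hδ hρR hδR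
  have hlocal (k : Space d) (h : Space d → ℂ) (hh : BandLimited h)
      (hX : ∀ ξ ∉ annulus d R, h ξ = 0) :
      ∫⁻ x in Metric.ball k ρ, (⨆ t ∈ Set.Ioo 0 δ, ‖osc α h t x‖ₑ) ^ 2 ∂μ ≤
        (ENNReal.ofReal ((2 * Real.pi) ^ d) * K) ^ 2 *
          ENNReal.ofReal (5 ^ (((d : ℝ) - γ) / 2 + s)) *
          ENNReal.ofReal (R ^ ((d : ℝ) - γ) * (ρ * R) ^ (2 * s)) * ∫⁻ ξ, ‖h ξ‖ₑ ^ 2 := by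
    rw [mul_assoc _ (ENNReal.ofReal _) (lintegral _ _)]
    exact (lintegral_mono fun x => pow_le_pow_left' (biSup_mono fun t ht =>
      ⟨ht.1, ht.2.trans_le hδρ⟩) 2).trans (h𝓜.lintegral_ball_le_of_support hα hγ hs hμ k hρ hR hρR
        hh fun ξ hξ => hX ξ fun hξX => hξ.not_ge hξX.2)
  have hglobal := e.volume_mul_lintegral_iSup_osc_sq_le hα
    (by rw [div_mul_cancel₀ _ hρ.ne']; linarith [cutoff_le d]) hlocal hg
    fun ξ hξ ζ hζ => sub_eq_zero_of_notMem_annulus hρ hρR hlow hhigh hξ hζ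
  rw [mul_left_comm _ (volume (Metric.closedBall _ _)), mul_left_comm _ (volume _),
    mul_left_comm _ (volume _)] at hglobal
  refine (le_of_mul_half_sq_mul_le (Metric.measure_ball_pos _ _ hρ).ne' measure_ball_lt_top.ne
    (Metric.measure_closedBall_pos _ _ (div_pos hc hρ)).ne' measure_closedBall_lt_top.ne
    hglobal).trans_eq ?_
  rw [volume_ball_mul_volume_closedBall hρ hc.le, coe_shortTimeConst]
  ring

/-! ### Dyadic shells and time blocks -/

/- Cauchy–Schwarz for the sum over `k`, with the weights `b k`. -/
theorem lintegral_sq_le_tsum_mul {Y K : Type*} [MeasurableSpace Y] {ν : Measure Y} [Countable K]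
    {b e : K → ℝ≥0∞} {F : Y → ℝ≥0∞} {f : K → Y → ℝ≥0∞} (hb : ∀ k, b k ≠ 0) (hb' : ∀ k, b k ≠ ∞)
    (hfm : ∀ k, Measurable (f k)) (hF : ∀ y, F y ≤ ∑' k, f k y)
    (hf : ∀ k, ∫⁻ y, f k y ^ 2 ∂ν ≤ b k ^ 2 * e k) :
    ∫⁻ y, F y ^ 2 ∂ν ≤ (∑' k, b k) * ∑' k, b k * e k := by
  have hterm (k : K) : ∫⁻ y, b k * ((b k)⁻¹ * f k y) ^ 2 ∂ν ≤ b k * e k := by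
    have hinv : (b k)⁻¹ ^ 2 ≠ ∞ := ENNReal.pow_ne_top (ENNReal.inv_ne_top.2 (hb k))
    simp only [mul_pow]
    rw [lintegral_const_mul' _ _ (hb' k), lintegral_const_mul' _ _ hinv]
    refine mul_le_mul_right ((mul_le_mul_right (hf k) _).trans_eq ?_) _
    rw [← mul_assoc, ← mul_pow, ENNReal.inv_mul_cancel (hb k) (hb' k), one_pow, one_mul]
  have hmeas (k : K) : Measurable fun y => b k * ((b k)⁻¹ * f k y) ^ 2 :=
    (((hfm k).const_mul _).pow_const 2).const_mul _
  calc ∫⁻ y, F y ^ 2 ∂ν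
      ≤ ∫⁻ y, (∑' k, b k) * ∑' k, b k * ((b k)⁻¹ * f k y) ^ 2 ∂ν := by
        refine lintegral_mono fun y => (pow_le_pow_left' (hF y) 2).trans ?_
        refine le_trans (le_of_eq ?_) (tsum_mul_sq_le b fun k => (b k)⁻¹ * f k y)
        refine congrArg (· ^ 2) (tsum_congr fun k => ?_)
        rw [← mul_assoc, ENNReal.mul_inv_cancel (hb k) (hb' k), one_mul]
    _ = (∑' k, b k) * ∑' k, ∫⁻ y, b k * ((b k)⁻¹ * f k y) ^ 2 ∂ν := by
        rw [lintegral_const_mul _ (.tsum hmeas), lintegral_tsum fun k => (hmeas k).aemeasurable]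
    _ ≤ (∑' k, b k) * ∑' k, b k * e k := mul_le_mul_right (ENNReal.tsum_le_tsum hterm) _

theorem schur_lintegral {Y J K : Type*} [MeasurableSpace Y] {ν : Measure Y} [Countable K]
    {b : J → K → ℝ≥0∞} {e : K → ℝ≥0∞} {F : J → Y → ℝ≥0∞} {f : J → K → Y → ℝ≥0∞} {S S' : ℝ≥0∞}
    (hb : ∀ j k, b j k ≠ 0) (hb' : ∀ j k, b j k ≠ ∞) (hS : ∀ j, ∑' k, b j k ≤ S)
    (hS' : ∀ k, ∑' j, b j k ≤ S') (hfm : ∀ j k, Measurable (f j k))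
    (hF : ∀ j y, F j y ≤ ∑' k, f j k y) (hf : ∀ j k, ∫⁻ y, f j k y ^ 2 ∂ν ≤ b j k ^ 2 * e k) :
    ∑' j, ∫⁻ y, F j y ^ 2 ∂ν ≤ S * S' * ∑' k, e k :=
  calc ∑' j, ∫⁻ y, F j y ^ 2 ∂ν ≤ ∑' j, S * ∑' k, b j k * e k :=
        ENNReal.tsum_le_tsum fun j => (lintegral_sq_le_tsum_mul (hb j) (hb' j) (hfm j) (hF j)
          (hf j)).trans (mul_le_mul_left (hS j) _)
    _ = S * ∑' k, (∑' j, b j k) * e k := by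
        rw [ENNReal.tsum_mul_left, ENNReal.tsum_comm]
        simp only [ENNReal.tsum_mul_right]
    _ ≤ S * ∑' k, S' * e k :=
        mul_le_mul_right (ENNReal.tsum_le_tsum fun k => mul_le_mul_left (hS' k) _) _
    _ = S * S' * ∑' k, e k := by rw [ENNReal.tsum_mul_left, mul_assoc]

theorem summable_two_rpow_neg_abs {c : ℝ} (hc : 0 < c) :
    Summable fun i : ℤ => (2 : ℝ) ^ (-(c * |(i : ℝ)|)) := by
  have hgeom : Summable fun n : ℕ => ((2 : ℝ) ^ (-c)) ^ n :=
    summable_geometric_of_lt_one (by positivity)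
      (Real.rpow_lt_one_of_one_lt_of_neg one_lt_two (neg_lt_zero.2 hc))
  refine .of_nat_of_neg ?_ ?_ <;>
  · refine hgeom.congr fun n => ?_
    simp [← Real.rpow_natCast, ← Real.rpow_mul]

theorem mul_abs_sub_floor_div_le {p : ℝ} (hp : 0 < p) (x y : ℝ) :
    p * |x - ⌊y / p⌋| ≤ p + |p * x - y| := by
  have hfloor : y - p * ⌊y / p⌋ = p * Int.fract (y / p) := by
    rw [← Int.self_sub_floor, mul_sub, mul_div_cancel₀ _ hp.ne']
  have hfract : |y - p * ⌊y / p⌋| ≤ p := by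
    rw [hfloor, abs_of_nonneg (mul_nonneg hp.le (Int.fract_nonneg _))]
    exact mul_le_of_le_one_right hp.le (Int.fract_lt_one _).le
  calc p * |x - ⌊y / p⌋| = |(p * x - y) + (y - p * ⌊y / p⌋)| := by
        rw [sub_add_sub_cancel, ← mul_sub, abs_mul, abs_of_pos hp]
    _ ≤ p + |p * x - y| := by linarith [abs_add_le (p * x - y) (y - p * ⌊y / p⌋)]

theorem exists_tsum_two_rpow_le {p ε : ℝ} (hp : 0 < p) (hε : 0 < ε) : ∃ S : ℝ≥0, ∀ y : ℝ,
    ∑' k : ℕ, ENNReal.ofReal (2 ^ (-(ε * |p * k - y|))) ≤ S := by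
  let f (i : ℤ) : ℝ := 2 ^ (ε * p) * 2 ^ (-(ε * p * |(i : ℝ)|))
  have hf : Summable f := (summable_two_rpow_neg_abs (mul_pos hε hp)).mul_left _
  refine ⟨(∑' i, ENNReal.ofReal (f i)).toNNReal, fun y => ?_⟩
  rw [ENNReal.coe_toNNReal hf.tsum_ofReal_ne_top]
  have hinj : Function.Injective fun k : ℕ => (k : ℤ) - ⌊y / p⌋ := fun a b h => by simpa using h
  refine (ENNReal.tsum_le_tsum fun k => ENNReal.ofReal_le_ofReal ?_).trans
    (ENNReal.tsum_comp_le_tsum_of_injective hinj fun i => ENNReal.ofReal (f i))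
  simp only [f]
  rw [← Real.rpow_add two_pos]
  refine Real.rpow_le_rpow_of_exponent_le one_le_two ?_
  have hfloor := mul_le_mul_of_nonneg_left (mul_abs_sub_floor_div_le hp k y) hε.le
  push_cast
  linarith

/-- The dyadic shell `2 ^ (k - 1) ≤ |ξ| < 2 ^ k`, or the unit ball for `k = 0`. -/
def shell (d : ℕ) : ℕ → Set (Space d) :=
  disjointed fun k => Metric.ball (0 : Space d) (2 ^ k)

theorem measurableSet_shell (k : ℕ) : MeasurableSet (shell d k) :=
  MeasurableSet.disjointed (fun _ => measurableSet_ball) k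

theorem norm_lt_of_mem_shell {k : ℕ} {ξ : Space d} (h : ξ ∈ shell d k) : ‖ξ‖ < 2 ^ k :=
  mem_ball_zero_iff.1 (disjointed_subset (fun k : ℕ => Metric.ball (0 : Space d) (2 ^ k)) k h)

theorem le_norm_of_mem_shell {k : ℕ} {ξ : Space d} (h : ξ ∈ shell d (k + 1)) : 2 ^ k ≤ ‖ξ‖ := by
  have hmono : Monotone fun k : ℕ => Metric.ball (0 : Space d) (2 ^ k) := fun a b hab =>
    Metric.ball_subset_ball (pow_le_pow_right₀ one_le_two hab)
  rw [shell, hmono.disjointed_add_one] at h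
  simpa using h.2

theorem iUnion_shell : ⋃ k, shell d k = Set.univ := by
  rw [shell, iUnion_disjointed]
  refine Set.eq_univ_of_forall fun ξ => Set.mem_iUnion.2 ?_
  obtain ⟨n, hn⟩ := pow_unbounded_of_one_lt ‖ξ‖ one_lt_two
  exact ⟨n, mem_ball_zero_iff.2 hn⟩

theorem pairwise_disjoint_shell : Pairwise (Function.onFun Disjoint (shell d)) :=
  disjoint_disjointed _

theorem hasSum_osc_shell {α : ℝ} (hα : 0 < α) {g : Space d → ℂ} (hg : Integrable g) (t : ℝ)
    (x : Space d) : HasSum (fun k => osc α ((shell d k).indicator g) t x) (osc α g t x) := by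
  have hosc (k : ℕ) : osc α ((shell d k).indicator g) t x =
      ∫ ξ in shell d k, phase α t x ξ * g ξ := by
    rw [osc, ← integral_indicator (measurableSet_shell k)]
    simp only [Set.indicator_mul_right]
  have hsum := hasSum_integral_iUnion (f := fun ξ => phase α t x ξ * g ξ) measurableSet_shell
    pairwise_disjoint_shell (integrable_phase_mul hα hg t x).integrableOn
  rw [iUnion_shell, setIntegral_univ] at hsum
  simp only [hosc]
  exact hsum

theorem tsum_energy_shell (g : Space d → ℂ) (σ : ℝ) :
    ∑' k, energy σ ((shell d k).indicator g) = energy σ g := by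
  have henergy (k : ℕ) : energy σ ((shell d k).indicator g) =
      ∫⁻ ξ in shell d k, ENNReal.ofReal ((1 + ‖ξ‖ ^ 2) ^ σ) * ‖g ξ‖ₑ ^ 2 := by
    rw [energy, ← lintegral_indicator (measurableSet_shell k)]
    refine lintegral_congr fun ξ => ?_
    by_cases hξ : ξ ∈ shell d k <;> simp [hξ]
  simp only [henergy]
  rw [← lintegral_iUnion measurableSet_shell pairwise_disjoint_shell, iUnion_shell,
    setLIntegral_univ, energy]

theorem BandLimited.indicator {g : Space d → ℂ} (hg : BandLimited g) {s : Set (Space d)}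
    (hs : MeasurableSet s) : BandLimited (s.indicator g) := by
  obtain ⟨R, hR⟩ := hg.bounded
  refine ⟨hg.measurable.indicator hs, hg.sq_lt_top.trans_le' (lintegral_mono fun ξ => ?_), R,
    fun ξ hξ => ?_⟩
  · exact pow_le_pow_left' (enorm_indicator_le_enorm_self g ξ) 2
  · rw [Set.indicator_apply_eq_zero]
    exact fun _ => hR ξ hξ

theorem two_rpow_le_weight_of_mem_shell {σ : ℝ} (hσ : 0 ≤ σ) {k : ℕ} {ξ : Space d}
    (hξ : ξ ∈ shell d k) : (2 : ℝ) ^ (2 * k * σ) ≤ 4 ^ σ * (1 + ‖ξ‖ ^ 2) ^ σ := by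
  rw [← Real.mul_rpow (by norm_num) (by positivity), Real.rpow_mul two_pos.le]
  refine Real.rpow_le_rpow (by positivity) ?_ hσ
  have hsq : (2 : ℝ) ^ (2 * (k : ℝ)) = (2 ^ k) ^ 2 := by
    rw [mul_comm, Real.rpow_mul two_pos.le, Real.rpow_natCast]
    norm_num
  rw [hsq]
  rcases k with _ | k
  · nlinarith [sq_nonneg ‖ξ‖]
  · have hξk := pow_le_pow_left₀ (by positivity) (le_norm_of_mem_shell hξ) 2
    rw [pow_succ (2 : ℝ) k]
    linarith

theorem lintegral_shell_le (g : Space d → ℂ) {σ : ℝ} (hσ : 0 ≤ σ) (k : ℕ) :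
    ENNReal.ofReal (2 ^ (2 * k * σ)) * ∫⁻ ξ, ‖(shell d k).indicator g ξ‖ₑ ^ 2 ≤
      ENNReal.ofReal (4 ^ σ) * energy σ ((shell d k).indicator g) := by
  rw [energy, ← lintegral_const_mul' _ _ ENNReal.ofReal_ne_top,
    ← lintegral_const_mul' _ _ ENNReal.ofReal_ne_top]
  refine lintegral_mono fun ξ => ?_
  by_cases hξ : ξ ∈ shell d k
  · rw [← mul_assoc, ← ENNReal.ofReal_mul (by positivity)]
    exact mul_le_mul_left (ENNReal.ofReal_le_ofReal (two_rpow_le_weight_of_mem_shell hσ hξ)) _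
  · simp [hξ]

/-- The datum whose evolution is the complex conjugate of the evolution of `g` backwards in time;
it transfers estimates for positive times to negative times. -/
def reflConj (g : Space d → ℂ) : Space d → ℂ := fun ξ => (starRingEnd ℂ) (g (-ξ))

theorem osc_reflConj (α : ℝ) (g : Space d → ℂ) (t : ℝ) (x : Space d) :
    osc α (reflConj g) t x = (starRingEnd ℂ) (osc α g (-t) x) := by
  rw [osc, osc, ← integral_conj, ← integral_neg_eq_self]
  refine integral_congr_ae (.of_forall fun ξ => ?_)
  simp only [reflConj, phase, map_mul, ← Complex.exp_conj, Complex.conj_I, Complex.conj_ofReal,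
    inner_neg_right, norm_neg, neg_neg]
  congr 2
  push_cast
  ring

theorem enorm_reflConj (g : Space d → ℂ) (ξ : Space d) : ‖reflConj g ξ‖ₑ = ‖g (-ξ)‖ₑ := by
  rw [reflConj, RCLike.enorm_conj]

theorem lintegral_enorm_reflConj_sq (g : Space d → ℂ) :
    ∫⁻ ξ, ‖reflConj g ξ‖ₑ ^ 2 = ∫⁻ ξ, ‖g ξ‖ₑ ^ 2 := by
  simp only [enorm_reflConj]
  exact lintegral_neg_eq_self (fun ξ => ‖g ξ‖ₑ ^ 2)

theorem BandLimited.reflConj {g : Space d → ℂ} (hg : BandLimited g) : BandLimited (reflConj g) := by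
  obtain ⟨R, hR⟩ := hg.bounded
  refine ⟨Complex.continuous_conj.measurable.comp (hg.measurable.comp measurable_neg), ?_, R,
    fun ξ hξ => ?_⟩
  · rw [lintegral_enorm_reflConj_sq]
    exact hg.sq_lt_top
  · rw [SeqSchrodinger.reflConj, hR (-ξ) (by rwa [norm_neg]), map_zero]

theorem lintegral_iSup_symm_le {α : ℝ} (hα : 0 < α) {μ : Measure (Space d)} {g : Space d → ℂ}
    (hg : Integrable g) {δ : ℝ} {c : ℝ≥0∞}
    (hpos : ∫⁻ x, (⨆ t ∈ Set.Ioo 0 δ, ‖osc α g t x‖ₑ) ^ 2 ∂μ ≤ c)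
    (hneg : ∫⁻ x, (⨆ t ∈ Set.Ioo 0 δ, ‖osc α (reflConj g) t x‖ₑ) ^ 2 ∂μ ≤ c) :
    ∫⁻ x, (⨆ t ∈ {t : ℝ | 0 < |t| ∧ |t| < δ}, ‖osc α g t x‖ₑ) ^ 2 ∂μ ≤ 2 * c := by
  have hsplit (x : Space d) : (⨆ t ∈ {t : ℝ | 0 < |t| ∧ |t| < δ}, ‖osc α g t x‖ₑ) ^ 2 ≤
      (⨆ t ∈ Set.Ioo 0 δ, ‖osc α g t x‖ₑ) ^ 2 +
        (⨆ t ∈ Set.Ioo 0 δ, ‖osc α (reflConj g) t x‖ₑ) ^ 2 := by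
    refine biSup_sq_le fun t ht => ?_
    rcases lt_or_ge 0 t with h | h
    · refine le_add_right (pow_le_pow_left' ?_ 2)
      exact le_iSup₂ (f := fun t (_ : t ∈ Set.Ioo 0 δ) => ‖osc α g t x‖ₑ) t
        ⟨h, (le_abs_self t).trans_lt ht.2⟩
    · have hosc : ‖osc α g t x‖ₑ = ‖osc α (reflConj g) (-t) x‖ₑ := by
        rw [osc_reflConj, RCLike.enorm_conj, neg_neg]
      rw [hosc]
      refine le_add_left (pow_le_pow_left' ?_ 2)
      rw [Set.mem_ofPred_eq, abs_of_nonpos h] at ht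
      exact le_iSup₂ (f := fun t (_ : t ∈ Set.Ioo 0 δ) => ‖osc α (reflConj g) t x‖ₑ) (-t) ht
  calc ∫⁻ x, (⨆ t ∈ {t : ℝ | 0 < |t| ∧ |t| < δ}, ‖osc α g t x‖ₑ) ^ 2 ∂μ
      ≤ ∫⁻ x, ((⨆ t ∈ Set.Ioo 0 δ, ‖osc α g t x‖ₑ) ^ 2 +
          (⨆ t ∈ Set.Ioo 0 δ, ‖osc α (reflConj g) t x‖ₑ) ^ 2) ∂μ := lintegral_mono hsplit
    _ ≤ c + c := by
        rw [lintegral_add_left ((measurable_iSup_osc hα hg _).pow_const 2)]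
        exact add_le_add hpos hneg
    _ = 2 * c := (two_mul c).symm

theorem energy_reflConj (σ : ℝ) (g : Space d → ℂ) : energy σ (reflConj g) = energy σ g := by
  simp only [energy, enorm_reflConj]
  simpa only [norm_neg] using
    lintegral_neg_eq_self fun ξ => ENNReal.ofReal ((1 + ‖ξ‖ ^ 2) ^ σ) * ‖g ξ‖ₑ ^ 2

theorem two_pow_rpow (k : ℕ) (x : ℝ) : ((2 : ℝ) ^ k) ^ x = 2 ^ (k * x) := by
  rw [← Real.rpow_natCast, ← Real.rpow_mul two_pos.le]

theorem indicator_shell_of_lt_norm (g : Space d → ℂ) {k : ℕ} {ξ : Space d} (h : 2 ^ k < ‖ξ‖) :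
    (shell d k).indicator g ξ = 0 :=
  Set.indicator_of_notMem (fun hξ => (norm_lt_of_mem_shell hξ).not_gt h) g

theorem indicator_shell_of_norm_lt (g : Space d → ℂ) {k : ℕ} {ξ : Space d} (h : ‖ξ‖ < 2 ^ k) :
    (shell d (k + 1)).indicator g ξ = 0 :=
  Set.indicator_of_notMem (fun hξ => (le_norm_of_mem_shell hξ).not_gt h) g

theorem ofReal_two_pow_rpow_mul_le {a b e p : ℝ} {k : ℕ} (h : e - p * k ≤ b) :
    ENNReal.ofReal ((2 ^ k) ^ a * 2 ^ (2 * e)) ≤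
      ENNReal.ofReal (2 ^ b) ^ 2 * ENNReal.ofReal (2 ^ (2 * k * (a / 2 + p))) := by
  rw [← ENNReal.ofReal_pow (by positivity), ← ENNReal.ofReal_mul (by positivity), two_pow_rpow,
    ← Real.rpow_add two_pos, ← Real.rpow_mul_natCast two_pos.le, ← Real.rpow_add two_pos]
  refine ENNReal.ofReal_le_ofReal (Real.rpow_le_rpow_of_exponent_le one_le_two ?_)
  push_cast
  linarith

theorem tsum_lintegral_shell_le (g : Space d → ℂ) {σ : ℝ} (hσ : 0 ≤ σ) :
    ∑' k : ℕ, ENNReal.ofReal (2 ^ (2 * k * σ)) * ∫⁻ ξ, ‖(shell d k).indicator g ξ‖ₑ ^ 2 ≤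
      ENNReal.ofReal (4 ^ σ) * energy σ g := by
  rw [← tsum_energy_shell, ← ENNReal.tsum_mul_left]
  exact ENNReal.tsum_le_tsum fun k => lintegral_shell_le g hσ k

theorem GrowthBound.lintegral_osc_shell_le {α γ : ℝ} (hα : 0 < α) {μ : Measure (Space d)} {A : ℝ≥0}
    (hμ : GrowthBound γ μ A) {g : Space d → ℂ} (hg : BandLimited g) (s t : ℝ) (k : ℕ) :
    ∫⁻ x, ‖osc α ((shell d k).indicator g) t x‖ₑ ^ 2 ∂μ ≤
      ENNReal.ofReal (2 ^ (-(s * k))) ^ 2 * (multiplierConst d * A *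
        (ENNReal.ofReal (2 ^ (2 * k * (((d : ℝ) - γ) / 2 + s))) *
          ∫⁻ ξ, ‖(shell d k).indicator g ξ‖ₑ ^ 2)) := by
  have hblock := ofReal_two_pow_rpow_mul_le (k := k) (a := d - γ) (zero_sub (s * k)).le
  rw [mul_zero, Real.rpow_zero, mul_one] at hblock
  refine (hμ.lintegral_osc_le hα (by positivity) (hg.indicator (measurableSet_shell k))
    (fun ξ => indicator_shell_of_lt_norm g) t).trans ?_
  calc _ ≤ multiplierConst d * A * (ENNReal.ofReal (2 ^ (-(s * k))) ^ 2 *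
          ENNReal.ofReal (2 ^ (2 * k * (((d : ℝ) - γ) / 2 + s)))) *
          ∫⁻ ξ, ‖(shell d k).indicator g ξ‖ₑ ^ 2 := by gcongr
    _ = _ := by ring

theorem exists_lintegral_osc_le_energy {α γ s : ℝ} (hα : 0 < α) (hγ : γ ≤ d) (hs : 0 < s) :
    ∃ C : ℝ≥0, ∀ {μ : Measure (Space d)} {A : ℝ≥0}, GrowthBound γ μ A →
      ∀ {g : Space d → ℂ}, BandLimited g → ∀ t : ℝ,
        ∫⁻ x, ‖osc α g t x‖ₑ ^ 2 ∂μ ≤ C * A * energy (((d : ℝ) - γ) / 2 + s) g := by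
  obtain ⟨S, hS⟩ := exists_tsum_two_rpow_le hs one_pos
  set σ := ((d : ℝ) - γ) / 2 + s with hσ_def
  have hσ : 0 ≤ σ := by linarith
  refine ⟨S * multiplierConst d * (4 ^ σ : ℝ).toNNReal, fun {μ A} hμ {g} hg t => ?_⟩
  let b (k : ℕ) : ℝ≥0∞ := ENNReal.ofReal (2 ^ (-(s * k)))
  let e (k : ℕ) : ℝ≥0∞ :=
    ENNReal.ofReal (2 ^ (2 * k * σ)) * ∫⁻ ξ, ‖(shell d k).indicator g ξ‖ₑ ^ 2
  have hb (k : ℕ) : b k ≤ 1 := ENNReal.ofReal_le_one.2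
    (Real.rpow_le_one_of_one_le_of_nonpos one_le_two (neg_nonpos.2 (by positivity)))
  have hbS : ∑' k, b k ≤ S := by
    simpa only [b, one_mul, sub_zero, abs_of_nonneg (mul_nonneg hs.le (Nat.cast_nonneg _))]
      using hS 0
  calc ∫⁻ x, ‖osc α g t x‖ₑ ^ 2 ∂μ
      ≤ (∑' k, b k) * ∑' k, b k * (multiplierConst d * A * e k) := by
        refine lintegral_sq_le_tsum_mul
          (f := fun k x => ‖osc α ((shell d k).indicator g) t x‖ₑ) (fun k => ?_)
          (fun k => ENNReal.ofReal_ne_top)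
          (fun k => (continuous_osc_right hα
            (hg.indicator (measurableSet_shell k)).integrable t).enorm.measurable)
          (fun x => ?_) (hμ.lintegral_osc_shell_le hα hg s t)
        · exact (ENNReal.ofReal_pos.2 (by positivity)).ne'
        · rw [← (hasSum_osc_shell hα hg.integrable t x).tsum_eq]
          exact enorm_tsum_le_tsum_enorm
    _ ≤ S * ∑' k, multiplierConst d * A * e k :=
        mul_le_mul' hbS (ENNReal.tsum_le_tsum fun k => mul_le_of_le_one_left' (hb k))
    _ ≤ S * (multiplierConst d * A * (ENNReal.ofReal (4 ^ σ) * energy σ g)) := by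
        rw [ENNReal.tsum_mul_left]
        gcongr
        exact tsum_lintegral_shell_le g hσ
    _ = (S * multiplierConst d * (4 ^ σ : ℝ).toNNReal : ℝ≥0) * A * energy σ g := by
        push_cast
        rw [ENNReal.ofReal]
        ring

theorem sTilde_pos {α r s : ℝ} (hα : 0 < α) (hr : 0 < r) (hs : 0 < s) : 0 < sTilde α r s := by
  have := lt_min hα one_pos
  unfold sTilde
  positivity

theorem sTilde_mul {α r s : ℝ} (hα : 0 < α) (hr : 0 < r) (hs : 0 < s) :
    sTilde α r s * (r * min α 1 + 2 * s) = r * α * s := by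
  have := lt_min hα one_pos
  have hne : r * min α 1 + 2 * s ≠ 0 := by positivity
  unfold sTilde
  field_simp

/- The three bounds are the exponents of the estimates for frequencies `2 ^ k` and times `2 ^ (-j)`
that come from counting times, from the maximal estimate, and from `|e^{ix} - 1| ≤ |x|`.
The exponent `sTilde` is the one at which the first two balance. -/
theorem exists_block_decay {α r s : ℝ} (hα : 0 < α) (hr : 0 < r) (hs : 0 < s) :
    ∃ ε : ℝ, 0 < ε ∧ ∀ k j : ℝ, 0 ≤ k →
      (0 ≤ sTilde α r s * k - r / 2 * j →
        r / 2 * j - sTilde α r s * k ≤ -(ε * |sTilde α r s * k - r / 2 * j|)) ∧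
      (sTilde α r s * k - r / 2 * j < 0 →
        (α * k - j) * (s / min α 1) - sTilde α r s * k ≤
          -(ε * |sTilde α r s * k - r / 2 * j|)) ∧
      (sTilde α r s * k - r / 2 * j < 0 → α * k - j ≤ 0 →
        (α * k - j) - sTilde α r s * k ≤ -(ε * |sTilde α r s * k - r / 2 * j|)) := by
  have hp := sTilde_pos hα hr hs
  have hbalance := sTilde_mul hα hr hs
  have hm : 0 < min α 1 := lt_min hα one_pos
  set p := sTilde α r s
  set m := min α 1
  set ε := min (min 1 (2 * s / (r * m))) (min (2 / r) (2 * p / (α * r)))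
  have hε : 0 < ε := by positivity
  have hε_one : ε ≤ 1 := (min_le_left _ _).trans (min_le_left _ _)
  have hε_max : ε ≤ 2 * s / (r * m) := (min_le_left _ _).trans (min_le_right _ _)
  have hε_time : ε ≤ 2 / r := (min_le_right _ _).trans (min_le_left _ _)
  have hε_freq : ε ≤ 2 * p / (α * r) := (min_le_right _ _).trans (min_le_right _ _)
  refine ⟨ε, hε, fun k j hk => ⟨fun hy => ?_, fun hy => ?_, fun hy hkj => ?_⟩⟩
  · rw [abs_of_nonneg hy]
    nlinarith
  · have hslope : (α * k - j) * (s / m) - p * k = 2 * s / (r * m) * (p * k - r / 2 * j) := by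
      field_simp
      linear_combination (-k) * hbalance
    rw [abs_of_neg hy, hslope]
    nlinarith
  · rw [abs_of_neg hy]
    rw [le_div_iff₀ hr] at hε_time
    rw [le_div_iff₀ (by positivity)] at hε_freq
    nlinarith [mul_nonneg (sub_nonneg.2 hε_time) (sub_nonneg.2 hkj),
      mul_nonneg hk (sub_nonneg.2 hε_freq), mul_nonneg (mul_nonneg hε.le hp.le) hk]

theorem enorm_sub_sq_le (a b : ℂ) : ‖a - b‖ₑ ^ 2 ≤ 2 * ‖a‖ₑ ^ 2 + 2 * ‖b‖ₑ ^ 2 :=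
  (pow_le_pow_left' enorm_sub_le 2).trans (add_sq_le_two _ _)

theorem lintegral_two_mul_add_le {Y : Type*} [MeasurableSpace Y] {ν : Measure Y} {F G : Y → ℝ≥0∞}
    (hF : Measurable F) {a b : ℝ≥0∞} (ha : ∫⁻ y, F y ∂ν ≤ a) (hb : ∫⁻ y, G y ∂ν ≤ b) :
    ∫⁻ y, (2 * F y + 2 * G y) ∂ν ≤ 2 * a + 2 * b := by
  rw [lintegral_add_left (hF.const_mul 2), lintegral_const_mul _ hF,
    lintegral_const_mul' _ _ (by norm_num)]
  gcongr

theorem exists_localization_scale {α R δ : ℝ} (hα : 0 < α) (hR : 0 < R) (hδ : 1 ≤ R ^ α * δ) :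
    ∃ ρ : ℝ, 0 < ρ ∧ ρ * R = (R ^ α * δ) ^ (min α 1)⁻¹ ∧ 1 ≤ ρ * R ∧ δ ≤ ρ ^ α ∧
      δ * R ^ (α - 1) ≤ ρ := by
  have hm : 0 < min α 1 := lt_min hα one_pos
  have hRα : 0 < R ^ α := Real.rpow_pos_of_pos hR α
  have hle {q : ℝ} (hq : 1 ≤ q) : R ^ α * δ ≤ (R ^ α * δ) ^ q := by
    simpa only [Real.rpow_one] using Real.rpow_le_rpow_of_exponent_le hδ hq
  set Λ := R ^ α * δ
  have hΛ : 0 < Λ := one_pos.trans_le hδ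
  have hΛm : Λ ≤ Λ ^ (min α 1)⁻¹ := hle ((one_le_inv₀ hm).2 (min_le_right _ _))
  have hρR : Λ ^ (min α 1)⁻¹ / R * R = Λ ^ (min α 1)⁻¹ := div_mul_cancel₀ _ hR.ne'
  refine ⟨Λ ^ (min α 1)⁻¹ / R, by positivity, hρR, hρR.symm ▸ hδ.trans hΛm, ?_, ?_⟩
  · rw [Real.div_rpow (by positivity) hR.le, ← Real.rpow_mul hΛ.le, le_div_iff₀ hRα, mul_comm]
    refine hle ?_
    rw [inv_mul_eq_div]
    exact (one_le_div hm).2 (min_le_left _ _)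
  · rw [Real.rpow_sub_one hR.ne', ← mul_div_assoc, mul_comm]
    exact div_le_div_of_nonneg_right hΛm hR.le

theorem lintegral_iSup_osc_sub_sq_le {α : ℝ} (hα : 0 < α) {μ : Measure (Space d)} {g : Space d → ℂ}
    (hg : Integrable g) {T : Set ℝ} {a b : ℝ≥0∞}
    (ha : ∫⁻ x, (⨆ t ∈ T, ‖osc α g t x‖ₑ) ^ 2 ∂μ ≤ a) (hb : ∫⁻ x, ‖osc α g 0 x‖ₑ ^ 2 ∂μ ≤ b) :
    ∫⁻ x, (⨆ t ∈ T, ‖osc α g t x - osc α g 0 x‖ₑ) ^ 2 ∂μ ≤ 2 * a + 2 * b := by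
  refine (lintegral_mono fun x => biSup_sq_le fun t ht => (enorm_sub_sq_le _ _).trans ?_).trans
    (lintegral_two_mul_add_le ((measurable_iSup_osc hα hg T).pow_const 2) ha hb)
  gcongr
  exact le_iSup₂ (f := fun t (_ : t ∈ T) => ‖osc α g t x‖ₑ) t ht

theorem MaximalFamily.exists_lintegral_iSup_osc_sub_le {α γ s : ℝ} (hα : 0 < α) (hγ : γ ≤ d)
    (hs : 0 < s) : ∃ C : ℝ≥0, ∀ {A K : ℝ≥0} {𝓜 : Set (Measure (Space d))},
    MaximalFamily α γ (((d : ℝ) - γ) / 2 + s) A K 𝓜 → ∀ {μ : Measure (Space d)}, μ ∈ 𝓜 →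
      ∀ {R δ : ℝ}, 0 < R → 0 < δ → 1 ≤ R ^ α * δ → ∀ {g : Space d → ℂ}, BandLimited g →
        (∀ ξ, ‖ξ‖ < R / 2 → g ξ = 0) → (∀ ξ, R < ‖ξ‖ → g ξ = 0) →
        ∫⁻ x, (⨆ t ∈ {t : ℝ | 0 < |t| ∧ |t| < δ}, ‖osc α g t x - osc α g 0 x‖ₑ) ^ 2 ∂μ ≤
          C * (A + K ^ 2) *
            ENNReal.ofReal (R ^ ((d : ℝ) - γ) * (R ^ α * δ) ^ (2 * (s / min α 1))) *
            ∫⁻ ξ, ‖g ξ‖ₑ ^ 2 := by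
  set σ := ((d : ℝ) - γ) / 2 + s
  have := lt_min hα one_pos
  refine ⟨4 * shortTimeConst d α * ((2 * Real.pi) ^ d).toNNReal ^ 2 * (5 ^ σ : ℝ).toNNReal +
    2 * multiplierConst d, fun {A K 𝓜} h𝓜 {μ} hμ {R δ} hR hδ hΛ {g} hg hlow hhigh => ?_⟩
  obtain ⟨ρ, hρ, hρR_eq, hρR, hδρ, hδR⟩ := exists_localization_scale hα hR hΛ
  have hpos := h𝓜.short_time hα hγ hs hμ hR hρ hδ hρR hδρ hδR hg hlow hhigh
  have hneg := h𝓜.short_time hα hγ hs hμ hR hρ hδ hρR hδρ hδR hg.reflConj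
    (fun ξ h => by simp [reflConj, hlow (-ξ) (by rwa [norm_neg])])
    (fun ξ h => by simp [reflConj, hhigh (-ξ) (by rwa [norm_neg])])
  rw [lintegral_enorm_reflConj_sq] at hneg
  have hsub := lintegral_iSup_osc_sub_sq_le hα hg.integrable
    (lintegral_iSup_symm_le hα hg.integrable hpos hneg)
    ((h𝓜.growth μ hμ).lintegral_osc_le hα hR hg hhigh 0)
  have hexp : (ρ * R) ^ (2 * s) = (R ^ α * δ) ^ (2 * (s / min α 1)) := by
    rw [hρR_eq, ← Real.rpow_mul (by positivity)]
    congr 1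
    ring
  rw [hexp] at hsub
  set E := ∫⁻ ξ, ‖g ξ‖ₑ ^ 2
  set Q := ENNReal.ofReal (R ^ ((d : ℝ) - γ) * (R ^ α * δ) ^ (2 * (s / min α 1)))
  have hQ : ENNReal.ofReal (R ^ ((d : ℝ) - γ)) ≤ Q := ENNReal.ofReal_le_ofReal
    (le_mul_of_one_le_right (by positivity) (Real.one_le_rpow hΛ (by positivity)))
  refine (hsub.trans (add_le_add_right (mul_le_mul_right (mul_le_mul_left
    (mul_le_mul_right hQ _) _) _) _)).trans ?_
  set P := ENNReal.ofReal ((2 * Real.pi) ^ d)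
  set F := ENNReal.ofReal (5 ^ σ)
  have hcoe : ((4 * shortTimeConst d α * ((2 * Real.pi) ^ d).toNNReal ^ 2 * (5 ^ σ : ℝ).toNNReal +
      2 * multiplierConst d : ℝ≥0) : ℝ≥0∞) =
      4 * shortTimeConst d α * P ^ 2 * F + 2 * multiplierConst d := by
    push_cast
    rfl
  rw [hcoe]
  refine (le_self_add (b := (4 * shortTimeConst d α * P ^ 2 * F * A +
    2 * multiplierConst d * K ^ 2) * Q * E)).trans_eq ?_
  ring

/-- The dyadic block of indices `n` for which `|t n|` is comparable to `2 ^ (-j)`. -/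
def timeBlock (t : ℕ → ℝ) (j : ℕ) : Set ℕ :=
  {n | (2 : ℝ) ^ (-((j : ℝ) + 1)) ≤ |t n| ∧ |t n| < 2 ^ (-(j : ℝ))}

theorem exists_mem_timeBlock {t : ℕ → ℝ} {n : ℕ} (h0 : t n ≠ 0) (h1 : |t n| < 1) :
    ∃ j, n ∈ timeBlock t j := by
  classical
  have hex : ∃ j : ℕ, (2 : ℝ) ^ (-((j : ℝ) + 1)) ≤ |t n| := by
    obtain ⟨j, hj⟩ := exists_pow_lt_of_lt_one (abs_pos.2 h0) (by norm_num : (2⁻¹ : ℝ) < 1)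
    refine ⟨j, le_trans ?_ hj.le⟩
    rw [← Real.rpow_natCast, Real.inv_rpow two_pos.le, ← Real.rpow_neg two_pos.le]
    exact Real.rpow_le_rpow_of_exponent_le one_le_two (by linarith)
  refine ⟨Nat.find hex, Nat.find_spec hex, ?_⟩
  rcases hj : Nat.find hex with _ | j
  · simpa using h1
  · have hmin := Nat.find_min hex (m := j) (by omega)
    rw [not_le] at hmin
    push_cast
    exact hmin

theorem abs_pos_of_mem_timeBlock {t : ℕ → ℝ} {j n : ℕ} (h : n ∈ timeBlock t j) : 0 < |t n| :=
  lt_of_lt_of_le (by positivity) h.1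

theorem MemWeakEll.exists_encard_le {r : ℝ} {t : ℕ → ℝ} (ht : MemWeakEll r t) :
    ∃ D : ℝ≥0, ∀ δ : ℝ, 0 < δ →
      ENNReal.ofReal (δ ^ r) * (({n : ℕ | δ ≤ |t n|}.encard : ℕ∞) : ℝ≥0∞) ≤ D := by
  lift (⨆ δ : ℝ, ⨆ _ : 0 < δ, ENNReal.ofReal (δ ^ r) *
    (({n : ℕ | δ ≤ |t n|}.encard : ℕ∞) : ℝ≥0∞)) to ℝ≥0 using ht.ne with D hD
  exact ⟨D, fun δ hδ => hD ▸ le_iSup₂ (f := fun (δ : ℝ) (_ : 0 < δ) => ENNReal.ofReal (δ ^ r) *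
    (({n : ℕ | δ ≤ |t n|}.encard : ℕ∞) : ℝ≥0∞)) δ hδ⟩

theorem MemWeakEll.exists_encard_timeBlock_le {r : ℝ} {t : ℕ → ℝ} (ht : MemWeakEll r t) :
    ∃ D : ℝ≥0, ∀ j : ℕ, (((timeBlock t j).encard : ℕ∞) : ℝ≥0∞) ≤
      D * ENNReal.ofReal (2 ^ (r * j)) := by
  obtain ⟨D, hD⟩ := ht.exists_encard_le
  refine ⟨D * (2 ^ r : ℝ).toNNReal, fun j => ?_⟩
  set δ : ℝ := 2 ^ (-((j : ℝ) + 1)) with hδ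
  have hsub : timeBlock t j ⊆ {n : ℕ | δ ≤ |t n|} := fun n hn => hn.1
  have hinv : ENNReal.ofReal (2 ^ (r * ((j : ℝ) + 1))) * ENNReal.ofReal (δ ^ r) = 1 := by
    rw [← ENNReal.ofReal_mul (by positivity), hδ, ← Real.rpow_mul two_pos.le,
      ← Real.rpow_add two_pos, ← ENNReal.ofReal_one]
    ring_nf
    rw [Real.rpow_zero]
  calc (((timeBlock t j).encard : ℕ∞) : ℝ≥0∞)
      ≤ (({n : ℕ | δ ≤ |t n|}.encard : ℕ∞) : ℝ≥0∞) :=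
        ENat.toENNReal_le.2 (Set.encard_le_encard hsub)
    _ = ENNReal.ofReal (2 ^ (r * ((j : ℝ) + 1))) * (ENNReal.ofReal (δ ^ r) *
          (({n : ℕ | δ ≤ |t n|}.encard : ℕ∞) : ℝ≥0∞)) := by
        rw [← mul_assoc, hinv, one_mul]
    _ ≤ ENNReal.ofReal (2 ^ (r * ((j : ℝ) + 1))) * D := by
        gcongr
        exact hD δ (by positivity)
    _ = (D * (2 ^ r : ℝ).toNNReal : ℝ≥0) * ENNReal.ofReal (2 ^ (r * j)) := by
        rw [mul_add_one, Real.rpow_add two_pos, ENNReal.ofReal_mul (by positivity)]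
        push_cast
        rw [ENNReal.ofReal, ENNReal.ofReal]
        ring

theorem MemWeakEll.encard_one_le_abs_lt_top {r : ℝ} {t : ℕ → ℝ} (ht : MemWeakEll r t) :
    (({n : ℕ | 1 ≤ |t n|}.encard : ℕ∞) : ℝ≥0∞) < ∞ := by
  obtain ⟨D, hD⟩ := ht.exists_encard_le
  have hcount := hD 1 one_pos
  rw [Real.one_rpow, ENNReal.ofReal_one, one_mul] at hcount
  exact hcount.trans_lt ENNReal.coe_lt_top

theorem lintegral_biSup_sq_le_encard {Y ι : Type*} [MeasurableSpace Y] {ν : Measure Y} [Countable ι]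
    (T : Set ι) {F : ι → Y → ℝ≥0∞} (hF : ∀ n, Measurable (F n)) {c : ℝ≥0∞}
    (h : ∀ n ∈ T, ∫⁻ y, F n y ^ 2 ∂ν ≤ c) :
    ∫⁻ y, (⨆ n ∈ T, F n y) ^ 2 ∂ν ≤ ((T.encard : ℕ∞) : ℝ≥0∞) * c := by
  calc ∫⁻ y, (⨆ n ∈ T, F n y) ^ 2 ∂ν ≤ ∫⁻ y, ∑' n : T, F n y ^ 2 ∂ν := by
        refine lintegral_mono fun y => biSup_sq_le fun n hn => ?_
        exact ENNReal.le_tsum (f := fun n : T => F n y ^ 2) ⟨n, hn⟩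
    _ = ∑' n : T, ∫⁻ y, F n y ^ 2 ∂ν :=
        lintegral_tsum fun n => ((hF n).pow_const 2).aemeasurable
    _ ≤ ∑' _ : T, c := ENNReal.tsum_le_tsum fun n => h n n.2
    _ = ((T.encard : ℕ∞) : ℝ≥0∞) * c := ENNReal.tsum_set_const T c

theorem two_pow_rpow_mul_two_rpow_neg (α : ℝ) (k j : ℕ) :
    ((2 : ℝ) ^ k) ^ α * 2 ^ (-(j : ℝ)) = 2 ^ (α * k - j) := by
  rw [two_pow_rpow, ← Real.rpow_add two_pos, mul_comm, sub_eq_add_neg]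

theorem GrowthBound.lintegral_iSup_timeBlock_le_of_encard_le {α γ : ℝ} (hα : 0 < α)
    {μ : Measure (Space d)} {A : ℝ≥0} (hμ : GrowthBound γ μ A) {R : ℝ} (hR : 0 < R)
    {g : Space d → ℂ} (hg : BandLimited g) (hsupp : ∀ ξ, R < ‖ξ‖ → g ξ = 0) {t : ℕ → ℝ} {j : ℕ}
    {N : ℝ≥0∞} (hN : (((timeBlock t j).encard : ℕ∞) : ℝ≥0∞) ≤ N) :
    ∫⁻ x, (⨆ n ∈ timeBlock t j, ‖osc α g (t n) x - osc α g 0 x‖ₑ) ^ 2 ∂μ ≤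
      N * (4 * (multiplierConst d * A * ENNReal.ofReal (R ^ ((d : ℝ) - γ)) *
        ∫⁻ ξ, ‖g ξ‖ₑ ^ 2)) := by
  have hmeas (τ : ℝ) : Measurable (osc α g τ) :=
    (continuous_osc_right hα hg.integrable τ).measurable
  refine (lintegral_biSup_sq_le_encard _ (fun n => ((hmeas (t n)).sub (hmeas 0)).enorm)
    fun n _ => ?_).trans (mul_le_mul_left hN _)
  calc ∫⁻ x, ‖osc α g (t n) x - osc α g 0 x‖ₑ ^ 2 ∂μ
      ≤ ∫⁻ x, (2 * ‖osc α g (t n) x‖ₑ ^ 2 + 2 * ‖osc α g 0 x‖ₑ ^ 2) ∂μ :=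
        lintegral_mono fun x => enorm_sub_sq_le _ _
    _ ≤ _ := lintegral_two_mul_add_le ((hmeas (t n)).enorm.pow_const 2)
        (hμ.lintegral_osc_le hα hR hg hsupp (t n)) (hμ.lintegral_osc_le hα hR hg hsupp 0)
    _ = 4 * (multiplierConst d * A * ENNReal.ofReal (R ^ ((d : ℝ) - γ)) *
          ∫⁻ ξ, ‖g ξ‖ₑ ^ 2) := by ring

theorem GrowthBound.lintegral_iSup_timeBlock_shell_le {α γ : ℝ} (hα : 0 < α)
    {μ : Measure (Space d)} {A : ℝ≥0} (hμ : GrowthBound γ μ A) {g : Space d → ℂ}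
    (hg : BandLimited g) (t : ℕ → ℝ) {j k : ℕ} (hkj : α * k - j ≤ 0) :
    ∫⁻ x, (⨆ n ∈ timeBlock t j, ‖osc α ((shell d k).indicator g) (t n) x -
        osc α ((shell d k).indicator g) 0 x‖ₑ) ^ 2 ∂μ ≤
      4 * multiplierConst d * A * ENNReal.ofReal ((2 ^ k) ^ ((d : ℝ) - γ) *
        2 ^ (2 * (α * k - j))) * ∫⁻ ξ, ‖(shell d k).indicator g ξ‖ₑ ^ 2 := by
  set f := (shell d k).indicator g
  have hscale : (2 : ℝ) ^ (-(j : ℝ)) * ((2 : ℝ) ^ k) ^ α = 2 ^ (α * k - j) := by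
    rw [mul_comm, two_pow_rpow_mul_two_rpow_neg]
  have hshort := hμ.lintegral_iSup_osc_sub_le hα (R := 2 ^ k) (δ := 2 ^ (-(j : ℝ)))
    (by positivity) (by positivity)
    (hscale ▸ Real.rpow_le_one_of_one_le_of_nonpos one_le_two hkj)
    (hg.indicator (measurableSet_shell k)) (fun ξ => indicator_shell_of_lt_norm g)
  rw [hscale, ← Real.rpow_mul_natCast two_pos.le, mul_comm (α * k - j), Nat.cast_two] at hshort
  refine le_trans (lintegral_mono fun x => pow_le_pow_left' (iSup₂_le fun n hn => ?_) 2) hshort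
  exact le_iSup₂ (f := fun τ (_ : τ ∈ Set.Icc (-(2 : ℝ) ^ (-(j : ℝ))) (2 ^ (-(j : ℝ)))) =>
    ‖osc α f τ x - osc α f 0 x‖ₑ) (t n) (abs_le.1 hn.2.le)

theorem MaximalFamily.exists_lintegral_iSup_timeBlock_shell_le {α γ s : ℝ} (hα : 0 < α)
    (hγ : γ ≤ d) (hs : 0 < s) : ∃ C : ℝ≥0, ∀ {A K : ℝ≥0} {𝓜 : Set (Measure (Space d))},
    MaximalFamily α γ (((d : ℝ) - γ) / 2 + s) A K 𝓜 → ∀ {μ : Measure (Space d)}, μ ∈ 𝓜 →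
      ∀ {g : Space d → ℂ}, BandLimited g → ∀ (t : ℕ → ℝ) {j k : ℕ}, 0 < α * k - j →
        ∫⁻ x, (⨆ n ∈ timeBlock t j, ‖osc α ((shell d k).indicator g) (t n) x -
            osc α ((shell d k).indicator g) 0 x‖ₑ) ^ 2 ∂μ ≤
          C * (A + K ^ 2) * ENNReal.ofReal ((2 ^ k) ^ ((d : ℝ) - γ) *
            2 ^ (2 * ((α * k - j) * (s / min α 1)))) *
            ∫⁻ ξ, ‖(shell d k).indicator g ξ‖ₑ ^ 2 := by
  obtain ⟨C, hC⟩ := MaximalFamily.exists_lintegral_iSup_osc_sub_le (d := d) hα hγ hs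
  refine ⟨C, fun {A K 𝓜} h𝓜 {μ} hμ {g} hg t {j k} hkj => ?_⟩
  obtain ⟨k, rfl⟩ : ∃ k', k = k' + 1 := by
    refine Nat.exists_eq_succ_of_ne_zero fun h0 => hkj.not_ge ?_
    simp [h0]
  set f := (shell d (k + 1)).indicator g
  have hlow (ξ : Space d) (h : ‖ξ‖ < 2 ^ (k + 1) / 2) : f ξ = 0 :=
    indicator_shell_of_norm_lt g (by rwa [pow_succ, mul_div_cancel_right₀ _ two_ne_zero] at h)
  have hmax := hC h𝓜 hμ (R := 2 ^ (k + 1)) (δ := 2 ^ (-(j : ℝ))) (by positivity) (by positivity)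
    (by rw [two_pow_rpow_mul_two_rpow_neg]; exact Real.one_le_rpow one_le_two hkj.le)
    (hg.indicator (measurableSet_shell (k + 1))) hlow (fun ξ => indicator_shell_of_lt_norm g)
  rw [two_pow_rpow_mul_two_rpow_neg, ← Real.rpow_mul two_pos.le, mul_left_comm] at hmax
  refine le_trans (lintegral_mono fun x => pow_le_pow_left' (iSup₂_le fun n hn => ?_) 2) hmax
  exact le_iSup₂ (f := fun τ (_ : τ ∈ {τ : ℝ | 0 < |τ| ∧ |τ| < 2 ^ (-(j : ℝ))}) =>
    ‖osc α f τ x - osc α f 0 x‖ₑ) (t n) ⟨abs_pos_of_mem_timeBlock hn, hn.2⟩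

theorem MaximalFamily.exists_lintegral_iSup_timeBlock_shell_le_decay {α γ r s : ℝ} (hα : 0 < α)
    (hγ : γ ≤ d) (hr : 0 < r) (hs : 0 < s) {t : ℕ → ℝ} (ht : MemWeakEll r t) :
    ∃ ε : ℝ, 0 < ε ∧ ∃ C : ℝ≥0, ∀ {A K : ℝ≥0} {𝓜 : Set (Measure (Space d))},
    MaximalFamily α γ (((d : ℝ) - γ) / 2 + s) A K 𝓜 → ∀ {μ : Measure (Space d)}, μ ∈ 𝓜 →
      ∀ {g : Space d → ℂ}, BandLimited g → ∀ j k : ℕ,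
        ∫⁻ x, (⨆ n ∈ timeBlock t j, ‖osc α ((shell d k).indicator g) (t n) x -
            osc α ((shell d k).indicator g) 0 x‖ₑ) ^ 2 ∂μ ≤
          ENNReal.ofReal (2 ^ (-(ε * |sTilde α r s * k - r / 2 * j|))) ^ 2 *
            (C * (A + K ^ 2) *
              (ENNReal.ofReal (2 ^ (2 * k * (((d : ℝ) - γ) / 2 + sTilde α r s))) *
                ∫⁻ ξ, ‖(shell d k).indicator g ξ‖ₑ ^ 2)) := by
  obtain ⟨ε, hε, hdecay⟩ := exists_block_decay hα hr hs
  obtain ⟨D, hD⟩ := ht.exists_encard_timeBlock_le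
  obtain ⟨C, hC⟩ := MaximalFamily.exists_lintegral_iSup_timeBlock_shell_le (d := d) hα hγ hs
  refine ⟨ε, hε, max (4 * multiplierConst d * max D 1) C, ?_⟩
  intro A K 𝓜 h𝓜 μ hμ g hg j k
  have hgrowth := h𝓜.growth μ hμ
  obtain ⟨hcount, hmaximal, hshort⟩ := hdecay k j (Nat.cast_nonneg k)
  set p := sTilde α r s
  set E := ∫⁻ ξ, ‖(shell d k).indicator g ξ‖ₑ ^ 2
  set W := ENNReal.ofReal (2 ^ (2 * k * (((d : ℝ) - γ) / 2 + p)))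
  set B := ENNReal.ofReal (2 ^ (-(ε * |p * k - r / 2 * j|)))
  set C' := max (4 * multiplierConst d * max D 1) C
  have hblock {I c : ℝ≥0∞} {e : ℝ} (hc : c ≤ C' * (A + K ^ 2))
      (hI : I ≤ c * ENNReal.ofReal ((2 ^ k) ^ ((d : ℝ) - γ) * 2 ^ (2 * e)) * E)
      (he : e - p * k ≤ -(ε * |p * k - r / 2 * j|)) : I ≤ B ^ 2 * (C' * (A + K ^ 2) * (W * E)) := by
    refine hI.trans ?_
    calc _ ≤ C' * (A + K ^ 2) * (B ^ 2 * W) * E := by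
          gcongr
          exact ofReal_two_pow_rpow_mul_le he
      _ = B ^ 2 * (C' * (A + K ^ 2) * (W * E)) := by ring
  have hconst {D' : ℝ≥0} (hD' : D' ≤ max D 1) :
      (4 * multiplierConst d * D' * A : ℝ≥0∞) ≤ C' * (A + K ^ 2) := by
    norm_cast
    exact mul_le_mul' ((mul_le_mul_right hD' _).trans (le_max_left _ _)) le_self_add
  rcases le_or_gt 0 (p * k - r / 2 * j) with hy | hy
  · refine hblock (hconst (le_max_left D 1)) ((hgrowth.lintegral_iSup_timeBlock_le_of_encard_le hα
      (by positivity) (hg.indicator (measurableSet_shell k))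
      (fun ξ => indicator_shell_of_lt_norm g) (hD j)).trans_eq ?_) (hcount hy)
    rw [ENNReal.ofReal_mul (by positivity), ← mul_assoc 2 (r / 2), mul_div_cancel₀ r two_ne_zero]
    ring
  rcases le_or_gt (α * k - j) 0 with hkj | hkj
  · refine hblock (hconst (le_max_right D 1)) ?_ (hshort hy hkj)
    rw [ENNReal.coe_one, mul_one]
    exact hgrowth.lintegral_iSup_timeBlock_shell_le hα hg t hkj
  · exact hblock (mul_le_mul_left (ENNReal.coe_le_coe.2 (le_max_right _ _)) _)
      (hC h𝓜 hμ hg t hkj) (hmaximal hy)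

theorem iSup_osc_sq_le (α : ℝ) (t : ℕ → ℝ) (g : Space d → ℂ) (x : Space d) :
    (⨆ n, ‖osc α g (t n) x‖ₑ) ^ 2 ≤
      (⨆ n ∈ {n | 1 ≤ |t n|}, ‖osc α g (t n) x‖ₑ) ^ 2 + (2 * ‖osc α g 0 x‖ₑ ^ 2 +
        2 * ∑' j, (⨆ n ∈ timeBlock t j, ‖osc α g (t n) x - osc α g 0 x‖ₑ) ^ 2) := by
  refine iSup_sq_le fun n => ?_
  rcases le_or_gt 1 |t n| with hlarge | hsmall
  · refine le_add_right (pow_le_pow_left' ?_ 2)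
    exact le_iSup₂ (f := fun n (_ : n ∈ {n | 1 ≤ |t n|}) => ‖osc α g (t n) x‖ₑ) n hlarge
  refine le_add_left ?_
  rcases eq_or_ne (t n) 0 with h0 | h0
  · rw [h0, two_mul]
    exact le_add_right (le_add_right le_rfl)
  obtain ⟨j, hj⟩ := exists_mem_timeBlock h0 hsmall
  calc ‖osc α g (t n) x‖ₑ ^ 2 = ‖osc α g 0 x + (osc α g (t n) x - osc α g 0 x)‖ₑ ^ 2 := by
        rw [add_sub_cancel]
    _ ≤ (‖osc α g 0 x‖ₑ + ‖osc α g (t n) x - osc α g 0 x‖ₑ) ^ 2 := by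
        gcongr
        exact enorm_add_le _ _
    _ ≤ 2 * ‖osc α g 0 x‖ₑ ^ 2 + 2 * ‖osc α g (t n) x - osc α g 0 x‖ₑ ^ 2 := add_sq_le_two _ _
    _ ≤ _ := by
        gcongr
        refine le_trans (pow_le_pow_left' ?_ 2) (ENNReal.le_tsum j)
        exact le_iSup₂ (f := fun n (_ : n ∈ timeBlock t j) => ‖osc α g (t n) x - osc α g 0 x‖ₑ) n hj

theorem measurable_iSup_osc_sub {α : ℝ} (hα : 0 < α) {g : Space d → ℂ} (hg : Integrable g)
    (t : ℕ → ℝ) (T : Set ℕ) :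
    Measurable fun x => ⨆ n ∈ T, ‖osc α g (t n) x - osc α g 0 x‖ₑ :=
  .iSup fun n => .iSup fun _ =>
    ((continuous_osc_right hα hg (t n)).sub (continuous_osc_right hα hg 0)).measurable.enorm

theorem iSup_osc_sub_le_tsum_shell {α : ℝ} (hα : 0 < α) {g : Space d → ℂ} (hg : Integrable g)
    (t : ℕ → ℝ) (T : Set ℕ) (x : Space d) :
    ⨆ n ∈ T, ‖osc α g (t n) x - osc α g 0 x‖ₑ ≤
      ∑' k, ⨆ n ∈ T, ‖osc α ((shell d k).indicator g) (t n) x -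
        osc α ((shell d k).indicator g) 0 x‖ₑ := by
  refine iSup₂_le fun n hn => ?_
  rw [← ((hasSum_osc_shell hα hg (t n) x).sub (hasSum_osc_shell hα hg 0 x)).tsum_eq]
  refine enorm_tsum_le_tsum_enorm.trans (ENNReal.tsum_le_tsum fun k => ?_)
  exact le_iSup₂ (f := fun n (_ : n ∈ T) => ‖osc α ((shell d k).indicator g) (t n) x -
    osc α ((shell d k).indicator g) 0 x‖ₑ) n hn

theorem MaximalFamily.exists_tsum_lintegral_iSup_timeBlock_le {α γ r s : ℝ} (hα : 0 < α)
    (hγ : γ ≤ d) (hr : 0 < r) (hs : 0 < s) {t : ℕ → ℝ} (ht : MemWeakEll r t) :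
    ∃ C : ℝ≥0, ∀ {A K : ℝ≥0} {𝓜 : Set (Measure (Space d))},
    MaximalFamily α γ (((d : ℝ) - γ) / 2 + s) A K 𝓜 → ∀ {μ : Measure (Space d)}, μ ∈ 𝓜 →
      ∀ {g : Space d → ℂ}, BandLimited g →
        ∑' j, ∫⁻ x, (⨆ n ∈ timeBlock t j, ‖osc α g (t n) x - osc α g 0 x‖ₑ) ^ 2 ∂μ ≤
          C * (A + K ^ 2) * energy (((d : ℝ) - γ) / 2 + sTilde α r s) g := by
  obtain ⟨ε, hε, C, hC⟩ :=
    MaximalFamily.exists_lintegral_iSup_timeBlock_shell_le_decay (d := d) hα hγ hr hs ht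
  have hp := sTilde_pos hα hr hs
  obtain ⟨S, hS⟩ := exists_tsum_two_rpow_le hp hε
  obtain ⟨S', hS'⟩ := exists_tsum_two_rpow_le (half_pos hr) hε
  set p := sTilde α r s
  set σ := ((d : ℝ) - γ) / 2 + p with hσ_def
  have hσ : 0 ≤ σ := by linarith
  refine ⟨S * S' * C * (4 ^ σ : ℝ).toNNReal, fun {A K 𝓜} h𝓜 {μ} hμ {g} hg => ?_⟩
  let b (j k : ℕ) : ℝ≥0∞ := ENNReal.ofReal (2 ^ (-(ε * |p * k - r / 2 * j|)))
  let e (k : ℕ) : ℝ≥0∞ :=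
    ENNReal.ofReal (2 ^ (2 * k * σ)) * ∫⁻ ξ, ‖(shell d k).indicator g ξ‖ₑ ^ 2
  calc ∑' j, ∫⁻ x, (⨆ n ∈ timeBlock t j, ‖osc α g (t n) x - osc α g 0 x‖ₑ) ^ 2 ∂μ
      ≤ S * S' * ∑' k, C * (A + K ^ 2) * e k :=
        schur_lintegral (b := b) (fun j k => (ENNReal.ofReal_pos.2 (by positivity)).ne')
          (fun j k => ENNReal.ofReal_ne_top) (fun j => hS (r / 2 * j))
          (fun k => by simpa only [b, abs_sub_comm] using hS' (p * k))
          (fun j k => measurable_iSup_osc_sub hα (hg.indicator (measurableSet_shell k)).integrable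
            t (timeBlock t j))
          (fun j => iSup_osc_sub_le_tsum_shell hα hg.integrable t (timeBlock t j)) (hC h𝓜 hμ hg)
    _ ≤ S * S' * (C * (A + K ^ 2) * (ENNReal.ofReal (4 ^ σ) * energy σ g)) := by
        rw [ENNReal.tsum_mul_left]
        gcongr
        exact tsum_lintegral_shell_le g hσ
    _ = (S * S' * C * (4 ^ σ : ℝ).toNNReal : ℝ≥0) * (A + K ^ 2) * energy σ g := by
        push_cast
        rw [ENNReal.ofReal]
        ring

theorem MaximalFamily.exists_lintegral_iSup_seq_le {α γ r s : ℝ} (hα : 0 < α) (hγ : γ ≤ d)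
    (hr : 0 < r) (hs : 0 < s) {t : ℕ → ℝ} (ht : MemWeakEll r t) :
    ∃ C : ℝ≥0, ∀ {A K : ℝ≥0} {𝓜 : Set (Measure (Space d))},
    MaximalFamily α γ (((d : ℝ) - γ) / 2 + s) A K 𝓜 → ∀ {μ : Measure (Space d)}, μ ∈ 𝓜 →
      ∀ {g : Space d → ℂ}, BandLimited g →
        ∫⁻ x, (⨆ n, ‖osc α g (t n) x‖ₑ) ^ 2 ∂μ ≤
          C * (A + K ^ 2) * energy (((d : ℝ) - γ) / 2 + sTilde α r s) g := by
  obtain ⟨C, hC⟩ := MaximalFamily.exists_tsum_lintegral_iSup_timeBlock_le (d := d) hα hγ hr hs ht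
  obtain ⟨C₀, hC₀⟩ := exists_lintegral_osc_le_energy (d := d) hα hγ (sTilde_pos hα hr hs)
  obtain ⟨D, hD⟩ : ∃ D : ℝ≥0, (D : ℝ≥0∞) = {n : ℕ | 1 ≤ |t n|}.encard :=
    ⟨_, ENNReal.coe_toNNReal ht.encard_one_le_abs_lt_top.ne⟩
  refine ⟨D * C₀ + 2 * C₀ + 2 * C, fun {A K 𝓜} h𝓜 {μ} hμ {g} hg => ?_⟩
  set W := energy (((d : ℝ) - γ) / 2 + sTilde α r s) g
  have hosc (τ : ℝ) : Measurable (osc α g τ) :=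
    (continuous_osc_right hα hg.integrable τ).measurable
  have hfixed (τ : ℝ) : ∫⁻ x, ‖osc α g τ x‖ₑ ^ 2 ∂μ ≤ C₀ * (A + K ^ 2) * W :=
    (hC₀ (h𝓜.growth μ hμ) hg τ).trans (by gcongr; exact le_self_add)
  have hlarge := lintegral_biSup_sq_le_encard {n : ℕ | 1 ≤ |t n|}
    (fun n => (hosc (t n)).enorm) (fun n _ => hfixed (t n))
  have hblocks : ∫⁻ x, ∑' j, (⨆ n ∈ timeBlock t j, ‖osc α g (t n) x - osc α g 0 x‖ₑ) ^ 2 ∂μ ≤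
      C * (A + K ^ 2) * W := (lintegral_tsum fun j => ((measurable_iSup_osc_sub hα hg.integrable t
    (timeBlock t j)).pow_const 2).aemeasurable).trans_le (hC h𝓜 hμ hg)
  refine (lintegral_mono fun x => iSup_osc_sq_le α t g x).trans ?_
  rw [lintegral_add_left ((Measurable.iSup fun n => .iSup fun _ => (hosc (t n)).enorm).pow_const 2)]
  refine (add_le_add (hlarge.trans_eq (by rw [← hD])) (lintegral_two_mul_add_le
    ((hosc 0).enorm.pow_const 2) (hfixed 0) hblocks)).trans_eq ?_
  push_cast
  ring

theorem iSup_osc_sq_le_of_Ioo (α : ℝ) (t : ℕ → ℝ) (g : Space d → ℂ) (x : Space d) :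
    (⨆ n, ‖osc α g (t n) x‖ₑ) ^ 2 ≤
      (⨆ n ∈ {n | 1 ≤ |t n|}, ‖osc α g (t n) x‖ₑ) ^ 2 +
        (‖osc α g 0 x‖ₑ ^ 2 + (⨆ τ ∈ {τ : ℝ | 0 < |τ| ∧ |τ| < 1}, ‖osc α g τ x‖ₑ) ^ 2) := by
  refine iSup_sq_le fun n => ?_
  rcases le_or_gt 1 |t n| with hlarge | hsmall
  · refine le_add_right (pow_le_pow_left' ?_ 2)
    exact le_iSup₂ (f := fun n (_ : n ∈ {n | 1 ≤ |t n|}) => ‖osc α g (t n) x‖ₑ) n hlarge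
  refine le_add_left ?_
  rcases eq_or_ne (t n) 0 with h0 | h0
  · exact h0 ▸ le_add_right le_rfl
  · refine le_add_left (pow_le_pow_left' ?_ 2)
    exact le_iSup₂ (f := fun τ (_ : τ ∈ {τ : ℝ | 0 < |τ| ∧ |τ| < 1}) => ‖osc α g τ x‖ₑ) (t n)
      ⟨abs_pos.2 h0, hsmall⟩

theorem MaximalEstimate.exists_lintegral_iSup_seq_le {α γ r s : ℝ} (hα : 0 < α) (hγ : γ ≤ d)
    (hs : 0 < s) {t : ℕ → ℝ} (ht : MemWeakEll r t) :
    ∃ C : ℝ≥0, ∀ {A K : ℝ≥0} {μ : Measure (Space d)}, GrowthBound γ μ A →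
    MaximalEstimate α (Set.Ioo 0 1) (((d : ℝ) - γ) / 2 + s) μ K →
      ∀ {g : Space d → ℂ}, BandLimited g →
        ∫⁻ x in Metric.ball 0 1, (⨆ n, ‖osc α g (t n) x‖ₑ) ^ 2 ∂μ ≤
          C * (A + K ^ 2) * energy (((d : ℝ) - γ) / 2 + s) g := by
  obtain ⟨C₀, hC₀⟩ := exists_lintegral_osc_le_energy (d := d) hα hγ hs
  obtain ⟨D, hD⟩ : ∃ D : ℝ≥0, (D : ℝ≥0∞) = {n : ℕ | 1 ≤ |t n|}.encard :=
    ⟨_, ENNReal.coe_toNNReal ht.encard_one_le_abs_lt_top.ne⟩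
  refine ⟨D * C₀ + (C₀ + 2 * ((2 * Real.pi) ^ d).toNNReal ^ 2), ?_⟩
  intro A K μ hμ H g hg
  have := hμ.isLocallyFiniteMeasure
  set W := energy (((d : ℝ) - γ) / 2 + s) g
  have hosc (τ : ℝ) : Measurable (osc α g τ) :=
    (continuous_osc_right hα hg.integrable τ).measurable
  have hfixed (τ : ℝ) :
      ∫⁻ x in Metric.ball 0 1, ‖osc α g τ x‖ₑ ^ 2 ∂μ ≤ C₀ * (A + K ^ 2) * W :=
    (setLIntegral_le_lintegral _ _).trans
      ((hC₀ hμ hg τ).trans (by gcongr; exact le_self_add))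
  have hlarge := lintegral_biSup_sq_le_encard {n : ℕ | 1 ≤ |t n|}
    (fun n => (hosc (t n)).enorm) (fun n _ => hfixed (t n))
  have hneg := MaximalEstimate.bandLimited hα H hg.reflConj
  rw [energy_reflConj] at hneg
  have hsmall := lintegral_iSup_symm_le hα hg.integrable
    (MaximalEstimate.bandLimited hα H hg) hneg
  refine (lintegral_mono fun x => iSup_osc_sq_le_of_Ioo α t g x).trans ?_
  rw [lintegral_add_left ((Measurable.iSup fun n => .iSup fun _ => (hosc (t n)).enorm).pow_const 2),
    lintegral_add_left ((hosc 0).enorm.pow_const 2)]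
  calc _ ≤ D * (C₀ * (A + K ^ 2) * W) + (C₀ * (A + K ^ 2) * W +
        2 * ((ENNReal.ofReal ((2 * Real.pi) ^ d) * K) ^ 2 * W)) := by
        rw [hD]
        exact add_le_add hlarge (add_le_add (hfixed 0) hsmall)
    _ ≤ D * (C₀ * (A + K ^ 2) * W) + (C₀ * (A + K ^ 2) * W +
        2 * (ENNReal.ofReal ((2 * Real.pi) ^ d) ^ 2 * (A + K ^ 2) * W)) := by
        rw [mul_pow]
        gcongr
        exact le_add_self
    _ = _ := by
        push_cast
        rw [ENNReal.ofReal]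
        ring

/-! ### Limits of band limited data -/

theorem measurable_fourierHat (f : Lp ℂ 2 (volume : Measure (Space d))) :
    Measurable (fourierHat f) :=
  (Lp.stronglyMeasurable _).measurable.comp (measurable_const_smul _)

theorem energy_mono_enorm {σ : ℝ} {g h : Space d → ℂ} (hgh : ∀ ξ, ‖g ξ‖ₑ ≤ ‖h ξ‖ₑ) :
    energy σ g ≤ energy σ h := by
  unfold energy
  gcongr with ξ
  exact hgh ξ

theorem tendsto_energy_tail {σ : ℝ} {g : Space d → ℂ} (hg : Measurable g) (h : energy σ g < ∞) :
    Tendsto (fun N : ℕ => energy σ ((Metric.ball (0 : Space d) N)ᶜ.indicator g)) atTop (𝓝 0) := by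
  rw [← lintegral_zero (μ := (volume : Measure (Space d)))]
  refine tendsto_lintegral_of_dominated_convergence
    (fun ξ => ENNReal.ofReal ((1 + ‖ξ‖ ^ 2) ^ σ) * ‖g ξ‖ₑ ^ 2) (fun N => ?_) (fun N => ?_) h.ne ?_
  · exact (measurable_ofReal_weight σ).mul
      ((hg.indicator measurableSet_ball.compl).enorm.pow_const 2)
  · refine .of_forall fun ξ => ?_
    exact mul_le_mul_right (pow_le_pow_left' (enorm_indicator_le_enorm_self g ξ) 2) _
  · refine .of_forall fun ξ => tendsto_const_nhds.congr' ?_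
    obtain ⟨n, hn⟩ := exists_nat_gt ‖ξ‖
    filter_upwards [eventually_ge_atTop n] with N hN
    have hξ : ‖ξ‖ < N := hn.trans_le (Nat.cast_le.2 hN)
    rw [Set.indicator_of_notMem (by simpa using hξ), enorm_zero, zero_pow two_ne_zero, mul_zero]

theorem bandLimited_ball_indicator {σ : ℝ} (hσ : 0 ≤ σ) {g : Space d → ℂ} (hg : Measurable g)
    (h : energy σ g < ∞) (R : ℝ) : BandLimited ((Metric.ball (0 : Space d) R).indicator g) := by
  refine ⟨hg.indicator measurableSet_ball, ?_, R,
    fun ξ hξ => Set.indicator_of_notMem (by simpa using hξ.le) g⟩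
  rw [← energy_zero]
  exact (energy_mono hσ _).trans_lt
    ((energy_mono_enorm fun ξ => enorm_indicator_le_enorm_self g ξ).trans_lt h)

theorem BandLimited.sub {g h : Space d → ℂ} (hg : BandLimited g) (hh : BandLimited h) :
    BandLimited (g - h) := by
  obtain ⟨R, hR⟩ := hg.bounded
  obtain ⟨R', hR'⟩ := hh.bounded
  refine ⟨hg.measurable.sub hh.measurable, ?_, max R R', fun ξ hξ => ?_⟩
  · rw [← eLpNorm_two_sq]
    exact ENNReal.pow_lt_top (hg.memLp.sub hh.memLp).2
  · rw [Pi.sub_apply, hR ξ ((le_max_left _ _).trans_lt hξ),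
      hR' ξ ((le_max_right _ _).trans_lt hξ), sub_zero]

theorem enorm_indicator_sub_indicator_le {X : Type*} {s t u : Set X} (hs : u ⊆ s) (ht : u ⊆ t)
    (g : X → ℂ) (x : X) : ‖(s.indicator g - t.indicator g) x‖ₑ ≤ ‖uᶜ.indicator g x‖ₑ := by
  by_cases hx : x ∈ u
  · simp [hs hx, ht hx]
  · rw [Set.indicator_of_mem hx, Pi.sub_apply]
    by_cases hxs : x ∈ s <;> by_cases hxt : x ∈ t <;> simp [hxs, hxt]

theorem exists_tendsto_eLpNorm_sub {Y E : Type*} [MeasurableSpace Y] [NormedAddCommGroup E]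
    [CompleteSpace E] {ν : Measure Y} {p : ℝ≥0∞} [Fact (1 ≤ p)] {f : ℕ → Y → E}
    (hf : ∀ n, MemLp (f n) p ν) {b : ℕ → ℝ≥0∞} (hb : Tendsto b atTop (𝓝 0))
    (h : ∀ n m N, N ≤ n → N ≤ m → eLpNorm (f n - f m) p ν ≤ b N) :
    ∃ u : Y → E, StronglyMeasurable u ∧ MemLp u p ν ∧
      Tendsto (fun N => eLpNorm (f N - u) p ν) atTop (𝓝 0) := by
  have hcauchy : CauchySeq fun n => (hf n).toLp (f n) :=
    EMetric.cauchySeq_iff_le_tendsto_0.2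
      ⟨b, fun n m N hn hm => (Lp.edist_toLp_toLp _ _ (hf n) (hf m)).le.trans (h n m N hn hm), hb⟩
  obtain ⟨U, hU⟩ := cauchySeq_tendsto_of_complete hcauchy
  refine ⟨U, Lp.stronglyMeasurable U, Lp.memLp U, ?_⟩
  rw [← Lp.tendsto_Lp_iff_tendsto_eLpNorm'' f hf U (Lp.memLp U), Lp.toLp_coeFn]
  exact hU

theorem eLpNorm_biSup_lt_le_of_tendsto {Y E : Type*} [MeasurableSpace Y] [NormedAddCommGroup E]
    {ν : Measure Y} {p : ℝ≥0∞} (hp : 1 ≤ p) {v : ℕ → ℕ → Y → E} {u : ℕ → Y → E}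
    (hv : ∀ N n, StronglyMeasurable (v N n)) (hu : ∀ n, StronglyMeasurable (u n))
    (hlim : ∀ n, Tendsto (fun N => eLpNorm (v N n - u n) p ν) atTop (𝓝 0)) {c : ℝ≥0∞}
    (h : ∀ N, eLpNorm (fun y => ⨆ n, ‖v N n y‖ₑ) p ν ≤ c) (m : ℕ) :
    eLpNorm (fun y => ⨆ n, ⨆ (_ : n < m), ‖u n y‖ₑ) p ν ≤ c := by
  have hsub (N n : ℕ) : Measurable fun y => ‖(v N n - u n) y‖ₑ := ((hv N n).sub (hu n)).enorm
  have hsum : Tendsto (fun N => c + ∑ n ∈ Finset.range m, eLpNorm (v N n - u n) p ν) atTop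
      (𝓝 c) := by
    simpa only [Finset.sum_const_zero, add_zero] using
      (tendsto_const_nhds (x := c)).add (tendsto_finsetSum (Finset.range m) fun n _ => hlim n)
  refine ge_of_tendsto' hsum fun N => ?_
  have hpt (y : Y) : ⨆ n, ⨆ (_ : n < m), ‖u n y‖ₑ ≤
      (⨆ n, ‖v N n y‖ₑ) + ∑ n ∈ Finset.range m, ‖(v N n - u n) y‖ₑ := by
    refine iSup₂_le fun n hn => ?_
    calc ‖u n y‖ₑ = ‖v N n y - (v N n - u n) y‖ₑ := by rw [Pi.sub_apply, sub_sub_cancel]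
      _ ≤ ‖v N n y‖ₑ + ‖(v N n - u n) y‖ₑ := enorm_sub_le
      _ ≤ _ := add_le_add (le_iSup (fun n => ‖v N n y‖ₑ) n)
        (Finset.single_le_sum (f := fun n => ‖(v N n - u n) y‖ₑ) (fun _ _ => zero_le)
          (Finset.mem_range.2 hn))
  calc _ ≤ eLpNorm ((fun y => ⨆ n, ‖v N n y‖ₑ) +
        ∑ n ∈ Finset.range m, fun y => ‖(v N n - u n) y‖ₑ) p ν :=
        eLpNorm_mono_enorm fun y => by
          simpa only [enorm_eq_self, Pi.add_apply, Finset.sum_apply] using hpt y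
    _ ≤ eLpNorm (fun y => ⨆ n, ‖v N n y‖ₑ) p ν +
        eLpNorm (∑ n ∈ Finset.range m, fun y => ‖(v N n - u n) y‖ₑ) p ν :=
        eLpNorm_add_le (Measurable.iSup fun n => (hv N n).enorm).aestronglyMeasurable
          (Finset.aestronglyMeasurable_sum _ fun n _ => (hsub N n).aestronglyMeasurable) hp
    _ ≤ c + ∑ n ∈ Finset.range m, eLpNorm (v N n - u n) p ν :=
        add_le_add (h N) ((eLpNorm_sum_le (fun n _ => (hsub N n).aestronglyMeasurable)
          hp).trans_eq (by simp only [eLpNorm_enorm]))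

theorem eLpNorm_iSup_le_of_tendsto {Y E : Type*} [MeasurableSpace Y] [NormedAddCommGroup E]
    {ν : Measure Y} {v : ℕ → ℕ → Y → E} {u : ℕ → Y → E}
    (hv : ∀ N n, StronglyMeasurable (v N n)) (hu : ∀ n, StronglyMeasurable (u n))
    (hlim : ∀ n, Tendsto (fun N => eLpNorm (v N n - u n) 2 ν) atTop (𝓝 0)) {c : ℝ≥0∞}
    (h : ∀ N, eLpNorm (fun y => ⨆ n, ‖v N n y‖ₑ) 2 ν ≤ c) :
    eLpNorm (fun y => ⨆ n, ‖u n y‖ₑ) 2 ν ≤ c := by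
  have hpartial (y : Y) :
      (⨆ n, ‖u n y‖ₑ) ^ 2 = ⨆ m, (⨆ n, ⨆ (_ : n < m), ‖u n y‖ₑ) ^ 2 := by
    rw [← ENNReal.iSup_pow]
    congr 1
    exact le_antisymm
      (iSup_le fun n => le_iSup_of_le (n + 1) (le_iSup₂_of_le n n.lt_succ_self le_rfl))
      (iSup_le fun m => iSup₂_le fun n _ => le_iSup (fun n => ‖u n y‖ₑ) n)
  rw [eLpNorm_two_le_iff]
  simp only [enorm_eq_self, hpartial]
  rw [lintegral_iSup]
  · refine iSup_le fun m => ?_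
    simpa only [enorm_eq_self] using (eLpNorm_two_le_iff _ _ _).1
      (eLpNorm_biSup_lt_le_of_tendsto one_le_two hv hu hlim h m)
  · exact fun m => (Measurable.iSup fun n => .iSup fun _ => (hu n).enorm).pow_const 2
  · exact fun a b hab y => pow_le_pow_left' (biSup_mono fun n hn => hn.trans_le hab) 2

theorem eLpNorm_iSup_inv_mul_osc_le {α σ : ℝ} {ν : Measure (Space d)} {g : Space d → ℂ}
    {t : ℕ → ℝ} {c : ℝ≥0∞} (h : ∫⁻ x, (⨆ n, ‖osc α g (t n) x‖ₑ) ^ 2 ∂ν ≤ c ^ 2 * energy σ g) :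
    eLpNorm (fun x => ⨆ n, ‖((((2 * Real.pi) ^ d)⁻¹ : ℝ) : ℂ) * osc α g (t n) x‖ₑ) 2 ν ≤
      c * energy σ g ^ (1 / 2 : ℝ) := by
  have hle_one : ‖((((2 * Real.pi) ^ d)⁻¹ : ℝ) : ℂ)‖ₑ ≤ 1 := by
    rw [← ofReal_norm, Complex.norm_real, Real.norm_of_nonneg (by positivity)]
    refine ENNReal.ofReal_le_one.2 (inv_le_one_of_one_le₀ (one_le_pow₀ ?_))
    linarith [Real.pi_gt_three]
  have hsq : (energy σ g ^ (1 / 2 : ℝ)) ^ 2 = energy σ g := by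
    rw [← ENNReal.rpow_mul_natCast]
    norm_num
  rw [eLpNorm_two_le_iff, mul_pow c, hsq]
  refine (lintegral_mono fun x => ?_).trans h
  rw [enorm_eq_self]
  gcongr with n
  rw [enorm_mul]
  exact mul_le_of_le_one_left' hle_one

section Density

variable {α σ : ℝ} {t : ℕ → ℝ} {ν μ : Measure (Space d)} {c : ℝ≥0}

theorem propagatorOn_ball_eq (α R : ℝ) (f : Lp ℂ 2 (volume : Measure (Space d))) (t : ℝ) :
    propagatorOn α (Metric.ball 0 R) f t = fun x =>
      (((2 * Real.pi) ^ d)⁻¹ : ℝ) * osc α ((Metric.ball 0 R).indicator (fourierHat f)) t x :=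
  funext (propagatorOn_eq α measurableSet_ball f t)

theorem bandLimited_ball_indicator_fourierHat (hσ : 0 ≤ σ)
    {f : Lp ℂ 2 (volume : Measure (Space d))} (hf : sobolevNorm σ f < ∞) (R : ℝ) :
    BandLimited ((Metric.ball 0 R).indicator (fourierHat f)) :=
  bandLimited_ball_indicator hσ (measurable_fourierHat f)
    (sobolevNorm_sq σ f ▸ ENNReal.pow_lt_top hf) R

theorem eLpNorm_iSup_propagatorOn_ball_le (hσ : 0 ≤ σ)
    (h : ∀ {g : Space d → ℂ}, BandLimited g →
      ∫⁻ x, (⨆ n, ‖osc α g (t n) x‖ₑ) ^ 2 ∂ν ≤ c ^ 2 * energy σ g)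
    {f : Lp ℂ 2 (volume : Measure (Space d))} (hf : sobolevNorm σ f < ∞) (R : ℝ) :
    eLpNorm (fun x => ⨆ n, ‖propagatorOn α (Metric.ball 0 R) f (t n) x‖ₑ) 2 ν ≤
      c * sobolevNorm σ f := by
  simp only [propagatorOn_ball_eq]
  refine (eLpNorm_iSup_inv_mul_osc_le
    (h (bandLimited_ball_indicator_fourierHat hσ hf R))).trans ?_
  gcongr
  rw [one_div, ENNReal.rpow_inv_le_iff two_pos, ENNReal.rpow_two, sobolevNorm_sq]
  exact energy_mono_enorm fun ξ => enorm_indicator_le_enorm_self _ ξ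

theorem eLpNorm_iSup_propagatorOn_ball_sub_le (hα : 0 < α) (hσ : 0 ≤ σ)
    (h : ∀ {g : Space d → ℂ}, BandLimited g →
      ∫⁻ x, (⨆ n, ‖osc α g (t n) x‖ₑ) ^ 2 ∂ν ≤ c ^ 2 * energy σ g)
    {f : Lp ℂ 2 (volume : Measure (Space d))} (hf : sobolevNorm σ f < ∞) {R R₁ R₂ : ℝ}
    (h₁ : R ≤ R₁) (h₂ : R ≤ R₂) :
    eLpNorm (fun x => ⨆ n, ‖propagatorOn α (Metric.ball 0 R₁) f (t n) x -
        propagatorOn α (Metric.ball 0 R₂) f (t n) x‖ₑ) 2 ν ≤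
      c * energy σ ((Metric.ball (0 : Space d) R)ᶜ.indicator (fourierHat f)) ^ (1 / 2 : ℝ) := by
  have hband := bandLimited_ball_indicator_fourierHat hσ hf
  simp only [propagatorOn_ball_eq, ← mul_sub,
    ← osc_sub hα (hband R₁).integrable (hband R₂).integrable]
  refine (eLpNorm_iSup_inv_mul_osc_le (h ((hband R₁).sub (hband R₂)))).trans ?_
  gcongr
  exact energy_mono_enorm (enorm_indicator_sub_indicator_le
    (Metric.ball_subset_ball h₁) (Metric.ball_subset_ball h₂) _)

theorem eLpNorm_le_eLpNorm_iSup_enorm {Y E : Type*} [MeasurableSpace Y] [NormedAddCommGroup E]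
    {ν : Measure Y} {p : ℝ≥0∞} (w : ℕ → Y → E) (n : ℕ) :
    eLpNorm (w n) p ν ≤ eLpNorm (fun y => ⨆ n, ‖w n y‖ₑ) p ν :=
  eLpNorm_mono_enorm fun y => by
    rw [enorm_eq_self]
    exact le_iSup (fun n => ‖w n y‖ₑ) n

theorem SeqMaximalEstimate.of_bandLimited (hα : 0 < α) (hσ : 0 ≤ σ)
    (h : ∀ {g : Space d → ℂ}, BandLimited g →
      ∫⁻ x in Metric.ball 0 1, (⨆ n, ‖osc α g (t n) x‖ₑ) ^ 2 ∂μ ≤ c ^ 2 * energy σ g) :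
    SeqMaximalEstimate α t σ μ c := by
  intro f hf
  let v (N n : ℕ) : Space d → ℂ := propagatorOn α (Metric.ball 0 (N : ℝ)) f (t n)
  let τ (N : ℕ) : ℝ≥0∞ := energy σ ((Metric.ball (0 : Space d) N)ᶜ.indicator (fourierHat f))
  have hv (N n : ℕ) : StronglyMeasurable (v N n) := by
    have hband := bandLimited_ball_indicator_fourierHat hσ hf N
    simp only [v, propagatorOn_ball_eq]
    exact (continuous_const.mul
      (continuous_osc_right hα hband.integrable (t n))).stronglyMeasurable
  have hsup (N : ℕ) := eLpNorm_iSup_propagatorOn_ball_le hσ h hf N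
  have hmem (N n : ℕ) : MemLp (v N n) 2 (μ.restrict (Metric.ball 0 1)) :=
    ⟨(hv N n).aestronglyMeasurable, ((eLpNorm_le_eLpNorm_iSup_enorm (v N) n).trans
      (hsup N)).trans_lt (ENNReal.mul_lt_top ENNReal.coe_lt_top hf)⟩
  have hcauchy (k n m N : ℕ) (hn : N ≤ n) (hm : N ≤ m) :
      eLpNorm (v n k - v m k) 2 (μ.restrict (Metric.ball 0 1)) ≤ c * τ N ^ (1 / 2 : ℝ) :=
    (eLpNorm_le_eLpNorm_iSup_enorm (fun k => v n k - v m k) k).trans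
      (eLpNorm_iSup_propagatorOn_ball_sub_le hα hσ h hf (Nat.cast_le.2 hn) (Nat.cast_le.2 hm))
  have hτ : Tendsto (fun N => (c : ℝ≥0∞) * τ N ^ (1 / 2 : ℝ)) atTop (𝓝 0) := by
    have htail := tendsto_energy_tail (measurable_fourierHat f)
      (sobolevNorm_sq σ f ▸ ENNReal.pow_lt_top hf)
    simpa using ENNReal.Tendsto.const_mul (((ENNReal.continuous_rpow_const (y := 1 / 2)).tendsto
      0).comp htail) (Or.inr (ENNReal.coe_ne_top (r := c)))
  choose u hu hu2 hulim using fun k =>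
    exists_tendsto_eLpNorm_sub (fun N => hmem N k) hτ (hcauchy k)
  exact ⟨u, fun n => ⟨hu2 n, hulim n⟩, eLpNorm_iSup_le_of_tendsto hv hu hulim hsup⟩

end Density

theorem MaximalFamily.exists_seqMaximalEstimate {α γ r s : ℝ} (hα : 0 < α) (hγ : γ ≤ d)
    (hr : 0 < r) (hs : 0 < s) {t : ℕ → ℝ} (ht : MemWeakEll r t) :
    ∃ C : ℝ≥0, 0 < C ∧ ∀ {A K : ℝ≥0} {𝓜 : Set (Measure (Space d))},
    MaximalFamily α γ (((d : ℝ) - γ) / 2 + s) A K 𝓜 → ∀ {μ : Measure (Space d)}, μ ∈ 𝓜 →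
      ∀ {s' : ℝ}, min s (sTilde α r s) ≤ s' →
        SeqMaximalEstimate α t (((d : ℝ) - γ) / 2 + s') μ (C * NNReal.sqrt (A + K ^ 2)) := by
  obtain ⟨C₁, hC₁⟩ := MaximalFamily.exists_lintegral_iSup_seq_le (d := d) hα hγ hr hs ht
  obtain ⟨C₂, hC₂⟩ := MaximalEstimate.exists_lintegral_iSup_seq_le (d := d) hα hγ hs ht
  refine ⟨NNReal.sqrt (C₁ + C₂ + 1), by positivity, ?_⟩
  intro A K 𝓜 h𝓜 μ hμ s' hs'
  have hs'_nonneg : 0 ≤ s' := (lt_min hs (sTilde_pos hα hr hs)).le.trans hs'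
  refine SeqMaximalEstimate.of_bandLimited hα (by linarith) fun {g} hg => ?_
  rw [← NNReal.sqrt_mul, ← ENNReal.coe_pow, NNReal.sq_sqrt]
  push_cast
  rcases min_le_iff.1 hs' with h | h
  · refine (hC₂ (h𝓜.growth μ hμ) (h𝓜.maximal μ hμ) hg).trans
      (mul_le_mul' ?_ (energy_mono (by linarith) g))
    gcongr
    exact le_add_right le_add_self
  · refine (setLIntegral_le_lintegral _ _).trans ((hC₁ h𝓜 hμ hg).trans
      (mul_le_mul' ?_ (energy_mono (by linarith) g)))
    gcongr
    exact le_add_right le_self_add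

theorem IsDimensional.growthBound {γ : ℝ} {μ : Measure (Space d)} (h : IsDimensional γ μ) :
    GrowthBound γ μ (growthConst γ μ) := by
  have hclosed : IsClosed {C : ℝ≥0 | GrowthBound γ μ C} := by
    simp only [GrowthBound, Set.ofPred_forall]
    refine isClosed_iInter fun x => isClosed_iInter fun ρ => isClosed_iInter fun _ => ?_
    exact isClosed_le continuous_const
      ((ENNReal.continuous_mul_const ENNReal.ofReal_ne_top).comp ENNReal.continuous_coe)
  exact hclosed.csInf_mem h (OrderBot.bddBelow _)

theorem GrowthBound.rescaleMeasure {γ : ℝ} {μ : Measure (Space d)} {A : ℝ≥0}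
    (h : GrowthBound γ μ A) (x₀ : Space d) {ρ : ℝ} (hρ : 0 < ρ) :
    GrowthBound γ (rescaleMeasure γ ρ x₀ μ) A := by
  intro y R hR
  have hcancel : ENNReal.ofReal (ρ ^ (-γ)) * ENNReal.ofReal (ρ ^ γ) = 1 := by
    rw [← ENNReal.ofReal_mul (by positivity), ← Real.rpow_add hρ, neg_add_cancel, Real.rpow_zero,
      ENNReal.ofReal_one]
  rw [SeqSchrodinger.rescaleMeasure, Measure.smul_apply,
    Measure.map_apply (by fun_prop) measurableSet_ball, preimage_ball_inv_smul_sub _ _ hρ,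
    smul_eq_mul]
  calc ENNReal.ofReal (ρ ^ (-γ)) * μ (Metric.ball (x₀ + ρ • y) (ρ * R))
      ≤ ENNReal.ofReal (ρ ^ (-γ)) * (A * ENNReal.ofReal ((ρ * R) ^ γ)) := by
        gcongr
        exact h _ _ (by positivity)
    _ = (ENNReal.ofReal (ρ ^ (-γ)) * ENNReal.ofReal (ρ ^ γ)) * (A * ENNReal.ofReal (R ^ γ)) := by
        rw [Real.mul_rpow hρ.le hR.le, ENNReal.ofReal_mul (by positivity)]
        ring
    _ = A * ENNReal.ofReal (R ^ γ) := by rw [hcancel, one_mul]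

theorem MaximalEstimate.mono {α σ : ℝ} {T T' : Set ℝ} {μ : Measure (Space d)} {K K' : ℝ≥0}
    (h : MaximalEstimate α T σ μ K) (hT : T' ⊆ T) (hK : K ≤ K') : MaximalEstimate α T' σ μ K' := by
  intro f
  refine (eLpNorm_mono_enorm fun x => ?_).trans ((h f).trans (by gcongr))
  simp only [enorm_eq_self]
  exact biSup_mono hT

theorem maximalFamily_growthBound {α γ σ : ℝ} {C : ℝ≥0} (h : ∀ μ : Measure (Space d),
    IsDimensional γ μ → MaximalEstimate α (Set.Ioo 0 1) σ μ (C * NNReal.sqrt (growthConst γ μ)))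
    (A : ℝ≥0) : MaximalFamily (d := d) α γ σ A (C * NNReal.sqrt A) {μ | GrowthBound γ μ A} where
  growth _ hμ := hμ
  rescaleMeasure_mem _ hμ x₀ _ hρ := hμ.rescaleMeasure x₀ hρ
  maximal μ hμ := (h μ ⟨A, hμ⟩).mono subset_rfl <| by
    have hle : growthConst γ μ ≤ A := csInf_le (OrderBot.bddBelow _) hμ
    gcongr

theorem rescaleMeasure_volume (x₀ : Space d) {ρ : ℝ} (hρ : 0 < ρ) :
    rescaleMeasure d ρ x₀ volume = volume := by
  have hcomp : (fun x : Space d => ρ⁻¹ • (x - x₀)) = (fun x => ρ⁻¹ • x) ∘ fun x => x - x₀ := rfl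
  have hpos : 0 < ρ ^ d := by positivity
  rw [rescaleMeasure, hcomp, ← Measure.map_map (by fun_prop) (by fun_prop),
    (measurePreserving_sub_right volume x₀).map_eq, Measure.map_addHaar_smul _ (inv_ne_zero hρ.ne'),
    finrank_euclideanSpace_fin, smul_smul, ← ENNReal.ofReal_mul (by positivity), inv_pow, inv_inv,
    abs_of_pos hpos, Real.rpow_neg hρ.le, Real.rpow_natCast, inv_mul_cancel₀ hpos.ne',
    ENNReal.ofReal_one, one_smul]

theorem growthBound_volume :
    GrowthBound d (volume : Measure (Space d)) (volume (Metric.ball (0 : Space d) 1)).toNNReal := by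
  intro x ρ hρ
  rw [Measure.addHaar_ball_of_pos _ _ hρ, finrank_euclideanSpace_fin,
    ENNReal.coe_toNNReal measure_ball_lt_top.ne, mul_comm, Real.rpow_natCast]

theorem maximalFamily_volume {α σ : ℝ} {C : ℝ≥0}
    (h : MaximalEstimate (d := d) α (Set.Ioc 0 1) σ volume C) :
    MaximalFamily (d := d) α d σ (volume (Metric.ball (0 : Space d) 1)).toNNReal C {volume} where
  growth := by
    rintro _ rfl
    exact growthBound_volume
  rescaleMeasure_mem := by
    rintro _ rfl x₀ ρ hρ
    exact rescaleMeasure_volume x₀ hρ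
  maximal := by
    rintro _ rfl
    exact h.mono Set.Ioo_subset_Ioc_self le_rfl

end SeqSchrodinger

end

theorem corollary3p2 (d : ℕ) (hd : 1 ≤ d) (α r sStar : ℝ) (hα : 0 < α) (hr : 0 < r)
    (hs : 0 < sStar) :
    -- the fractal estimate
    (∀ γ : ℝ, 0 < γ → γ ≤ (d : ℝ) →
      (∃ C : ℝ≥0, ∀ μ : Measure (EuclideanSpace ℝ (Fin d)), SeqSchrodinger.IsDimensional γ μ →
        SeqSchrodinger.MaximalEstimate α (Set.Ioo 0 1) (((d : ℝ) - γ) / 2 + sStar) μ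
          (C * NNReal.sqrt (SeqSchrodinger.growthConst γ μ))) →
      ∀ t : ℕ → ℝ, SeqSchrodinger.MemWeakEll r t →
        ∃ C' : ℝ≥0, 0 < C' ∧
          ∀ s : ℝ, min sStar (SeqSchrodinger.sTilde α r sStar) ≤ s →
            ∀ μ : Measure (EuclideanSpace ℝ (Fin d)), SeqSchrodinger.IsDimensional γ μ →
              SeqSchrodinger.SeqMaximalEstimate α t (((d : ℝ) - γ) / 2 + s) μ
                (C' * NNReal.sqrt (SeqSchrodinger.growthConst γ μ)))
    ∧
    -- the consequence for Lebesgue measure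
    ((∃ C : ℝ≥0, SeqSchrodinger.MaximalEstimate (d := d) α (Set.Ioc 0 1) sStar volume C) →
      ∀ t : ℕ → ℝ, SeqSchrodinger.MemWeakEll r t →
        ∃ C' : ℝ≥0, 0 < C' ∧
          ∀ s : ℝ, min sStar (SeqSchrodinger.sTilde α r sStar) ≤ s →
            SeqSchrodinger.SeqMaximalEstimate (d := d) α t s volume C') := by
  refine ⟨fun γ _ hγ ⟨C, hC⟩ t ht => ?_, fun ⟨C, hC⟩ t ht => ?_⟩
  · obtain ⟨C', hC', hseq⟩ :=
      SeqSchrodinger.MaximalFamily.exists_seqMaximalEstimate (d := d) hα hγ hr hs ht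
    refine ⟨C' * NNReal.sqrt (1 + C ^ 2),
      mul_pos hC' (NNReal.sqrt_pos.2 (by positivity)), fun s hle μ hμ => ?_⟩
    set A := SeqSchrodinger.growthConst γ μ
    have hconst : C' * NNReal.sqrt (A + (C * NNReal.sqrt A) ^ 2) =
        C' * NNReal.sqrt (1 + C ^ 2) * NNReal.sqrt A := by
      rw [mul_assoc, ← NNReal.sqrt_mul, mul_pow, NNReal.sq_sqrt, add_mul, one_mul]
    rw [← hconst]
    exact hseq (SeqSchrodinger.maximalFamily_growthBound hC A) hμ.growthBound hle
  · obtain ⟨C', hC', hseq⟩ :=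
      SeqSchrodinger.MaximalFamily.exists_seqMaximalEstimate (d := d) hα le_rfl hr hs ht
    have hfull (σ : ℝ) : ((d : ℝ) - d) / 2 + σ = σ := by ring
    simp only [hfull] at hseq
    have hA : 0 < (volume (Metric.ball (0 : EuclideanSpace ℝ (Fin d)) 1)).toNNReal :=
      ENNReal.toNNReal_pos (Metric.measure_ball_pos _ _ one_pos).ne' measure_ball_lt_top.ne
    exact ⟨_, mul_pos hC' (NNReal.sqrt_pos.2 (by positivity)),
      fun s hle => hseq (SeqSchrodinger.maximalFamily_volume hC) rfl hle⟩
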